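/- Let $\mu$ be a $\sigma$-finite measure on a measurable space $\Omega$, let $F_0,F_1$ be probability distributions with densities $f_0,f_1>0$ ($\mu$-a.e.), let $\epsilon_0,\epsilon_1>0$, and let $\mathscr G_j=\{G: D_{\mathrm{KL}}(G,F_j)\le\epsilon_j\}$, $j\in\{0,1\}$, where $D_{\mathrm{KL}}(G,F)=\int_\Omega\log(g/f)\,g\,d\mu$. Lower case letters denote densities with respect to $\mu$, and densities are identified when they agree $\mu$-a.e. Assume that $\mathscr G_0\cap\mathscr G_1=\emptyset$. For $u\in(0,1)$ let $D_u(G_0,G_1)=\int_\Omega g_1^{u}g_0^{1-u}\,d\mu$. Consider the problem of finding $\hat u\in(0,1)$ and $\hat g_0,\hat g_1$ such that, with $u=\hat u$, $$\hat g_0\in\arg\sup_{G_0\in\mathscr G_0,\ g_0>0}D_u(G_0,\hat G_1),\qquad \hat g_1\in\arg\sup_{G_1\in\mathscr G_1,\ g_1>0}D_u(\hat G_0,G_1),\qquad \hat u\in\arg\min_{v\in(0,1)}D_v(\hat G_0,\hat G_1).\tag{P}$$ The first two conditions, for a given $u$, are called the maximization stage at $u$. (i) For every $u\in(0,1)$ the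 maximization stage at $u$ has exactly one solution $(\hat g_0,\hat g_1)$; it also maximizes $D_u$ jointly over $\mathscr G_0\times\mathscr G_1$. There are $\lambda_0,\lambda_1>0$ and $\mu_0,\mu_1\in\mathbb R$ which are KKT multipliers of the two maximization problems ($\lambda_j$ for the constraint $D_{\mathrm{KL}}(G_j,F_j)\le\epsilon_j$, $\mu_j$ for $\int g_j\,d\mu=1$), in the sense that complementary slackness holds and that $\hat g_0$ and $\hat g_1$ maximize, over the positive integrable functions $g_0$, respectively $g_1$, with finite $\int\log(g_j/f_j)g_j\,d\mu$, the Lagrangians $$D_u(G_0,\hat G_1)+\lambda_0\big(\epsilon_0-D_{\mathrm{KL}}(G_0,F_0)\big)+\mu_0\Big(1-\int g_0\,d\mu\Big),\qquad D_u(\hat G_0,G_1)+\lambda_1\big(\epsilon_1-D_{\mathrm{KL}}(G_1,F_1)\big)+\mu_1\Big(1-\int g_1\,d\mu\Big).$$ With these multipliers, $\mu$-a.e., $$\hat g_0=\exp\!\left[\tfrac{-\lambda_0-\mu_0}{\lambda_0}\right]\exp\!\left[\tfrac{(1-u)(\hat g_1/\hat g_0)^u}{\lambda_0}\right]f_0,\qquad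 \hat g_1=\exp\!\left[\tfrac{-\lambda_1-\mu_1}{\lambda_1}\right]\exp\!\left[\tfrac{u(\hat g_1/\hat g_0)^{-1+u}}{\lambda_1}\right]f_1,$$ $$\frac{\hat g_1}{\hat g_0}=\exp\!\left[\tfrac{-\mu_1}{\lambda_1}+\tfrac{\mu_0}{\lambda_0}\right]\exp\!\left[\tfrac{u(\hat g_1/\hat g_0)^{-1+u}}{\lambda_1}+\tfrac{(-1+u)(\hat g_1/\hat g_0)^{u}}{\lambda_0}\right]\frac{f_1}{f_0}.$$ (ii) For every $u\in(0,1)$ put, for $\lambda_0,\lambda_1>0$ and a measurable $\ell>0$, $r_0=\exp[(1-u)\ell^u/\lambda_0]$, $r_1=\exp[u\ell^{-1+u}/\lambda_1]$ and $s_j=\int_\Omega r_jf_j\,d\mu$. The multipliers in (i), together with the robust likelihood ratio $\ell=\hat g_1/\hat g_0$, satisfy, with all integrals finite, $$\int_\Omega r_0\log(r_0/s_0)\frac{f_0}{s_0}\,d\mu=\epsilon_0,\qquad \int_\Omega r_1\log(r_1/s_1)\frac{f_1}{s_1}\,d\mu=\epsilon_1,\qquad \ell=\frac{r_1s_0}{r_0s_1}\cdot\frac{f_1}{f_0}\quad\mu\text{-a.e.},$$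 and this system has no other solution $(\lambda_0,\lambda_1,\ell)$ ($\ell$ up to $\mu$-null sets). The multipliers $\mu_0,\mu_1$ are then determined by $s_j=\exp[(\lambda_j+\mu_j)/\lambda_j]$. (iii) Problem (P) has exactly one solution $(\hat u,\hat g_0,\hat g_1)$, and $\hat g_0,\hat g_1$ have the forms in (i) with $u=\hat u$ and KKT multipliers $\lambda_0,\lambda_1>0$, $\mu_0,\mu_1$. Moreover $\hat u$ is the unique minimizer over $u\in(0,1)$ of the value of $D_u$ at the solution of the maximization stage at $u$. -/

import Mathlib

open MeasureTheory Set

namespace RobustTest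

variable {Ω : Type*} [MeasurableSpace Ω]

/-- `g` is a probability density with respect to the dominating measure `μ`. -/
structure IsProbDensity (μ : Measure Ω) (g : Ω → ℝ) : Prop where
  measurable : Measurable g
  nonneg : ∀ᵐ x ∂μ, 0 ≤ g x
  integrable : Integrable g μ
  integral_eq_one : ∫ x, g x ∂μ = 1

/-- The probability distribution `G` with density `g`, i.e. `dG = g dμ`. -/
noncomputable def distOf (μ : Measure Ω) (g : Ω → ℝ) : Measure Ω :=
  μ.withDensity (fun x => ENNReal.ofReal (g x))

/-- The uncertainty class `{G : D_KL(G, F) ≤ ε}` around the distribution `F` with density `f`,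
described through the densities of its members. Every `G` with `D_KL(G, F) < ∞` is absolutely
continuous with respect to `F`, hence has a density with respect to `μ`. -/
def klClass (μ : Measure Ω) (f : Ω → ℝ) (ε : ℝ) : Set (Ω → ℝ) :=
  {g | IsProbDensity μ g ∧
    InformationTheory.klDiv (distOf μ g) (distOf μ f) ≤ ENNReal.ofReal ε}

/-- The members of the uncertainty class whose density is strictly positive. -/
def klClassPos (μ : Measure Ω) (f : Ω → ℝ) (ε : ℝ) : Set (Ω → ℝ) :=
  {g | g ∈ klClass μ f ε ∧ ∀ᵐ x ∂μ, 0 < g x}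

/-- The `u`-affinity `D_u(G₀, G₁) = ∫ g₁ ^ u * g₀ ^ (1 - u) dμ`. -/
noncomputable def affinity (μ : Measure Ω) (u : ℝ) (g₀ g₁ : Ω → ℝ) : ℝ :=
  ∫ x, g₁ x ^ u * g₀ x ^ (1 - u) ∂μ

/-- The maximization stage for a given `u`: the two coupled constrained problems
`g₀ ∈ arg sup D_u(·, g₁)` and `g₁ ∈ arg sup D_u(g₀, ·)`, each over the strictly positive
densities in the corresponding uncertainty class. -/
structure SolvesMaximization (μ : Measure Ω) (f₀ f₁ : Ω → ℝ) (ε₀ ε₁ u : ℝ)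
    (g₀ g₁ : Ω → ℝ) : Prop where
  mem₀ : g₀ ∈ klClassPos μ f₀ ε₀
  mem₁ : g₁ ∈ klClassPos μ f₁ ε₁
  max₀ : ∀ h ∈ klClassPos μ f₀ ε₀, affinity μ u h g₁ ≤ affinity μ u g₀ g₁
  max₁ : ∀ h ∈ klClassPos μ f₁ ε₁, affinity μ u g₀ h ≤ affinity μ u g₀ g₁

/-- The max-min `u`-affinity problem: for the minimizing `u`, the pair `(g₀, g₁)` solves the
maximization stage, and for this pair, `u` minimizes the affinity over `(0, 1)`. -/
structure SolvesMaxMin (μ : Measure Ω) (f₀ f₁ : Ω → ℝ) (ε₀ ε₁ u : ℝ)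
    (g₀ g₁ : Ω → ℝ) : Prop where
  mem_Ioo : u ∈ Ioo (0 : ℝ) 1
  maximization : SolvesMaximization μ f₀ f₁ ε₀ ε₁ u g₀ g₁
  minimization : ∀ v ∈ Ioo (0 : ℝ) 1, affinity μ u g₀ g₁ ≤ affinity μ v g₀ g₁

/-- The KL-divergence written with densities, `∫ log (g / f) * g dμ`, also used for positive
functions `g` which are not normalized. -/
noncomputable def klInt (μ : Measure Ω) (g f : Ω → ℝ) : ℝ :=
  ∫ x, Real.log (g x / f x) * g x ∂μ

/-- The Lagrangian `L₀ = D_u(G₀, G₁) + lam₀ (ε₀ - D_KL(G₀, F₀)) + mu₀ (1 - ∫ g₀ dμ)`. -/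
noncomputable def lagrangian₀ (μ : Measure Ω) (f₀ : Ω → ℝ) (ε₀ u : ℝ) (g₀ g₁ : Ω → ℝ)
    (lam₀ mu₀ : ℝ) : ℝ :=
  affinity μ u g₀ g₁ + lam₀ * (ε₀ - klInt μ g₀ f₀) + mu₀ * (1 - ∫ x, g₀ x ∂μ)

/-- The Lagrangian `L₁ = D_u(G₀, G₁) + lam₁ (ε₁ - D_KL(G₁, F₁)) + mu₁ (1 - ∫ g₁ dμ)`. -/
noncomputable def lagrangian₁ (μ : Measure Ω) (f₁ : Ω → ℝ) (ε₁ u : ℝ) (g₀ g₁ : Ω → ℝ)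
    (lam₁ mu₁ : ℝ) : ℝ :=
  affinity μ u g₀ g₁ + lam₁ * (ε₁ - klInt μ g₁ f₁) + mu₁ * (1 - ∫ x, g₁ x ∂μ)

/-- The domain of the Lagrangian: strictly positive integrable functions, not necessarily
normalized, for which the KL-integral is finite. -/
structure InLagrangianDomain (μ : Measure Ω) (f g : Ω → ℝ) : Prop where
  measurable : Measurable g
  pos : ∀ᵐ x ∂μ, 0 < g x
  integrable : Integrable g μ
  integrable_kl : Integrable (fun x => Real.log (g x / f x) * g x) μ

/-- `lam₀, mu₀, lam₁, mu₁` are KKT multipliers of the two coupled problems at `(g₀, g₁)`: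
the multipliers of the inequality constraints are nonnegative, complementary slackness holds, and
`g₀` and `g₁` maximize the (concave) Lagrangians `L₀(·, g₁)` and `L₁(g₀, ·)`. -/
structure AreKKTMultipliers (μ : Measure Ω) (f₀ f₁ : Ω → ℝ) (ε₀ ε₁ u : ℝ) (g₀ g₁ : Ω → ℝ)
    (lam₀ mu₀ lam₁ mu₁ : ℝ) : Prop where
  dom₀ : InLagrangianDomain μ f₀ g₀
  dom₁ : InLagrangianDomain μ f₁ g₁
  nonneg₀ : 0 ≤ lam₀
  nonneg₁ : 0 ≤ lam₁
  slack₀ : lam₀ * (ε₀ - klInt μ g₀ f₀) = 0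
  slack₁ : lam₁ * (ε₁ - klInt μ g₁ f₁) = 0
  max₀ : ∀ h, InLagrangianDomain μ f₀ h →
    lagrangian₀ μ f₀ ε₀ u h g₁ lam₀ mu₀ ≤ lagrangian₀ μ f₀ ε₀ u g₀ g₁ lam₀ mu₀
  max₁ : ∀ h, InLagrangianDomain μ f₁ h →
    lagrangian₁ μ f₁ ε₁ u g₀ h lam₁ mu₁ ≤ lagrangian₁ μ f₁ ε₁ u g₀ g₁ lam₁ mu₁

/-- The exponential parametric forms of the densities, coupled through the likelihood ratio
`g₁ / g₀`, and the resulting functional equation for `g₁ / g₀` (with `f₁ / f₀` the nominal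
likelihood ratio). -/
structure HasParametricForm (μ : Measure Ω) (f₀ f₁ : Ω → ℝ) (u : ℝ) (g₀ g₁ : Ω → ℝ)
    (lam₀ mu₀ lam₁ mu₁ : ℝ) : Prop where
  form₀ : ∀ᵐ x ∂μ, g₀ x = Real.exp ((-lam₀ - mu₀) / lam₀) *
    Real.exp ((1 - u) * (g₁ x / g₀ x) ^ u / lam₀) * f₀ x
  form₁ : ∀ᵐ x ∂μ, g₁ x = Real.exp ((-lam₁ - mu₁) / lam₁) *
    Real.exp (u * (g₁ x / g₀ x) ^ (-1 + u) / lam₁) * f₁ x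
  ratio : ∀ᵐ x ∂μ, g₁ x / g₀ x = Real.exp (-mu₁ / lam₁ + mu₀ / lam₀) *
    Real.exp (u * (g₁ x / g₀ x) ^ (-1 + u) / lam₁ + (-1 + u) * (g₁ x / g₀ x) ^ u / lam₀) *
    (f₁ x / f₀ x)

/-- `r₀(lam₀, l) = exp ((1 - u) l ^ u / lam₀)`. -/
noncomputable def r₀ (u lam₀ : ℝ) (l : Ω → ℝ) (x : Ω) : ℝ :=
  Real.exp ((1 - u) * l x ^ u / lam₀)

/-- `r₁(lam₁, l) = exp (u l ^ (-1 + u) / lam₁)`. -/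
noncomputable def r₁ (u lam₁ : ℝ) (l : Ω → ℝ) (x : Ω) : ℝ :=
  Real.exp (u * l x ^ (-1 + u) / lam₁)

/-- `s₀ = ∫ r₀ f₀ dμ`. -/
noncomputable def s₀ (μ : Measure Ω) (f₀ : Ω → ℝ) (u lam₀ : ℝ) (l : Ω → ℝ) : ℝ :=
  ∫ x, r₀ u lam₀ l x * f₀ x ∂μ

/-- `s₁ = ∫ r₁ f₁ dμ`. -/
noncomputable def s₁ (μ : Measure Ω) (f₁ : Ω → ℝ) (u lam₁ : ℝ) (l : Ω → ℝ) : ℝ :=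
  ∫ x, r₁ u lam₁ l x * f₁ x ∂μ

/-- The system of three equations for the unknowns `lam₀, lam₁ > 0` and the positive function
`l` (the robust likelihood ratio). -/
structure SolvesSystem (μ : Measure Ω) (f₀ f₁ : Ω → ℝ) (ε₀ ε₁ u lam₀ lam₁ : ℝ)
    (l : Ω → ℝ) : Prop where
  lam₀_pos : 0 < lam₀
  lam₁_pos : 0 < lam₁
  aemeasurable : AEMeasurable l μ
  pos : ∀ᵐ x ∂μ, 0 < l x
  integrable₀ : Integrable (fun x => r₀ u lam₀ l x * f₀ x) μ
  integrable₁ : Integrable (fun x => r₁ u lam₁ l x * f₁ x) μ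
  integrable_log₀ : Integrable (fun x => r₀ u lam₀ l x *
    Real.log (r₀ u lam₀ l x / s₀ μ f₀ u lam₀ l) * f₀ x / s₀ μ f₀ u lam₀ l) μ
  integrable_log₁ : Integrable (fun x => r₁ u lam₁ l x *
    Real.log (r₁ u lam₁ l x / s₁ μ f₁ u lam₁ l) * f₁ x / s₁ μ f₁ u lam₁ l) μ
  eq₀ : ∫ x, r₀ u lam₀ l x * Real.log (r₀ u lam₀ l x / s₀ μ f₀ u lam₀ l) * f₀ x /
    s₀ μ f₀ u lam₀ l ∂μ = ε₀
  eq₁ : ∫ x, r₁ u lam₁ l x * Real.log (r₁ u lam₁ l x / s₁ μ f₁ u lam₁ l) * f₁ x /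
    s₁ μ f₁ u lam₁ l ∂μ = ε₁
  eq_ratio : ∀ᵐ x ∂μ, l x = (r₁ u lam₁ l x * s₀ μ f₀ u lam₀ l) /
    (r₀ u lam₀ l x * s₁ μ f₁ u lam₁ l) * (f₁ x / f₀ x)

end RobustTest

/-!
The `u`-affinity is jointly concave in the pair of densities and the divergence classes are convex,
so the two coupled maximizations form one concave problem. Everything rests on the tangent
inequality `b ^ u * a ^ (1 - u) ≤ (1 - u) * l ^ u * a + u * l ^ (u - 1) * b`, an equality on the ray
`b = l * a`: because the affinity is homogeneous of degree one and differentiable at positive pairs,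
a pair that is optimal in each variable separately is optimal jointly
(`SolvesMaximization.isJointMax`).

*Existence.* The Kullback-Leibler divergence is uniformly convex for the Hellinger distance
(`klInt_midpoint_le`). Selecting near-minimizers of the sum of the two divergences from a decreasing
sequence of convex sets therefore gives a Cauchy sequence of square roots in `L²`; together with
Fatou's lemma this replaces weak compactness (`exists_tendsto_of_nested`, `exists_affinity_ge`).
Since the classes are disjoint, the maximal affinity is below one.

*Multipliers.* Separation in `ℝ³` gives multipliers of the two divergence constraints
(`IsJointMax.exists_multipliers`). A vanishing multiplier would let one density approach the other
at no cost and push the affinity to one, so both multipliers are positive and both constraints are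
active. Strict convexity of the divergence then gives uniqueness (`IsJointMax.ae_eq`), its infinite
slope at zero gives positivity (`IsLagrangeMax.pos₀`), and first variations give the stationarity
conditions (`IsLagrangeMax.stationary`), which are the exponential forms. Conversely, Gibbs'
inequality and the tangent inequality turn stationarity into joint optimality
(`IsStationary.isJointMax`); a solution of the system of equations is a stationary pair, whence its
uniqueness.

*The exponent.* The maximal affinity is a convex function of `u`, is below one inside `(0, 1)`, and
is bounded below near the endpoints by the affinity of `f₀` and `f₁`, which tends to one there; so
it
has a minimizer. Applying `exists_affinity_ge` to the affinities at two exponents shows that the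
maximizing pair at the minimizer is a saddle point (`IsJointMax.saddle`), and strict convexity of
the affinity in `u` makes the minimizer unique.
-/

namespace RobustTest

/-! ### Pointwise inequalities -/

theorem rpow_mul_rpow_le {u a b : ℝ} (hu : u ∈ Ioo (0 : ℝ) 1) (ha : 0 ≤ a) (hb : 0 ≤ b) :
    b ^ u * a ^ (1 - u) ≤ (1 - u) * a + u * b := by
  have := Real.geom_mean_le_arith_mean2_weighted hu.1.le (sub_nonneg.2 hu.2.le) hb ha (by ring)
  linarith

theorem eq_of_rpow_mul_rpow_eq {u a b : ℝ} (hu : u ∈ Ioo (0 : ℝ) 1) (ha : 0 ≤ a) (hb : 0 ≤ b)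
    (h : b ^ u * a ^ (1 - u) = (1 - u) * a + u * b) : a = b := by
  obtain ⟨hu0, hu1⟩ := hu
  have hv : 0 < 1 - u := by linarith
  rcases ha.eq_or_lt with rfl | ha
  · rw [Real.zero_rpow hv.ne'] at h
    nlinarith
  rcases hb.eq_or_lt with rfl | hb
  · rw [Real.zero_rpow hu0.ne'] at h
    nlinarith
  by_contra hne
  have hlog := strictConcaveOn_log_Ioi.2 (Set.mem_Ioi.2 ha) (Set.mem_Ioi.2 hb) hne hv hu0 (by ring)
  simp only [smul_eq_mul] at hlog
  rw [← h, Real.log_mul (by positivity) (by positivity), Real.log_rpow hb, Real.log_rpow ha]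
    at hlog
  linarith

/-- The graph of the weighted geometric mean lies below its tangent plane at any point of slope
`l`, i.e. at any positive `(m₀, m₁)` with `m₁ / m₀ = l`. -/
theorem rpow_mul_rpow_le_tangent {u a b l : ℝ} (hu : u ∈ Ioo (0 : ℝ) 1) (ha : 0 ≤ a)
    (hb : 0 ≤ b) (hl : 0 < l) :
    b ^ u * a ^ (1 - u) ≤ (1 - u) * l ^ u * a + u * l ^ (-1 + u) * b := by
  have h := rpow_mul_rpow_le hu ha (div_nonneg hb hl.le)
  rw [Real.div_rpow hb hl.le] at h
  have hlu : 0 < l ^ u := Real.rpow_pos_of_pos hl u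
  have e : l ^ (-1 + u) = l ^ u / l := by
    rw [add_comm, ← sub_eq_add_neg, Real.rpow_sub_one hl.ne']
  rw [e]
  have h2 := mul_le_mul_of_nonneg_left h hlu.le
  calc b ^ u * a ^ (1 - u) = l ^ u * (b ^ u / l ^ u * a ^ (1 - u)) := by field_simp
    _ ≤ _ := h2
    _ = _ := by ring

theorem rpow_mul_rpow_eq_ratio {u a b : ℝ} (ha : 0 < a) (hb : 0 ≤ b) :
    b ^ u * a ^ (1 - u) = (b / a) ^ u * a := by
  rw [Real.div_rpow hb ha.le, Real.rpow_sub ha, Real.rpow_one]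
  field_simp

theorem rpow_mul_rpow_eq_ratio' {u a b : ℝ} (ha : 0 < a) (hb : 0 < b) :
    b ^ u * a ^ (1 - u) = (b / a) ^ (-1 + u) * b := by
  rw [rpow_mul_rpow_eq_ratio ha hb.le, Real.rpow_add (by positivity), Real.rpow_neg_one]
  field_simp

/-- Joint concavity of the weighted geometric mean. -/
theorem rpow_mul_rpow_concave {u a b a' b' t s : ℝ} (hu : u ∈ Ioo (0 : ℝ) 1) (ha : 0 ≤ a)
    (hb : 0 ≤ b) (ha' : 0 ≤ a') (hb' : 0 ≤ b') (ht : 0 ≤ t) (hs : 0 ≤ s) :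
    t * (b ^ u * a ^ (1 - u)) + s * (b' ^ u * a' ^ (1 - u)) ≤
      (t * b + s * b') ^ u * (t * a + s * a') ^ (1 - u) := by
  obtain ⟨hu0, hu1⟩ := id hu
  have hv : 1 - u ≠ 0 := by linarith
  have h0 : 0 ≤ (t * b + s * b') ^ u * (t * a + s * a') ^ (1 - u) := by positivity
  have hA : 0 ≤ t * a + s * a' := by positivity
  have hB : 0 ≤ t * b + s * b' := by positivity
  have zero : ∀ {p q : ℝ}, p * q = 0 → ∀ w : ℝ, w ≠ 0 → p * q ^ w = 0 := by
    intro p q hpq w hw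
    rcases mul_eq_zero.1 hpq with rfl | rfl
    · simp
    · rw [Real.zero_rpow hw, mul_zero]
  rcases hA.eq_or_lt with hA | hA
  · have h1 : t * a = 0 := by nlinarith [mul_nonneg ht ha, mul_nonneg hs ha']
    have h2 : s * a' = 0 := by nlinarith [mul_nonneg ht ha, mul_nonneg hs ha']
    have e1 := zero h1 _ hv
    have e2 := zero h2 _ hv
    calc _ = b ^ u * (t * a ^ (1 - u)) + b' ^ u * (s * a' ^ (1 - u)) := by ring
      _ ≤ _ := by rw [e1, e2]; simpa using h0
  rcases hB.eq_or_lt with hB | hB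
  · have h1 : t * b = 0 := by nlinarith [mul_nonneg ht hb, mul_nonneg hs hb']
    have h2 : s * b' = 0 := by nlinarith [mul_nonneg ht hb, mul_nonneg hs hb']
    have e1 := zero h1 _ hu0.ne'
    have e2 := zero h2 _ hu0.ne'
    calc _ = (t * b ^ u) * a ^ (1 - u) + (s * b' ^ u) * a' ^ (1 - u) := by ring
      _ ≤ _ := by rw [e1, e2]; simpa using h0
  set A := t * a + s * a' with hAdef
  set B := t * b + s * b' with hBdef
  have hl : 0 < B / A := by positivity
  have h1 := mul_le_mul_of_nonneg_left (rpow_mul_rpow_le_tangent hu ha hb hl) ht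
  have h2 := mul_le_mul_of_nonneg_left (rpow_mul_rpow_le_tangent hu ha' hb' hl) hs
  have e1 := rpow_mul_rpow_eq_ratio (u := u) hA hB.le
  have e2 := rpow_mul_rpow_eq_ratio' (u := u) hA hB
  calc _ ≤ (1 - u) * ((B / A) ^ u * A) + u * ((B / A) ^ (-1 + u) * B) := by
        refine (add_le_add h1 h2).trans (le_of_eq ?_)
        rw [hAdef, hBdef]; ring
    _ = _ := by rw [← e1, ← e2]; ring

/-- Gibbs' inequality, pointwise. -/
theorem log_div_mul_le {f h k : ℝ} (hf : 0 < f) (hh : 0 < h) (hk : 0 ≤ k) :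
    Real.log (h / f) * k ≤ Real.log (k / f) * k + h - k := by
  rcases hk.eq_or_lt with rfl | hk
  · simp [hh.le]
  have h1 := Real.log_le_sub_one_of_pos (div_pos hh hk)
  rw [Real.log_div hh.ne' hk.ne'] at h1
  rw [Real.log_div hh.ne' hf.ne', Real.log_div hk.ne' hf.ne']
  have h2 := mul_le_mul_of_nonneg_right h1 hk.le
  have h3 : (h / k - 1) * k = h - k := by field_simp
  nlinarith

theorem sub_le_log_div_mul {f k : ℝ} (hf : 0 < f) (hk : 0 ≤ k) :
    k - f ≤ Real.log (k / f) * k := by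
  have := log_div_mul_le hf hf hk
  rw [div_self hf.ne', Real.log_one] at this
  linarith

theorem log_div_mul_convex {f a b t s : ℝ} (hf : 0 < f) (ha : 0 ≤ a) (hb : 0 ≤ b) (ht : 0 ≤ t)
    (hs : 0 ≤ s) (hts : t + s = 1) :
    Real.log ((t * a + s * b) / f) * (t * a + s * b) ≤
      t * (Real.log (a / f) * a) + s * (Real.log (b / f) * b) := by
  have hm : 0 ≤ t * a + s * b := by positivity
  rcases hm.eq_or_lt with hm | hm
  · have h1 : t * a = 0 := by nlinarith [mul_nonneg ht ha, mul_nonneg hs hb]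
    have h2 : s * b = 0 := by nlinarith [mul_nonneg ht ha, mul_nonneg hs hb]
    have e : t * (Real.log (a / f) * a) + s * (Real.log (b / f) * b) =
      (t * a) * Real.log (a / f) + (s * b) * Real.log (b / f) := by ring
    rw [e, h1, h2]; simp
  have h1 := mul_le_mul_of_nonneg_left (log_div_mul_le hf hm ha) ht
  have h2 := mul_le_mul_of_nonneg_left (log_div_mul_le hf hm hb) hs
  nlinarith

/-- Uniform convexity of `a ↦ a log (a / f)` with respect to the Hellinger distance. -/
theorem log_div_mul_midpoint {f a b : ℝ} (hf : 0 < f) (ha : 0 ≤ a) (hb : 0 ≤ b) :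
    Real.log ((1 / 2 * a + 1 / 2 * b) / f) * (1 / 2 * a + 1 / 2 * b) +
      (Real.sqrt a - Real.sqrt b) ^ 2 / 4 ≤
      1 / 2 * (Real.log (a / f) * a) + 1 / 2 * (Real.log (b / f) * b) := by
  have hm : 0 ≤ 1 / 2 * a + 1 / 2 * b := by positivity
  rcases hm.eq_or_lt with hm | hm
  · have h1 : a = 0 := by linarith
    have h2 : b = 0 := by linarith
    simp [h1, h2]
  set m := 1 / 2 * a + 1 / 2 * b with hmdef
  -- `a log (a / m) = -2 a log √(m / a) ≥ 2 a - 2 √(a m)`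
  have key : ∀ c : ℝ, 0 ≤ c → Real.log (m / f) * c + 2 * c - 2 * (Real.sqrt c * Real.sqrt m) ≤
      Real.log (c / f) * c := by
    intro c hc
    rcases hc.eq_or_lt with rfl | hc
    · simp
    have hsc : 0 < Real.sqrt c := Real.sqrt_pos.2 hc
    have hsm : 0 < Real.sqrt m := Real.sqrt_pos.2 hm
    have h1 := Real.log_le_sub_one_of_pos (div_pos hsm hsc)
    rw [Real.log_div hsm.ne' hsc.ne', Real.log_sqrt hm.le, Real.log_sqrt hc.le] at h1
    rw [Real.log_div hm.ne' hf.ne', Real.log_div hc.ne' hf.ne']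
    have h2 := mul_le_mul_of_nonneg_right h1 hc.le
    have h3 : (Real.sqrt m / Real.sqrt c - 1) * c = Real.sqrt c * Real.sqrt m - c := by
      have := Real.mul_self_sqrt hc.le
      field_simp
      nlinarith
    nlinarith
  have h1 := key a ha
  have h2 := key b hb
  have ea := Real.sq_sqrt ha
  have eb := Real.sq_sqrt hb
  have em := Real.sq_sqrt hm.le
  have e : Real.log (m / f) * m = 1 / 2 * (Real.log (m / f) * a) + 1 / 2 * (Real.log (m / f) * b) := by
    rw [hmdef]; ring
  have e2 : 2 * Real.sqrt m ^ 2 = Real.sqrt a ^ 2 + Real.sqrt b ^ 2 := by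
    rw [em, ea, eb, hmdef]; ring
  nlinarith [sq_nonneg (Real.sqrt a + Real.sqrt b - 2 * Real.sqrt m)]

theorem one_add_rpow_ge {a x : ℝ} (ha : a ∈ Ioo (0 : ℝ) 1) (hx : |x| ≤ 1 / 2) :
    1 + a * x - x ^ 2 ≤ (1 + x) ^ a := by
  obtain ⟨h1, h2⟩ := abs_le.1 hx
  obtain ⟨ha0, ha1⟩ := ha
  have hpos : 0 < 1 + x := by linarith
  have hB := rpow_one_add_le_one_add_mul_self (s := x) (by linarith) (p := 1 - a)
    (by linarith) (by linarith)
  have hpp : 0 < (1 + x) ^ a := Real.rpow_pos_of_pos hpos a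
  have e : (1 + x) ^ a * (1 + x) ^ (1 - a) = 1 + x := by
    rw [← Real.rpow_add hpos]; simp
  have hD : 0 < 1 + (1 - a) * x := by nlinarith
  have h3 : 1 + x ≤ (1 + x) ^ a * (1 + (1 - a) * x) := by
    calc 1 + x = (1 + x) ^ a * (1 + x) ^ (1 - a) := e.symm
      _ ≤ _ := mul_le_mul_of_nonneg_left hB hpp.le
  have h4 : (1 + a * x - x ^ 2) * (1 + (1 - a) * x) ≤ 1 + x := by
    have : 0 ≤ x ^ 2 * (1 - a * (1 - a) + (1 - a) * x) := by
      apply mul_nonneg (sq_nonneg x)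
      nlinarith
    nlinarith
  exact le_of_mul_le_mul_right (h4.trans h3) hD

theorem one_add_mul_log_le {x : ℝ} (hx : -1 < x) :
    (1 + x) * Real.log (1 + x) ≤ x + x ^ 2 := by
  have := mul_le_mul_of_nonneg_left (Real.log_le_sub_one_of_pos (x := 1 + x) (by linarith))
    (by linarith : 0 ≤ 1 + x)
  nlinarith

/-! ### Divergence and affinity of densities -/

open Filter Topology

/-- `g` is a probability density whose Kullback-Leibler divergence from `f` is finite. -/
structure HasFiniteKL {Ω : Type*} [MeasurableSpace Ω] (μ : Measure Ω) (f g : Ω → ℝ) : Prop where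
  density : IsProbDensity μ g
  integrable_kl : Integrable (fun x => Real.log (g x / f x) * g x) μ

section Densities

variable {Ω : Type*} [MeasurableSpace Ω] {μ : Measure Ω} {f g h g₀ g₁ h₀ h₁ : Ω → ℝ} {ε u t s : ℝ}

theorem IsProbDensity.combo (hg : IsProbDensity μ g) (hh : IsProbDensity μ h) (ht : 0 ≤ t)
    (hs : 0 ≤ s) (hts : t + s = 1) : IsProbDensity μ (fun x => t * g x + s * h x) where
  measurable := (hg.measurable.const_mul t).add (hh.measurable.const_mul s)
  nonneg := by
    filter_upwards [hg.nonneg, hh.nonneg] with x h1 h2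
    positivity
  integrable := (hg.integrable.const_mul t).add (hh.integrable.const_mul s)
  integral_eq_one := by
    rw [integral_add (hg.integrable.const_mul t) (hh.integrable.const_mul s), integral_const_mul,
      integral_const_mul, hg.integral_eq_one, hh.integral_eq_one]
    linarith

theorem IsProbDensity.of_integral_pos (hm : Measurable g) (h0 : ∀ᵐ x ∂μ, 0 ≤ g x)
    (hi : Integrable g μ) (hpos : 0 < ∫ x, g x ∂μ) :
    IsProbDensity μ (fun x => g x / ∫ y, g y ∂μ) where
  measurable := hm.div_const _
  nonneg := by
    filter_upwards [h0] with x hx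
    positivity
  integrable := hi.div_const _
  integral_eq_one := by
    rw [integral_div, div_self hpos.ne']

theorem measurable_kl (hf : Measurable f) (hg : Measurable g) :
    Measurable (fun x => Real.log (g x / f x) * g x) :=
  (Real.measurable_log.comp (hg.div hf)).mul hg

theorem isFiniteMeasure_distOf (hg : IsProbDensity μ g) : IsFiniteMeasure (distOf μ g) :=
  isFiniteMeasure_withDensity_ofReal hg.integrable.2

/-- The divergence through densities. Adding `f - g`, of total integral zero, makes the integrand
nonnegative, so that the formula holds without any integrability assumption. -/
theorem klDiv_distOf (hf : IsProbDensity μ f) (hfp : ∀ᵐ x ∂μ, 0 < f x)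
    (hg : IsProbDensity μ g) :
    InformationTheory.klDiv (distOf μ g) (distOf μ f) =
      ∫⁻ x, ENNReal.ofReal (Real.log (g x / f x) * g x + f x - g x) ∂μ := by
  have := isFiniteMeasure_distOf hf
  have := isFiniteMeasure_distOf hg
  have mf : Measurable fun x => ENNReal.ofReal (f x) := hf.measurable.ennreal_ofReal
  have mgf : Measurable fun x => ENNReal.ofReal (g x / f x) :=
    (hg.measurable.div hf.measurable).ennreal_ofReal
  have e : distOf μ g = (distOf μ f).withDensity (fun x => ENNReal.ofReal (g x / f x)) := by
    unfold distOf
    rw [← withDensity_mul _ mf mgf]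
    refine withDensity_congr_ae ?_
    filter_upwards [hfp] with x hx
    rw [Pi.mul_apply, ← ENNReal.ofReal_mul hx.le, mul_div_cancel₀ _ hx.ne']
  have hac : distOf μ g ≪ distOf μ f := by
    rw [e]; exact withDensity_absolutelyContinuous _ _
  rw [InformationTheory.klDiv_eq_lintegral_klFun_of_ac hac]
  have hrn : (distOf μ g).rnDeriv (distOf μ f) =ᵐ[distOf μ f]
      fun x => ENNReal.ofReal (g x / f x) := by
    conv_lhs => rw [e]
    exact Measure.rnDeriv_withDensity _ mgf
  have h1 : ∫⁻ x, ENNReal.ofReal (InformationTheory.klFun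
      ((distOf μ g).rnDeriv (distOf μ f) x).toReal) ∂(distOf μ f) =
      ∫⁻ x, ENNReal.ofReal (InformationTheory.klFun
        (ENNReal.ofReal (g x / f x)).toReal) ∂(distOf μ f) := by
    refine lintegral_congr_ae ?_
    filter_upwards [hrn] with x hx
    rw [hx]
  rw [h1]
  unfold distOf
  rw [lintegral_withDensity_eq_lintegral_mul _ mf
    (show Measurable fun x => ENNReal.ofReal (InformationTheory.klFun
      (ENNReal.ofReal (g x / f x)).toReal) from
      (InformationTheory.measurable_klFun.comp mgf.ennreal_toReal).ennreal_ofReal)]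
  refine lintegral_congr_ae ?_
  filter_upwards [hfp, hg.nonneg] with x hx hx'
  rw [Pi.mul_apply, ENNReal.toReal_ofReal (by positivity), ← ENNReal.ofReal_mul hx.le,
    InformationTheory.klFun_apply]
  congr 1
  field_simp

/-- Membership in an uncertainty class, expressed with real integrals of densities. -/
theorem mem_klClass_iff (hf : IsProbDensity μ f) (hfp : ∀ᵐ x ∂μ, 0 < f x) (hε : 0 ≤ ε) :
    g ∈ klClass μ f ε ↔ HasFiniteKL μ f g ∧ klInt μ g f ≤ ε := by
  have aux : IsProbDensity μ g → ∀ᵐ x ∂μ, 0 ≤ Real.log (g x / f x) * g x + f x - g x := by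
    intro hg
    filter_upwards [hfp, hg.nonneg] with x h1 h2
    have := sub_le_log_div_mul h1 h2
    linarith
  have mk : IsProbDensity μ g →
      Measurable (fun x => Real.log (g x / f x) * g x + f x - g x) := fun hg =>
    ((measurable_kl hf.measurable hg.measurable).add hf.measurable).sub hg.measurable
  have val : ∀ hg : HasFiniteKL μ f g,
      Integrable (fun x => Real.log (g x / f x) * g x + f x - g x) μ ∧
      ∫ x, (Real.log (g x / f x) * g x + f x - g x) ∂μ = klInt μ g f := by
    intro hg
    have i : Integrable (fun x => Real.log (g x / f x) * g x + f x) μ :=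
      hg.integrable_kl.add hf.integrable
    refine ⟨i.sub hg.density.integrable, ?_⟩
    rw [integral_sub i hg.density.integrable,
      integral_add hg.integrable_kl hf.integrable, hf.integral_eq_one,
      hg.density.integral_eq_one]
    unfold klInt
    ring
  constructor
  · rintro ⟨hg, hkl⟩
    rw [klDiv_distOf hf hfp hg] at hkl
    have hint : Integrable (fun x => Real.log (g x / f x) * g x + f x - g x) μ := by
      refine ⟨(mk hg).aestronglyMeasurable, ?_⟩
      rw [hasFiniteIntegral_iff_ofReal (aux hg)]
      exact hkl.trans_lt ENNReal.ofReal_lt_top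
    have hK : HasFiniteKL μ f g := by
      refine ⟨hg, ((hint.add hg.integrable).sub hf.integrable).congr ?_⟩
      filter_upwards with x
      simp only [Pi.add_apply, Pi.sub_apply]
      ring
    refine ⟨hK, ?_⟩
    rw [← ofReal_integral_eq_lintegral_ofReal hint (aux hg), (val hK).2,
      ENNReal.ofReal_le_ofReal_iff hε] at hkl
    exact hkl
  · rintro ⟨hK, hkl⟩
    refine ⟨hK.density, ?_⟩
    rw [klDiv_distOf hf hfp hK.density,
      ← ofReal_integral_eq_lintegral_ofReal (val hK).1 (aux hK.density), (val hK).2]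
    exact ENNReal.ofReal_le_ofReal hkl

theorem klInt_self (hfp : ∀ᵐ x ∂μ, 0 < f x) : klInt μ f f = 0 := by
  unfold klInt
  rw [integral_congr_ae (g := fun _ => (0 : ℝ)), integral_zero]
  filter_upwards [hfp] with x hx
  rw [div_self hx.ne', Real.log_one, zero_mul]

theorem hasFiniteKL_self (hf : IsProbDensity μ f) (hfp : ∀ᵐ x ∂μ, 0 < f x) :
    HasFiniteKL μ f f := by
  refine ⟨hf, (integrable_zero Ω ℝ μ).congr ?_⟩
  filter_upwards [hfp] with x hx
  rw [div_self hx.ne', Real.log_one, zero_mul, Pi.zero_apply]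

theorem klInt_nonneg (hf : IsProbDensity μ f) (hfp : ∀ᵐ x ∂μ, 0 < f x)
    (hg : HasFiniteKL μ f g) : 0 ≤ klInt μ g f := by
  have : ∫ x, (g x - f x) ∂μ ≤ klInt μ g f := by
    refine integral_mono_ae (hg.density.integrable.sub hf.integrable) hg.integrable_kl ?_
    filter_upwards [hfp, hg.density.nonneg] with x h1 h2
    exact sub_le_log_div_mul h1 h2
  rw [integral_sub hg.density.integrable hf.integrable, hg.density.integral_eq_one,
    hf.integral_eq_one] at this
  linarith

/-- Only an upper bound needs checking: the integrand is bounded below by `g - f`. -/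
theorem hasFiniteKL_of_le (hf : IsProbDensity μ f) (hfp : ∀ᵐ x ∂μ, 0 < f x)
    (hg : IsProbDensity μ g) {b : Ω → ℝ} (hb : Integrable b μ)
    (hle : ∀ᵐ x ∂μ, Real.log (g x / f x) * g x ≤ b x) : HasFiniteKL μ f g := by
  refine ⟨hg, integrable_of_le_of_le
    (measurable_kl hf.measurable hg.measurable).aestronglyMeasurable ?_ hle
    (hg.integrable.sub hf.integrable) hb⟩
  filter_upwards [hfp, hg.nonneg] with x h1 h2
  exact sub_le_log_div_mul h1 h2

theorem HasFiniteKL.combo (hf : IsProbDensity μ f) (hfp : ∀ᵐ x ∂μ, 0 < f x)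
    (hg : HasFiniteKL μ f g) (hh : HasFiniteKL μ f h) (ht : 0 ≤ t)
    (hs : 0 ≤ s) (hts : t + s = 1) : HasFiniteKL μ f (fun x => t * g x + s * h x) := by
  refine hasFiniteKL_of_le hf hfp (hg.density.combo hh.density ht hs hts)
    ((hg.integrable_kl.const_mul t).add (hh.integrable_kl.const_mul s)) ?_
  filter_upwards [hfp, hg.density.nonneg, hh.density.nonneg] with x h1 h2 h3
  exact log_div_mul_convex h1 h2 h3 ht hs hts

theorem klInt_combo_le (hf : IsProbDensity μ f) (hfp : ∀ᵐ x ∂μ, 0 < f x)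
    (hg : HasFiniteKL μ f g) (hh : HasFiniteKL μ f h) (ht : 0 ≤ t)
    (hs : 0 ≤ s) (hts : t + s = 1) :
    klInt μ (fun x => t * g x + s * h x) f ≤ t * klInt μ g f + s * klInt μ h f := by
  unfold klInt
  rw [← integral_const_mul, ← integral_const_mul, ← integral_add
    (hg.integrable_kl.const_mul t) (hh.integrable_kl.const_mul s)]
  refine integral_mono_ae (hg.combo hf hfp hh ht hs hts).integrable_kl
    ((hg.integrable_kl.const_mul t).add (hh.integrable_kl.const_mul s)) ?_
  filter_upwards [hfp, hg.density.nonneg, hh.density.nonneg] with x h1 h2 h3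
  exact log_div_mul_convex h1 h2 h3 ht hs hts

theorem memLp_sqrt (hg : IsProbDensity μ g) : MemLp (fun x => Real.sqrt (g x)) 2 μ := by
  rw [memLp_two_iff_integrable_sq hg.measurable.sqrt.aestronglyMeasurable]
  refine hg.integrable.congr ?_
  filter_upwards [hg.nonneg] with x hx
  rw [Real.sq_sqrt hx]

theorem integrable_sqrt_sub_sq (hg : IsProbDensity μ g) (hh : IsProbDensity μ h) :
    Integrable (fun x => (Real.sqrt (g x) - Real.sqrt (h x)) ^ 2) μ :=
  ((memLp_sqrt hg).sub (memLp_sqrt hh)).integrable_sq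

/-- The Kullback-Leibler divergence is uniformly convex with respect to the Hellinger distance. -/
theorem klInt_midpoint_le (hf : IsProbDensity μ f) (hfp : ∀ᵐ x ∂μ, 0 < f x)
    (hg : HasFiniteKL μ f g) (hh : HasFiniteKL μ f h) :
    klInt μ (fun x => 1 / 2 * g x + 1 / 2 * h x) f +
      (∫ x, (Real.sqrt (g x) - Real.sqrt (h x)) ^ 2 ∂μ) / 4 ≤
      1 / 2 * klInt μ g f + 1 / 2 * klInt μ h f := by
  unfold klInt
  have hc := (hg.combo hf hfp hh (t := 1 / 2) (s := 1 / 2) (by norm_num) (by norm_num)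
    (by norm_num)).integrable_kl
  have hH := (integrable_sqrt_sub_sq hg.density hh.density).div_const 4
  rw [← integral_const_mul, ← integral_const_mul, ← integral_add
    (hg.integrable_kl.const_mul _) (hh.integrable_kl.const_mul _), ← integral_div,
    ← integral_add hc hH]
  refine integral_mono_ae (hc.add hH)
    ((hg.integrable_kl.const_mul _).add (hh.integrable_kl.const_mul _)) ?_
  filter_upwards [hfp, hg.density.nonneg, hh.density.nonneg] with x h1 h2 h3
  exact log_div_mul_midpoint h1 h2 h3

theorem ae_eq_of_hellinger (hg : IsProbDensity μ g) (hh : IsProbDensity μ h)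
    (h0 : ∫ x, (Real.sqrt (g x) - Real.sqrt (h x)) ^ 2 ∂μ ≤ 0) : g =ᵐ[μ] h := by
  have h1 : ∫ x, (Real.sqrt (g x) - Real.sqrt (h x)) ^ 2 ∂μ = 0 :=
    le_antisymm h0 (integral_nonneg fun x => sq_nonneg _)
  rw [integral_eq_zero_iff_of_nonneg (fun x => sq_nonneg _) (integrable_sqrt_sub_sq hg hh)] at h1
  filter_upwards [h1, hg.nonneg, hh.nonneg] with x hx ha hb
  have : Real.sqrt (g x) = Real.sqrt (h x) := by
    have := pow_eq_zero_iff (two_ne_zero) |>.1 hx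
    linarith
  exact (Real.sqrt_inj ha hb).1 this

theorem tendsto_log_div_mul {c : ℝ} {a : ℕ → ℝ} {b : ℝ} (hc : c ≠ 0)
    (ha : Tendsto a atTop (𝓝 b)) :
    Tendsto (fun n => Real.log (a n / c) * a n) atTop (𝓝 (Real.log (b / c) * b)) := by
  have hcont : Continuous fun y : ℝ => Real.log (y / c) * y := by
    have : (fun y : ℝ => Real.log (y / c) * y) = fun y => c * (y / c * Real.log (y / c)) := by
      funext y; field_simp
    rw [this]
    exact continuous_const.mul (Real.continuous_mul_log.comp (continuous_id.div_const c))
  exact (hcont.tendsto b).comp ha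

/-- The uncertainty classes are closed under almost everywhere convergence of densities to a
density (lower semicontinuity of the Kullback-Leibler divergence). -/
theorem mem_klClass_of_tendsto (hf : IsProbDensity μ f) (hfp : ∀ᵐ x ∂μ, 0 < f x)
    {k : ℕ → Ω → ℝ} (hk : ∀ n, k n ∈ klClass μ f ε) (hg : IsProbDensity μ g)
    (hlim : ∀ᵐ x ∂μ, Tendsto (fun n => k n x) atTop (𝓝 (g x))) : g ∈ klClass μ f ε := by
  refine ⟨hg, ?_⟩
  rw [klDiv_distOf hf hfp hg]
  have h1 : ∀ n, ∫⁻ x, ENNReal.ofReal (Real.log (k n x / f x) * k n x + f x - k n x) ∂μ ≤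
      ENNReal.ofReal ε := fun n => by
    rw [← klDiv_distOf hf hfp (hk n).1]; exact (hk n).2
  have h2 : ∫⁻ x, ENNReal.ofReal (Real.log (g x / f x) * g x + f x - g x) ∂μ =
      ∫⁻ x, liminf (fun n => ENNReal.ofReal
        (Real.log (k n x / f x) * k n x + f x - k n x)) atTop ∂μ := by
    refine lintegral_congr_ae ?_
    filter_upwards [hlim, hfp] with x hx hx'
    exact (ENNReal.tendsto_ofReal (((tendsto_log_div_mul hx'.ne' hx).add_const _).sub
      hx)).liminf_eq.symm
  rw [h2]
  refine (lintegral_liminf_le fun n => (((measurable_kl hf.measurable (hk n).1.measurable).add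
    hf.measurable).sub (hk n).1.measurable).ennreal_ofReal).trans ?_
  exact liminf_le_of_le (by isBoundedDefault) fun b hb =>
    (hb.exists.choose_spec).trans (h1 _)

theorem measurable_affinity (hg₀ : Measurable g₀) (hg₁ : Measurable g₁) :
    Measurable (fun x => g₁ x ^ u * g₀ x ^ (1 - u)) :=
  (hg₁.pow_const u).mul (hg₀.pow_const (1 - u))

theorem integrable_affinity (hu : u ∈ Ioo (0 : ℝ) 1) (hm₀ : Measurable g₀) (hm₁ : Measurable g₁)
    (h0₀ : ∀ᵐ x ∂μ, 0 ≤ g₀ x) (h0₁ : ∀ᵐ x ∂μ, 0 ≤ g₁ x) (hi₀ : Integrable g₀ μ)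
    (hi₁ : Integrable g₁ μ) : Integrable (fun x => g₁ x ^ u * g₀ x ^ (1 - u)) μ := by
  refine Integrable.mono' ((hi₀.const_mul (1 - u)).add (hi₁.const_mul u))
    (measurable_affinity hm₀ hm₁).aestronglyMeasurable ?_
  filter_upwards [h0₀, h0₁] with x h1 h2
  rw [Real.norm_of_nonneg (by positivity)]
  exact rpow_mul_rpow_le hu h1 h2

theorem IsProbDensity.integrable_affinity (hu : u ∈ Ioo (0 : ℝ) 1) (hg₀ : IsProbDensity μ g₀)
    (hg₁ : IsProbDensity μ g₁) : Integrable (fun x => g₁ x ^ u * g₀ x ^ (1 - u)) μ :=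
  RobustTest.integrable_affinity hu hg₀.measurable hg₁.measurable hg₀.nonneg hg₁.nonneg
    hg₀.integrable hg₁.integrable

/-- Exchanging the two densities replaces `u` by `1 - u`; statements about the first density are
transferred to the second one in this way. -/
theorem affinity_swap : affinity μ (1 - u) g₁ g₀ = affinity μ u g₀ g₁ := by
  unfold affinity
  refine integral_congr_ae (Eventually.of_forall fun x => ?_)
  simp only [sub_sub_cancel]
  ring

theorem affinity_congr (h0 : g₀ =ᵐ[μ] h₀) (h1 : g₁ =ᵐ[μ] h₁) :
    affinity μ u g₀ g₁ = affinity μ u h₀ h₁ := by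
  refine integral_congr_ae ?_
  filter_upwards [h0, h1] with x e0 e1
  rw [e0, e1]

theorem affinity_nonneg (hg₀ : IsProbDensity μ g₀) (hg₁ : IsProbDensity μ g₁) :
    0 ≤ affinity μ u g₀ g₁ := by
  refine integral_nonneg_of_ae ?_
  filter_upwards [hg₀.nonneg, hg₁.nonneg] with x h1 h2
  exact mul_nonneg (Real.rpow_nonneg h2 _) (Real.rpow_nonneg h1 _)

theorem integral_amgm (hu : u ∈ Ioo (0 : ℝ) 1) (hg₀ : IsProbDensity μ g₀)
    (hg₁ : IsProbDensity μ g₁) :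
    Integrable (fun x => (1 - u) * g₀ x + u * g₁ x - g₁ x ^ u * g₀ x ^ (1 - u)) μ ∧
    ∫ x, ((1 - u) * g₀ x + u * g₁ x - g₁ x ^ u * g₀ x ^ (1 - u)) ∂μ =
      1 - affinity μ u g₀ g₁ := by
  have i := hg₀.integrable_affinity hu hg₁
  have i0 := hg₀.integrable.const_mul (1 - u)
  have i1 := hg₁.integrable.const_mul u
  have i01 : Integrable (fun x => (1 - u) * g₀ x + u * g₁ x) μ := i0.add i1
  refine ⟨i01.sub i, ?_⟩
  rw [integral_sub i01 i, integral_add i0 i1, integral_const_mul, integral_const_mul,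
    hg₀.integral_eq_one, hg₁.integral_eq_one]
  unfold affinity
  ring

theorem amgm_nonneg (hu : u ∈ Ioo (0 : ℝ) 1) (hg₀ : IsProbDensity μ g₀)
    (hg₁ : IsProbDensity μ g₁) :
    ∀ᵐ x ∂μ, 0 ≤ (1 - u) * g₀ x + u * g₁ x - g₁ x ^ u * g₀ x ^ (1 - u) := by
  filter_upwards [hg₀.nonneg, hg₁.nonneg] with x h1 h2
  exact sub_nonneg.2 (rpow_mul_rpow_le hu h1 h2)

theorem affinity_le_one (hu : u ∈ Ioo (0 : ℝ) 1) (hg₀ : IsProbDensity μ g₀)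
    (hg₁ : IsProbDensity μ g₁) : affinity μ u g₀ g₁ ≤ 1 := by
  have h := integral_nonneg_of_ae (amgm_nonneg hu hg₀ hg₁)
  rw [(integral_amgm hu hg₀ hg₁).2] at h
  linarith

theorem ae_eq_of_affinity_eq_one (hu : u ∈ Ioo (0 : ℝ) 1) (hg₀ : IsProbDensity μ g₀)
    (hg₁ : IsProbDensity μ g₁) (h : 1 ≤ affinity μ u g₀ g₁) : g₀ =ᵐ[μ] g₁ := by
  have hle := affinity_le_one hu hg₀ hg₁
  have h0 := (integral_amgm hu hg₀ hg₁).2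
  rw [le_antisymm hle h, sub_self, integral_eq_zero_iff_of_nonneg_ae (amgm_nonneg hu hg₀ hg₁)
    (integral_amgm hu hg₀ hg₁).1] at h0
  filter_upwards [h0, hg₀.nonneg, hg₁.nonneg] with x hx h1 h2
  have hx' : (1 - u) * g₀ x + u * g₁ x - g₁ x ^ u * g₀ x ^ (1 - u) = 0 := hx
  exact eq_of_rpow_mul_rpow_eq hu h1 h2 (by linarith)

theorem affinity_combo_ge (hu : u ∈ Ioo (0 : ℝ) 1) (hg₀ : IsProbDensity μ g₀)
    (hg₁ : IsProbDensity μ g₁) (hh₀ : IsProbDensity μ h₀) (hh₁ : IsProbDensity μ h₁)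
    (ht : 0 ≤ t) (hs : 0 ≤ s) (hts : t + s = 1) :
    t * affinity μ u g₀ g₁ + s * affinity μ u h₀ h₁ ≤
      affinity μ u (fun x => t * g₀ x + s * h₀ x) (fun x => t * g₁ x + s * h₁ x) := by
  unfold affinity
  have i0 := (hg₀.integrable_affinity hu hg₁).const_mul t
  have i1 := (hh₀.integrable_affinity hu hh₁).const_mul s
  rw [← integral_const_mul, ← integral_const_mul, ← integral_add i0 i1]
  refine integral_mono_ae (i0.add i1) ((hg₀.combo hh₀ ht hs hts).integrable_affinity hu
    (hg₁.combo hh₁ ht hs hts)) ?_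
  filter_upwards [hg₀.nonneg, hg₁.nonneg, hh₀.nonneg, hh₁.nonneg] with x a b c d
  exact rpow_mul_rpow_concave hu a b c d ht hs

/-- Upper semicontinuity of the affinity along almost everywhere convergent densities, by Fatou's
lemma for the nonnegative defect in the arithmetic-geometric mean inequality. -/
theorem le_affinity_of_tendsto (hu : u ∈ Ioo (0 : ℝ) 1) {k₀ k₁ : ℕ → Ω → ℝ} {b : ℕ → ℝ} {a : ℝ}
    (hk₀ : ∀ n, IsProbDensity μ (k₀ n)) (hk₁ : ∀ n, IsProbDensity μ (k₁ n))
    (hg₀ : IsProbDensity μ g₀) (hg₁ : IsProbDensity μ g₁)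
    (hlim₀ : ∀ᵐ x ∂μ, Tendsto (fun n => k₀ n x) atTop (𝓝 (g₀ x)))
    (hlim₁ : ∀ᵐ x ∂μ, Tendsto (fun n => k₁ n x) atTop (𝓝 (g₁ x)))
    (hb : Tendsto b atTop (𝓝 a)) (hle : ∀ n, b n ≤ affinity μ u (k₀ n) (k₁ n)) :
    a ≤ affinity μ u g₀ g₁ := by
  have ha : a ≤ 1 := le_of_tendsto' hb fun n =>
    (hle n).trans (affinity_le_one hu (hk₀ n) (hk₁ n))
  have h1 : ∀ n, ∫⁻ x, ENNReal.ofReal ((1 - u) * k₀ n x + u * k₁ n x -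
      k₁ n x ^ u * k₀ n x ^ (1 - u)) ∂μ ≤ ENNReal.ofReal (1 - b n) := fun n => by
    rw [← ofReal_integral_eq_lintegral_ofReal (integral_amgm hu (hk₀ n) (hk₁ n)).1
      (amgm_nonneg hu (hk₀ n) (hk₁ n)), (integral_amgm hu (hk₀ n) (hk₁ n)).2]
    exact ENNReal.ofReal_le_ofReal (by linarith [hle n])
  have h2 : ENNReal.ofReal (1 - affinity μ u g₀ g₁) =
      ∫⁻ x, liminf (fun n => ENNReal.ofReal ((1 - u) * k₀ n x + u * k₁ n x -
        k₁ n x ^ u * k₀ n x ^ (1 - u))) atTop ∂μ := by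
    rw [← (integral_amgm hu hg₀ hg₁).2, ofReal_integral_eq_lintegral_ofReal
      (integral_amgm hu hg₀ hg₁).1 (amgm_nonneg hu hg₀ hg₁)]
    refine lintegral_congr_ae ?_
    filter_upwards [hlim₀, hlim₁] with x h0 h1
    refine (ENNReal.tendsto_ofReal (((h0.const_mul _).add (h1.const_mul _)).sub
      ((h1.rpow_const (Or.inr hu.1.le)).mul
        (h0.rpow_const (Or.inr (sub_nonneg.2 hu.2.le)))))).liminf_eq.symm
  have h3 : ENNReal.ofReal (1 - affinity μ u g₀ g₁) ≤ ENNReal.ofReal (1 - a) := by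
    rw [h2]
    refine (lintegral_liminf_le fun n => ((((hk₀ n).measurable.const_mul _).add
      ((hk₁ n).measurable.const_mul _)).sub (measurable_affinity (hk₀ n).measurable
        (hk₁ n).measurable)).ennreal_ofReal).trans ?_
    rw [← (ENNReal.tendsto_ofReal (hb.const_sub 1)).liminf_eq]
    exact liminf_le_liminf (Eventually.of_forall h1)
  have := (ENNReal.ofReal_le_ofReal_iff (by linarith)).1 h3
  linarith

end Densities

/-! ### Compactness of the uncertainty classes -/

section Compactness

variable {Ω : Type*} [MeasurableSpace Ω] {μ : Measure Ω} {f₀ f₁ : Ω → ℝ} {ε₀ ε₁ u v : ℝ}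

theorem norm_sq_eq_integral_sq (F : Lp ℝ 2 μ) : ‖F‖ ^ 2 = ∫ x, F x ^ 2 ∂μ := by
  rw [← real_inner_self_eq_norm_sq, L2.inner_def]
  refine integral_congr_ae (Eventually.of_forall fun x => ?_)
  simp only [real_inner_self_eq_norm_sq, Real.norm_eq_abs, sq_abs]

/-- A Hellinger-Cauchy sequence of densities has a subsequence converging almost everywhere to a
density; no mass is lost because the square roots converge in `L²`. -/
theorem exists_density_of_hellinger_cauchy {k : ℕ → Ω → ℝ} (hk : ∀ n, IsProbDensity μ (k n))
    {B : ℕ → ℝ} (hB : Tendsto B atTop (𝓝 0))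
    (hle : ∀ n m, n ≤ m →
      ∫ x, (Real.sqrt (k n x) - Real.sqrt (k m x)) ^ 2 ∂μ ≤ B n) :
    ∃ (φ : ℕ → ℕ) (g : Ω → ℝ), StrictMono φ ∧ IsProbDensity μ g ∧
      ∀ᵐ x ∂μ, Tendsto (fun n => k (φ n) x) atTop (𝓝 (g x)) := by
  set F : ℕ → Lp ℝ 2 μ := fun n => (memLp_sqrt (hk n)).toLp with hF
  have hFx : ∀ n, ∀ᵐ x ∂μ, F n x = Real.sqrt (k n x) := fun n => MemLp.coeFn_toLp _
  have hc : CauchySeq F := by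
    refine cauchySeq_of_le_tendsto_0' (fun n => Real.sqrt (B n)) ?_ ?_
    · intro n m hnm
      refine Real.le_sqrt_of_sq_le ?_
      rw [dist_eq_norm, norm_sq_eq_integral_sq]
      refine le_trans (le_of_eq (integral_congr_ae ?_)) (hle n m hnm)
      filter_upwards [hFx n, hFx m, Lp.coeFn_sub (F n) (F m)] with x h1 h2 h3
      rw [h3, Pi.sub_apply, h1, h2]
    · simpa using hB.sqrt
  obtain ⟨S, hS⟩ := cauchySeq_tendsto_of_complete hc
  obtain ⟨φ, hφ, hae⟩ := (tendstoInMeasure_of_tendsto_Lp hS).exists_seq_tendsto_ae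
  refine ⟨φ, fun x => S x ^ 2, hφ, ⟨?_, ?_, ?_, ?_⟩, ?_⟩
  · exact (Lp.stronglyMeasurable S).measurable.pow_const 2
  · exact Eventually.of_forall fun x => sq_nonneg _
  · exact (Lp.memLp S).integrable_sq
  · rw [← norm_sq_eq_integral_sq]
    refine tendsto_nhds_unique (hS.norm.pow 2) ?_
    refine tendsto_const_nhds.congr fun n => ?_
    rw [norm_sq_eq_integral_sq, ← (hk n).integral_eq_one]
    refine integral_congr_ae ?_
    filter_upwards [hFx n, (hk n).nonneg] with x h1 h2
    rw [h1, Real.sq_sqrt h2]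
  · filter_upwards [hae, ae_all_iff.2 hFx, ae_all_iff.2 fun n => (hk n).nonneg] with x h1 h2 h3
    refine (h1.pow 2).congr fun n => ?_
    rw [h2, Real.sq_sqrt (h3 _)]

theorem klClass_combo (hf₀ : IsProbDensity μ f₀) (hf₀p : ∀ᵐ x ∂μ, 0 < f₀ x) (hε₀ : 0 ≤ ε₀)
    {g h : Ω → ℝ} (hg : g ∈ klClass μ f₀ ε₀) (hh : h ∈ klClass μ f₀ ε₀) {t s : ℝ} (ht : 0 ≤ t)
    (hs : 0 ≤ s) (hts : t + s = 1) : (fun x => t * g x + s * h x) ∈ klClass μ f₀ ε₀ := by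
  rw [mem_klClass_iff hf₀ hf₀p hε₀] at *
  refine ⟨hg.1.combo hf₀ hf₀p hh.1 ht hs hts,
    (klInt_combo_le hf₀ hf₀p hg.1 hh.1 ht hs hts).trans ?_⟩
  have e : ε₀ = t * ε₀ + s * ε₀ := by rw [← add_mul, hts, one_mul]
  rw [e]
  exact add_le_add (mul_le_mul_of_nonneg_left hg.2 ht) (mul_le_mul_of_nonneg_left hh.2 hs)

/-- Weak compactness in the form used below: a decreasing sequence of nonempty midpoint-convex
subsets of the product of the two uncertainty classes admits a selection converging almost
everywhere to an element of the product. The selection nearly minimizes the sum of the divergences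
over each set, and the uniform convexity of the divergence makes it a Cauchy sequence. -/
theorem exists_tendsto_of_nested (hf₀ : IsProbDensity μ f₀) (hf₁ : IsProbDensity μ f₁)
    (hf₀p : ∀ᵐ x ∂μ, 0 < f₀ x) (hf₁p : ∀ᵐ x ∂μ, 0 < f₁ x) (hε₀ : 0 ≤ ε₀) (hε₁ : 0 ≤ ε₁)
    {C : ℕ → Set ((Ω → ℝ) × (Ω → ℝ))} (hanti : Antitone C) (hne : ∀ n, (C n).Nonempty)
    (hsub : ∀ n, C n ⊆ klClass μ f₀ ε₀ ×ˢ klClass μ f₁ ε₁)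
    (hmid : ∀ n, ∀ p ∈ C n, ∀ q ∈ C n, ((fun x => 1 / 2 * p.1 x + 1 / 2 * q.1 x,
      fun x => 1 / 2 * p.2 x + 1 / 2 * q.2 x) : (Ω → ℝ) × (Ω → ℝ)) ∈ C n) :
    ∃ k : ℕ → (Ω → ℝ) × (Ω → ℝ), (∀ n, k n ∈ C n) ∧
      ∃ g₀ ∈ klClass μ f₀ ε₀, ∃ g₁ ∈ klClass μ f₁ ε₁,
        (∀ᵐ x ∂μ, Tendsto (fun n => (k n).1 x) atTop (𝓝 (g₀ x))) ∧
        (∀ᵐ x ∂μ, Tendsto (fun n => (k n).2 x) atTop (𝓝 (g₁ x))) := by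
  set J : (Ω → ℝ) × (Ω → ℝ) → ℝ := fun p => klInt μ p.1 f₀ + klInt μ p.2 f₁ with hJ
  have hm0 : ∀ n, ∀ p ∈ C n, HasFiniteKL μ f₀ p.1 ∧ klInt μ p.1 f₀ ≤ ε₀ := fun n p hp =>
    (mem_klClass_iff hf₀ hf₀p hε₀).1 (hsub n hp).1
  have hm1 : ∀ n, ∀ p ∈ C n, HasFiniteKL μ f₁ p.2 ∧ klInt μ p.2 f₁ ≤ ε₁ := fun n p hp =>
    (mem_klClass_iff hf₁ hf₁p hε₁).1 (hsub n hp).2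
  have hJ0 : ∀ n, ∀ p ∈ C n, 0 ≤ J p := fun n p hp =>
    add_nonneg (klInt_nonneg hf₀ hf₀p (hm0 n p hp).1) (klInt_nonneg hf₁ hf₁p (hm1 n p hp).1)
  set v : ℕ → ℝ := fun n => sInf (J '' C n) with hv
  have hbdd : ∀ n, BddBelow (J '' C n) := fun n => ⟨0, by
    rintro _ ⟨p, hp, rfl⟩; exact hJ0 n p hp⟩
  have hvle : ∀ n, ∀ p ∈ C n, v n ≤ J p := fun n p hp => csInf_le (hbdd n) ⟨p, hp, rfl⟩
  have hvmono : Monotone v := fun n m hnm =>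
    csInf_le_csInf (hbdd n) ((hne m).image J) (image_mono (hanti hnm))
  have hvbdd : BddAbove (range v) := ⟨ε₀ + ε₁, by
    rintro _ ⟨n, rfl⟩
    obtain ⟨p, hp⟩ := hne n
    exact (hvle n p hp).trans (add_le_add (hm0 n p hp).2 (hm1 n p hp).2)⟩
  have hvlim := tendsto_atTop_ciSup hvmono hvbdd
  set V := ⨆ n, v n with hV
  have hvV : ∀ n, v n ≤ V := fun n => le_ciSup hvbdd n
  have hδ : ∀ n : ℕ, (0 : ℝ) < 1 / ((n : ℝ) + 1) := fun n => by positivity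
  have hsel : ∀ n, ∃ p ∈ C n, J p < v n + 1 / ((n : ℝ) + 1) := fun n => by
    obtain ⟨_, ⟨p, hp, rfl⟩, h⟩ := exists_lt_of_csInf_lt ((hne n).image J)
      (lt_add_of_pos_right (v n) (hδ n))
    exact ⟨p, hp, h⟩
  choose k hkC hkJ using hsel
  set B : ℕ → ℝ := fun n => 2 * (V - v n) + 4 * (1 / ((n : ℝ) + 1)) with hB
  have hBlim : Tendsto B atTop (𝓝 0) := by
    have := ((hvlim.const_sub V).const_mul 2).add
      ((tendsto_one_div_add_atTop_nhds_zero_nat (𝕜 := ℝ)).const_mul 4)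
    rw [sub_self, mul_zero, mul_zero, add_zero] at this
    exact this
  -- the midpoint of `k n` and `k m` lies in `C n`, so its value is at least `v n`, while both
  -- endpoints have values at most `V + 1 / (n + 1)`
  have hboth : ∀ n m, n ≤ m →
      ∫ x, (Real.sqrt ((k n).1 x) - Real.sqrt ((k m).1 x)) ^ 2 ∂μ +
        ∫ x, (Real.sqrt ((k n).2 x) - Real.sqrt ((k m).2 x)) ^ 2 ∂μ ≤ B n := by
    intro n m hnm
    have hkm := hanti hnm (hkC m)
    have h0 := klInt_midpoint_le hf₀ hf₀p (hm0 n _ (hkC n)).1 (hm0 n _ hkm).1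
    have h1 := klInt_midpoint_le hf₁ hf₁p (hm1 n _ (hkC n)).1 (hm1 n _ hkm).1
    have h2 := hvle n _ (hmid n _ (hkC n) _ hkm)
    have h3 := hkJ n
    have h4 := hkJ m
    have h5 := hvV m
    have h6 : 1 / ((m : ℝ) + 1) ≤ 1 / ((n : ℝ) + 1) := by gcongr
    simp only [hJ, hB] at *
    linarith
  have hd0 : ∀ n, IsProbDensity μ (k n).1 := fun n => (hm0 n _ (hkC n)).1.density
  have hd1 : ∀ n, IsProbDensity μ (k n).2 := fun n => (hm1 n _ (hkC n)).1.density
  obtain ⟨φ, g₀, hφ, hg₀, hlim₀⟩ := exists_density_of_hellinger_cauchy hd0 hBlim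
    fun n m hnm => le_trans (le_add_of_nonneg_right (integral_nonneg fun x => sq_nonneg _))
      (hboth n m hnm)
  obtain ⟨ψ, g₁, hψ, hg₁, hlim₁⟩ := exists_density_of_hellinger_cauchy (fun n => hd1 (φ n))
    (hBlim.comp hφ.tendsto_atTop)
    fun n m hnm => le_trans (le_add_of_nonneg_left (integral_nonneg fun x => sq_nonneg _))
      (hboth (φ n) (φ m) (hφ.monotone hnm))
  have hlim₀' : ∀ᵐ x ∂μ, Tendsto (fun n => (k (φ (ψ n))).1 x) atTop (𝓝 (g₀ x)) := by
    filter_upwards [hlim₀] with x hx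
    exact hx.comp hψ.tendsto_atTop
  refine ⟨fun n => k (φ (ψ n)), fun n => ?_, g₀, ?_, g₁, ?_, hlim₀', hlim₁⟩
  · exact hanti ((hψ.id_le n).trans (hφ.id_le _)) (hkC _)
  · exact mem_klClass_of_tendsto hf₀ hf₀p (fun n => (hsub _ (hkC (φ (ψ n)))).1) hg₀ hlim₀'
  · exact mem_klClass_of_tendsto hf₁ hf₁p (fun n => (hsub _ (hkC (φ (ψ n)))).2) hg₁ hlim₁

/-- If two affinities can be brought simultaneously arbitrarily close to the levels `a` and `b`
within the uncertainty classes, then these levels are attained simultaneously. -/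
theorem exists_affinity_ge (hf₀ : IsProbDensity μ f₀) (hf₁ : IsProbDensity μ f₁)
    (hf₀p : ∀ᵐ x ∂μ, 0 < f₀ x) (hf₁p : ∀ᵐ x ∂μ, 0 < f₁ x) (hε₀ : 0 ≤ ε₀) (hε₁ : 0 ≤ ε₁)
    (hu : u ∈ Ioo (0 : ℝ) 1) (hv : v ∈ Ioo (0 : ℝ) 1) {a b : ℝ}
    (hex : ∀ δ > 0, ∃ g₀ ∈ klClass μ f₀ ε₀, ∃ g₁ ∈ klClass μ f₁ ε₁,
      a - δ ≤ affinity μ u g₀ g₁ ∧ b - δ ≤ affinity μ v g₀ g₁) :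
    ∃ g₀ ∈ klClass μ f₀ ε₀, ∃ g₁ ∈ klClass μ f₁ ε₁,
      a ≤ affinity μ u g₀ g₁ ∧ b ≤ affinity μ v g₀ g₁ := by
  set C : ℕ → Set ((Ω → ℝ) × (Ω → ℝ)) := fun n => {p | p ∈ klClass μ f₀ ε₀ ×ˢ klClass μ f₁ ε₁ ∧
    a - 1 / ((n : ℝ) + 1) ≤ affinity μ u p.1 p.2 ∧ b - 1 / ((n : ℝ) + 1) ≤ affinity μ v p.1 p.2}
    with hC
  have conc : ∀ {w c : ℝ}, w ∈ Ioo (0 : ℝ) 1 → ∀ p ∈ klClass μ f₀ ε₀ ×ˢ klClass μ f₁ ε₁,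
      ∀ q ∈ klClass μ f₀ ε₀ ×ˢ klClass μ f₁ ε₁, c ≤ affinity μ w p.1 p.2 →
      c ≤ affinity μ w q.1 q.2 → c ≤ affinity μ w (fun x => 1 / 2 * p.1 x + 1 / 2 * q.1 x)
        (fun x => 1 / 2 * p.2 x + 1 / 2 * q.2 x) := by
    intro w c hw p hp q hq h1 h2
    have := affinity_combo_ge (t := 1 / 2) (s := 1 / 2) hw hp.1.1 hp.2.1 hq.1.1 hq.2.1
      (by norm_num) (by norm_num) (by norm_num)
    linarith
  obtain ⟨k, hk, g₀, hg₀, g₁, hg₁, hlim₀, hlim₁⟩ := exists_tendsto_of_nested hf₀ hf₁ hf₀p hf₁p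
    hε₀ hε₁ (C := C) (by
      intro n m hnm p hp
      have h6 : 1 / ((m : ℝ) + 1) ≤ 1 / ((n : ℝ) + 1) := by gcongr
      exact ⟨hp.1, by linarith [hp.2.1], by linarith [hp.2.2]⟩) (by
      intro n
      obtain ⟨p, hp, q, hq, h1, h2⟩ := hex (1 / ((n : ℝ) + 1)) (by positivity)
      exact ⟨(p, q), ⟨hp, hq⟩, h1, h2⟩) (fun n p hp => hp.1) (by
      intro n p hp q hq
      refine ⟨⟨klClass_combo hf₀ hf₀p hε₀ hp.1.1 hq.1.1 (by norm_num) (by norm_num) (by norm_num),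
        klClass_combo hf₁ hf₁p hε₁ hp.1.2 hq.1.2 (by norm_num) (by norm_num) (by norm_num)⟩,
        conc hu p hp.1 q hq.1 hp.2.1 hq.2.1, conc hv p hp.1 q hq.1 hp.2.2 hq.2.2⟩)
  have lim : ∀ c : ℝ, Tendsto (fun n : ℕ => c - 1 / ((n : ℝ) + 1)) atTop (𝓝 c) := fun c => by
    simpa using (tendsto_one_div_add_atTop_nhds_zero_nat (𝕜 := ℝ)).const_sub c
  exact ⟨g₀, hg₀, g₁, hg₁,
    le_affinity_of_tendsto hu (fun n => (hk n).1.1.1) (fun n => (hk n).1.2.1) hg₀.1 hg₁.1 hlim₀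
      hlim₁ (lim a) fun n => (hk n).2.1,
    le_affinity_of_tendsto hv (fun n => (hk n).1.1.1) (fun n => (hk n).1.2.1) hg₀.1 hg₁.1 hlim₀
      hlim₁ (lim b) fun n => (hk n).2.2⟩

end Compactness

/-! ### Joint maxima and multipliers of the divergence constraints -/

section JointMaximum

variable {Ω : Type*} [MeasurableSpace Ω] {μ : Measure Ω} {f f₀ f₁ g₀ g₁ : Ω → ℝ}
  {ε₀ ε₁ u lam₀ lam₁ : ℝ}

/-- The pair `(g₀, g₁)` maximizes the affinity jointly over the two uncertainty classes. -/
structure IsJointMax (μ : Measure Ω) (f₀ f₁ : Ω → ℝ) (ε₀ ε₁ u : ℝ) (g₀ g₁ : Ω → ℝ) : Prop where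
  mem₀ : g₀ ∈ klClass μ f₀ ε₀
  mem₁ : g₁ ∈ klClass μ f₁ ε₁
  le : ∀ h₀ ∈ klClass μ f₀ ε₀, ∀ h₁ ∈ klClass μ f₁ ε₁, affinity μ u h₀ h₁ ≤ affinity μ u g₀ g₁

theorem self_mem_klClass (hf : IsProbDensity μ f) (hfp : ∀ᵐ x ∂μ, 0 < f x) {ε : ℝ}
    (hε : 0 ≤ ε) : f ∈ klClass μ f ε :=
  (mem_klClass_iff hf hfp hε).2 ⟨hasFiniteKL_self hf hfp, by rwa [klInt_self hfp]⟩

theorem exists_isJointMax (hf₀ : IsProbDensity μ f₀) (hf₁ : IsProbDensity μ f₁)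
    (hf₀p : ∀ᵐ x ∂μ, 0 < f₀ x) (hf₁p : ∀ᵐ x ∂μ, 0 < f₁ x) (hε₀ : 0 ≤ ε₀) (hε₁ : 0 ≤ ε₁)
    (hu : u ∈ Ioo (0 : ℝ) 1) : ∃ g₀ g₁, IsJointMax μ f₀ f₁ ε₀ ε₁ u g₀ g₁ := by
  set T : Set ℝ := {a | ∃ h₀ ∈ klClass μ f₀ ε₀, ∃ h₁ ∈ klClass μ f₁ ε₁, a = affinity μ u h₀ h₁}
  have hne : T.Nonempty :=
    ⟨_, f₀, self_mem_klClass hf₀ hf₀p hε₀, f₁, self_mem_klClass hf₁ hf₁p hε₁, rfl⟩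
  have hbd : BddAbove T := ⟨1, by
    rintro _ ⟨h₀, hh₀, h₁, hh₁, rfl⟩
    exact affinity_le_one hu hh₀.1 hh₁.1⟩
  have hap : ∀ δ > 0, ∃ g₀ ∈ klClass μ f₀ ε₀, ∃ g₁ ∈ klClass μ f₁ ε₁,
      sSup T - δ ≤ affinity μ u g₀ g₁ ∧ sSup T - δ ≤ affinity μ u g₀ g₁ := by
    intro δ hδ
    obtain ⟨_, ⟨h₀, hh₀, h₁, hh₁, rfl⟩, hlt⟩ := exists_lt_of_lt_csSup hne (sub_lt_self (sSup T) hδ)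
    exact ⟨h₀, hh₀, h₁, hh₁, hlt.le, hlt.le⟩
  obtain ⟨g₀, hg₀, g₁, hg₁, h, -⟩ := exists_affinity_ge hf₀ hf₁ hf₀p hf₁p hε₀ hε₁ hu hu hap
  exact ⟨g₀, g₁, hg₀, hg₁, fun h₀ hh₀ h₁ hh₁ => (le_csSup hbd ⟨h₀, hh₀, h₁, hh₁, rfl⟩).trans h⟩

theorem affinity_lt_one_of_disjoint (hu : u ∈ Ioo (0 : ℝ) 1)
    (hf₁ : IsProbDensity μ f₁) (hf₁p : ∀ᵐ x ∂μ, 0 < f₁ x)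
    (hdisj : Disjoint (klClass μ f₀ ε₀) (klClass μ f₁ ε₁))
    (hg₀ : g₀ ∈ klClass μ f₀ ε₀) (hg₁ : g₁ ∈ klClass μ f₁ ε₁) : affinity μ u g₀ g₁ < 1 := by
  by_contra! hcon
  have e := ae_eq_of_affinity_eq_one hu hg₀.1 hg₁.1 hcon
  refine Set.disjoint_left.1 hdisj hg₀
    (mem_klClass_of_tendsto hf₁ hf₁p (k := fun _ => g₁) (fun _ => hg₁) hg₀.1 ?_)
  filter_upwards [e] with x hx
  rw [hx]
  exact tendsto_const_nhds

/-- Lagrange multipliers for the joint problem, by separating the origin from the open convex set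
of all triples lying strictly below (objective gain, slack, slack) of some pair of densities. The
Slater point `(f₀, f₁)` makes the multiplier of the objective positive. -/
theorem IsJointMax.exists_multipliers (hf₀ : IsProbDensity μ f₀) (hf₁ : IsProbDensity μ f₁)
    (hf₀p : ∀ᵐ x ∂μ, 0 < f₀ x) (hf₁p : ∀ᵐ x ∂μ, 0 < f₁ x) (hε₀ : 0 < ε₀) (hε₁ : 0 < ε₁)
    (hu : u ∈ Ioo (0 : ℝ) 1) (hg : IsJointMax μ f₀ f₁ ε₀ ε₁ u g₀ g₁) :
    ∃ lam₀ lam₁ : ℝ, 0 ≤ lam₀ ∧ 0 ≤ lam₁ ∧ ∀ h₀ h₁, HasFiniteKL μ f₀ h₀ → HasFiniteKL μ f₁ h₁ →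
      affinity μ u h₀ h₁ + lam₀ * (ε₀ - klInt μ h₀ f₀) + lam₁ * (ε₁ - klInt μ h₁ f₁) ≤
        affinity μ u g₀ g₁ := by
  set V := affinity μ u g₀ g₁ with hV
  -- the objective gain and the two constraint slacks, with room to spare
  set A : Set (ℝ × ℝ × ℝ) := {p | ∃ h₀ h₁, HasFiniteKL μ f₀ h₀ ∧ HasFiniteKL μ f₁ h₁ ∧
    p.1 < affinity μ u h₀ h₁ - V ∧ p.2.1 < ε₀ - klInt μ h₀ f₀ ∧ p.2.2 < ε₁ - klInt μ h₁ f₁} with hA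
  have hopen : IsOpen A := by
    rw [isOpen_iff_mem_nhds]
    rintro p ⟨h₀, h₁, hh₀, hh₁, p0, p1, p2⟩
    filter_upwards [(isOpen_lt continuous_fst continuous_const).mem_nhds p0,
      (isOpen_lt (continuous_fst.comp continuous_snd) continuous_const).mem_nhds p1,
      (isOpen_lt (continuous_snd.comp continuous_snd) continuous_const).mem_nhds p2] with q q0 q1 q2
    exact ⟨h₀, h₁, hh₀, hh₁, q0, q1, q2⟩
  have hconv : Convex ℝ A := by
    rw [convex_iff_forall_pos]
    rintro p ⟨h₀, h₁, hh₀, hh₁, p0, p1, p2⟩ q ⟨k₀, k₁, hk₀, hk₁, q0, q1, q2⟩ t s ht hs hts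
    refine ⟨fun x => t * h₀ x + s * k₀ x, fun x => t * h₁ x + s * k₁ x,
      hh₀.combo hf₀ hf₀p hk₀ ht.le hs.le hts, hh₁.combo hf₁ hf₁p hk₁ ht.le hs.le hts, ?_, ?_, ?_⟩
    · have := affinity_combo_ge hu hh₀.density hh₁.density hk₀.density hk₁.density ht.le hs.le hts
      have e : V = t * V + s * V := by rw [← add_mul, hts, one_mul]
      simp only [Prod.fst_add, Prod.smul_fst, smul_eq_mul]
      nlinarith
    · have := klInt_combo_le hf₀ hf₀p hh₀ hk₀ ht.le hs.le hts
      have e : ε₀ = t * ε₀ + s * ε₀ := by rw [← add_mul, hts, one_mul]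
      simp only [Prod.fst_add, Prod.smul_fst, Prod.snd_add, Prod.smul_snd, smul_eq_mul]
      nlinarith
    · have := klInt_combo_le hf₁ hf₁p hh₁ hk₁ ht.le hs.le hts
      have e : ε₁ = t * ε₁ + s * ε₁ := by rw [← add_mul, hts, one_mul]
      simp only [Prod.snd_add, Prod.smul_snd, smul_eq_mul]
      nlinarith
  have h0A : (0 : ℝ × ℝ × ℝ) ∉ A := by
    rintro ⟨h₀, h₁, hh₀, hh₁, p0, p1, p2⟩
    simp only [Prod.fst_zero, Prod.snd_zero] at p0 p1 p2
    have := hg.le h₀ ((mem_klClass_iff hf₀ hf₀p hε₀.le).2 ⟨hh₀, by linarith⟩) h₁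
      ((mem_klClass_iff hf₁ hf₁p hε₁.le).2 ⟨hh₁, by linarith⟩)
    linarith
  obtain ⟨φ, hφ⟩ := geometric_hahn_banach_open_point hconv hopen h0A
  rw [map_zero] at hφ
  set c := φ (1, 0, 0) with hc
  set c₀ := φ (0, 1, 0) with hc₀
  set c₁ := φ (0, 0, 1) with hc₁
  have hφe : ∀ a b d : ℝ, φ (a, b, d) = a * c + b * c₀ + d * c₁ := by
    intro a b d
    have : ((a, b, d) : ℝ × ℝ × ℝ) = a • (1, 0, 0) + b • (0, 1, 0) + d • (0, 0, 1) := by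
      simp
    rw [this, map_add, map_add, map_smul, map_smul, map_smul]
    rfl
  have hneg : ∀ h₀ h₁, HasFiniteKL μ f₀ h₀ → HasFiniteKL μ f₁ h₁ → ∀ a b d : ℝ, 0 < a → 0 < b →
      0 < d → (affinity μ u h₀ h₁ - V - a) * c + (ε₀ - klInt μ h₀ f₀ - b) * c₀ +
        (ε₁ - klInt μ h₁ f₁ - d) * c₁ < 0 := by
    intro h₀ h₁ hh₀ hh₁ a b d ha hb hd
    rw [← hφe]
    exact hφ _ ⟨h₀, h₁, hh₀, hh₁, by simpa using ha, by simpa using hb, by simpa using hd⟩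
  have hF₀ := hasFiniteKL_self hf₀ hf₀p
  have hF₁ := hasFiniteKL_self hf₁ hf₁p
  have nonneg_of : ∀ {r z : ℝ}, (∀ y : ℝ, 0 < y → r - y * z < 0) → 0 ≤ z := by
    intro r z h
    by_contra! hz
    have h1 := h ((|r| + 1) / (-z)) (div_pos (by positivity) (by linarith))
    have h2 : (|r| + 1) / (-z) * z = -(|r| + 1) := by
      rw [div_mul_eq_mul_div, div_eq_iff (by linarith)]; ring
    rw [h2] at h1
    linarith [neg_abs_le r]
  have hc0 : 0 ≤ c := nonneg_of (r := (affinity μ u f₀ f₁ - V) * c + (ε₀ - klInt μ f₀ f₀ - 1) * c₀ +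
      (ε₁ - klInt μ f₁ f₁ - 1) * c₁) fun y hy => by
    linarith [hneg f₀ f₁ hF₀ hF₁ y 1 1 hy one_pos one_pos]
  have hc₀0 : 0 ≤ c₀ := nonneg_of (r := (affinity μ u f₀ f₁ - V - 1) * c +
      (ε₀ - klInt μ f₀ f₀) * c₀ + (ε₁ - klInt μ f₁ f₁ - 1) * c₁) fun y hy => by
    linarith [hneg f₀ f₁ hF₀ hF₁ 1 y 1 one_pos hy one_pos]
  have hc₁0 : 0 ≤ c₁ := nonneg_of (r := (affinity μ u f₀ f₁ - V - 1) * c +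
      (ε₀ - klInt μ f₀ f₀ - 1) * c₀ + (ε₁ - klInt μ f₁ f₁) * c₁) fun y hy => by
    linarith [hneg f₀ f₁ hF₀ hF₁ 1 1 y one_pos one_pos hy]
  have hcpos : 0 < c := by
    refine hc0.lt_of_ne' fun hc => ?_
    have := hneg f₀ f₁ hF₀ hF₁ 1 (ε₀ / 2) (ε₁ / 2) one_pos (by positivity) (by positivity)
    rw [klInt_self hf₀p, klInt_self hf₁p, hc] at this
    nlinarith [mul_nonneg hε₀.le hc₀0, mul_nonneg hε₁.le hc₁0]
  refine ⟨c₀ / c, c₁ / c, div_nonneg hc₀0 hc0, div_nonneg hc₁0 hc0, fun h₀ h₁ hh₀ hh₁ => ?_⟩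
  have hlim : (affinity μ u h₀ h₁ - V) * c + (ε₀ - klInt μ h₀ f₀) * c₀ +
      (ε₁ - klInt μ h₁ f₁) * c₁ ≤ 0 := by
    refine le_of_forall_pos_le_add fun η hη => ?_
    have hS : 0 < c + c₀ + c₁ := by linarith
    have hq := div_pos hη hS
    have := hneg h₀ h₁ hh₀ hh₁ _ _ _ hq hq hq
    have e : η / (c + c₀ + c₁) * (c + c₀ + c₁) = η := div_mul_cancel₀ _ hS.ne'
    nlinarith
  have e : (affinity μ u h₀ h₁ + c₀ / c * (ε₀ - klInt μ h₀ f₀) + c₁ / c * (ε₁ - klInt μ h₁ f₁) -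
      V) * c = (affinity μ u h₀ h₁ - V) * c + (ε₀ - klInt μ h₀ f₀) * c₀ +
      (ε₁ - klInt μ h₁ f₁) * c₁ := by
    field_simp
    ring
  rw [← e] at hlim
  linarith [nonpos_of_mul_nonpos_left hlim hcpos]

/-- Every density can be approximated in affinity by densities of finite divergence from `f`,
namely by its normalized truncations `min g₁ (n f)`. -/
theorem exists_affinity_gt (hf : IsProbDensity μ f) (hfp : ∀ᵐ x ∂μ, 0 < f x)
    (hu : u ∈ Ioo (0 : ℝ) 1) (hg₁ : IsProbDensity μ g₁) {a : ℝ} (ha : a < 1) :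
    ∃ h, HasFiniteKL μ f h ∧ a < affinity μ u h g₁ := by
  set k : ℕ → Ω → ℝ := fun n x => min (g₁ x) (n * f x) with hk
  have hkm : ∀ n, Measurable (k n) := fun n => hg₁.measurable.min (hf.measurable.const_mul _)
  have hk0 : ∀ n, ∀ᵐ x ∂μ, 0 ≤ k n x := fun n => by
    filter_upwards [hg₁.nonneg, hfp] with x h1 h2
    exact le_min h1 (by positivity)
  have hkb : ∀ n, ∀ᵐ x ∂μ, ‖k n x‖ ≤ g₁ x := fun n => by
    filter_upwards [hk0 n] with x h1
    rw [Real.norm_of_nonneg h1]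
    exact min_le_left _ _
  have hlim : Tendsto (fun n => ∫ x, k n x ∂μ) atTop (𝓝 1) := by
    rw [← hg₁.integral_eq_one]
    refine tendsto_integral_of_dominated_convergence g₁ (fun n => (hkm n).aestronglyMeasurable)
      hg₁.integrable hkb ?_
    filter_upwards [hfp] with x hx
    obtain ⟨N, hN⟩ := exists_nat_ge (g₁ x / f x)
    refine tendsto_const_nhds.congr' ?_
    filter_upwards [eventually_ge_atTop N] with n hn
    refine (min_eq_left ?_).symm
    rw [div_le_iff₀ hx] at hN
    refine hN.trans ?_
    gcongr
  obtain ⟨n, hn⟩ := (hlim.eventually (lt_mem_nhds (max_lt ha one_pos))).exists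
  have hki : Integrable (k n) μ :=
    Integrable.mono' hg₁.integrable (hkm n).aestronglyMeasurable (hkb n)
  set C := ∫ x, k n x ∂μ with hC
  have hC0 : 0 < C := (le_max_right _ _).trans_lt hn
  have hC1 : C ≤ 1 := by
    rw [← hg₁.integral_eq_one]
    exact integral_mono hki hg₁.integrable fun x => min_le_left _ _
  have hd := IsProbDensity.of_integral_pos (hkm n) (hk0 n) hki hC0
  refine ⟨_, hasFiniteKL_of_le hf hfp hd (hd.integrable.const_mul (Real.log (n / C))) ?_, ?_⟩
  · filter_upwards [hfp, hk0 n] with x h1 h2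
    rcases h2.eq_or_lt with h2 | h2
    · simp [← h2]
    · refine mul_le_mul_of_nonneg_right (Real.log_le_log (by positivity) ?_) (by positivity)
      rw [div_right_comm]
      refine div_le_div_of_nonneg_right ?_ hC0.le
      rw [div_le_iff₀ h1]
      exact min_le_right _ _
  · refine (le_max_left _ _).trans_lt (hn.trans_le ?_)
    refine integral_mono_ae hki (hd.integrable_affinity hu hg₁) ?_
    filter_upwards [hk0 n, hg₁.nonneg] with x h1 h2
    have e : k n x = k n x ^ u * k n x ^ (1 - u) := by
      rcases h1.eq_or_lt with h1 | h1
      · rw [← h1, Real.zero_rpow hu.1.ne', zero_mul]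
      · rw [← Real.rpow_add h1]; simp
    calc k n x = k n x ^ u * k n x ^ (1 - u) := e
      _ ≤ g₁ x ^ u * (k n x / C) ^ (1 - u) := by
        refine mul_le_mul (Real.rpow_le_rpow h1 (min_le_left _ _) hu.1.le)
          (Real.rpow_le_rpow h1 ?_ (sub_nonneg.2 hu.2.le)) (by positivity) (by positivity)
        exact le_div_self h1 hC0 hC1

/-- The pair `(g₀, g₁)` maximizes, over densities of finite divergence, the Lagrangian of the
joint problem in which only the two divergence constraints are dualized; both multipliers are
positive and both constraints are active. -/
structure IsLagrangeMax (μ : Measure Ω) (f₀ f₁ : Ω → ℝ) (ε₀ ε₁ u : ℝ) (g₀ g₁ : Ω → ℝ)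
    (lam₀ lam₁ : ℝ) : Prop where
  mem₀ : HasFiniteKL μ f₀ g₀
  mem₁ : HasFiniteKL μ f₁ g₁
  lam₀_pos : 0 < lam₀
  lam₁_pos : 0 < lam₁
  kl₀ : klInt μ g₀ f₀ = ε₀
  kl₁ : klInt μ g₁ f₁ = ε₁
  le : ∀ h₀ h₁, HasFiniteKL μ f₀ h₀ → HasFiniteKL μ f₁ h₁ →
    affinity μ u h₀ h₁ + lam₀ * (ε₀ - klInt μ h₀ f₀) + lam₁ * (ε₁ - klInt μ h₁ f₁) ≤
      affinity μ u g₀ g₁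

theorem IsLagrangeMax.swap (hg : IsLagrangeMax μ f₀ f₁ ε₀ ε₁ u g₀ g₁ lam₀ lam₁) :
    IsLagrangeMax μ f₁ f₀ ε₁ ε₀ (1 - u) g₁ g₀ lam₁ lam₀ where
  mem₀ := hg.mem₁
  mem₁ := hg.mem₀
  lam₀_pos := hg.lam₁_pos
  lam₁_pos := hg.lam₀_pos
  kl₀ := hg.kl₁
  kl₁ := hg.kl₀
  le h₁ h₀ hh₁ hh₀ := by
    rw [affinity_swap, affinity_swap]
    linarith [hg.le h₀ h₁ hh₀ hh₁]

theorem IsJointMax.exists_isLagrangeMax (hf₀ : IsProbDensity μ f₀) (hf₁ : IsProbDensity μ f₁)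
    (hf₀p : ∀ᵐ x ∂μ, 0 < f₀ x) (hf₁p : ∀ᵐ x ∂μ, 0 < f₁ x) (hε₀ : 0 < ε₀) (hε₁ : 0 < ε₁)
    (hu : u ∈ Ioo (0 : ℝ) 1) (hg : IsJointMax μ f₀ f₁ ε₀ ε₁ u g₀ g₁)
    (hlt : affinity μ u g₀ g₁ < 1) :
    ∃ lam₀ lam₁, IsLagrangeMax μ f₀ f₁ ε₀ ε₁ u g₀ g₁ lam₀ lam₁ := by
  obtain ⟨lam₀, lam₁, h0, h1, hle⟩ := hg.exists_multipliers hf₀ hf₁ hf₀p hf₁p hε₀ hε₁ hu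
  obtain ⟨m₀, k₀⟩ := (mem_klClass_iff hf₀ hf₀p hε₀.le).1 hg.mem₀
  obtain ⟨m₁, k₁⟩ := (mem_klClass_iff hf₁ hf₁p hε₁.le).1 hg.mem₁
  -- if a multiplier vanished, that density could approach the other one for free
  have p0 : 0 < lam₀ := by
    refine h0.lt_of_ne' fun h => ?_
    obtain ⟨h₀, hh₀, hlt'⟩ := exists_affinity_gt hf₀ hf₀p hu m₁.density hlt
    have := hle h₀ g₁ hh₀ m₁
    rw [h] at this
    nlinarith [mul_nonneg h1 (sub_nonneg.2 k₁)]
  have p1 : 0 < lam₁ := by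
    refine h1.lt_of_ne' fun h => ?_
    obtain ⟨h₁, hh₁, hlt'⟩ := exists_affinity_gt (u := 1 - u) hf₁ hf₁p
      ⟨by linarith [hu.2], by linarith [hu.1]⟩ m₀.density hlt
    rw [affinity_swap] at hlt'
    have := hle g₀ h₁ m₀ hh₁
    rw [h] at this
    nlinarith [mul_nonneg h0 (sub_nonneg.2 k₀)]
  have hs := hle g₀ g₁ m₀ m₁
  have s0 := mul_nonneg h0 (sub_nonneg.2 k₀)
  have s1 := mul_nonneg h1 (sub_nonneg.2 k₁)
  have e0 : lam₀ * (ε₀ - klInt μ g₀ f₀) = 0 := by linarith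
  have e1 : lam₁ * (ε₁ - klInt μ g₁ f₁) = 0 := by linarith
  refine ⟨lam₀, lam₁, m₀, m₁, p0, p1, ?_, ?_, hle⟩
  · have := (mul_eq_zero.1 e0).resolve_left p0.ne'
    linarith
  · have := (mul_eq_zero.1 e1).resolve_left p1.ne'
    linarith

/-- Two joint maxima agree: their midpoint is again a joint maximum, so both divergence
constraints are active there, which strict convexity of the divergence only allows if the two
maxima coincide. -/
theorem IsJointMax.ae_eq {h₀ h₁ : Ω → ℝ} (hf₀ : IsProbDensity μ f₀) (hf₁ : IsProbDensity μ f₁)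
    (hf₀p : ∀ᵐ x ∂μ, 0 < f₀ x) (hf₁p : ∀ᵐ x ∂μ, 0 < f₁ x) (hε₀ : 0 < ε₀) (hε₁ : 0 < ε₁)
    (hu : u ∈ Ioo (0 : ℝ) 1) (hg : IsJointMax μ f₀ f₁ ε₀ ε₁ u g₀ g₁)
    (hh : IsJointMax μ f₀ f₁ ε₀ ε₁ u h₀ h₁) (hlt : affinity μ u g₀ g₁ < 1) :
    g₀ =ᵐ[μ] h₀ ∧ g₁ =ᵐ[μ] h₁ := by
  have hal : affinity μ u g₀ g₁ = affinity μ u h₀ h₁ :=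
    le_antisymm (hh.le _ hg.mem₀ _ hg.mem₁) (hg.le _ hh.mem₀ _ hh.mem₁)
  obtain ⟨m₀, k₀⟩ := (mem_klClass_iff hf₀ hf₀p hε₀.le).1 hg.mem₀
  obtain ⟨m₁, k₁⟩ := (mem_klClass_iff hf₁ hf₁p hε₁.le).1 hg.mem₁
  obtain ⟨n₀, l₀⟩ := (mem_klClass_iff hf₀ hf₀p hε₀.le).1 hh.mem₀
  obtain ⟨n₁, l₁⟩ := (mem_klClass_iff hf₁ hf₁p hε₁.le).1 hh.mem₁
  have hle := affinity_combo_ge hu m₀.density m₁.density n₀.density n₁.density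
    (t := 1 / 2) (s := 1 / 2) (by norm_num) (by norm_num) (by norm_num)
  have c₀ := klClass_combo hf₀ hf₀p hε₀.le hg.mem₀ hh.mem₀ (t := 1 / 2) (s := 1 / 2)
    (by norm_num) (by norm_num) (by norm_num)
  have c₁ := klClass_combo hf₁ hf₁p hε₁.le hg.mem₁ hh.mem₁ (t := 1 / 2) (s := 1 / 2)
    (by norm_num) (by norm_num) (by norm_num)
  have hle2 := hg.le _ c₀ _ c₁
  have hmid : IsJointMax μ f₀ f₁ ε₀ ε₁ u (fun x => 1 / 2 * g₀ x + 1 / 2 * h₀ x)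
      (fun x => 1 / 2 * g₁ x + 1 / 2 * h₁ x) :=
    ⟨c₀, c₁, fun a ha b hb => (hg.le a ha b hb).trans (by linarith)⟩
  obtain ⟨_, _, hL⟩ := hmid.exists_isLagrangeMax hf₀ hf₁ hf₀p hf₁p hε₀ hε₁ hu (by linarith)
  have q₀ := klInt_midpoint_le hf₀ hf₀p m₀ n₀
  have q₁ := klInt_midpoint_le hf₁ hf₁p m₁ n₁
  rw [hL.kl₀] at q₀
  rw [hL.kl₁] at q₁
  exact ⟨ae_eq_of_hellinger m₀.density n₀.density (by linarith),
    ae_eq_of_hellinger m₁.density n₁.density (by linarith)⟩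

end JointMaximum

/-! ### Positivity, and coordinatewise versus joint optimality -/

section Optimality

variable {Ω : Type*} [MeasurableSpace Ω] {μ : Measure Ω} {f f₀ f₁ g₀ g₁ : Ω → ℝ}
  {ε₀ ε₁ u lam₀ lam₁ : ℝ}

theorem one_sub_mem_Ioo (hu : u ∈ Ioo (0 : ℝ) 1) : 1 - u ∈ Ioo (0 : ℝ) 1 :=
  ⟨by linarith [hu.2], by linarith [hu.1]⟩

/-- A Lagrangian maximizer is strictly positive: mixing in a fraction `t` of `f₀` where `g₀`
vanishes lowers the divergence at the rate `t log t`, which beats any loss of order `t`. -/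
theorem IsLagrangeMax.pos₀ (hf₀ : IsProbDensity μ f₀) (hf₀p : ∀ᵐ x ∂μ, 0 < f₀ x)
    (hu : u ∈ Ioo (0 : ℝ) 1) (hε₀ : 0 ≤ ε₀)
    (hg : IsLagrangeMax μ f₀ f₁ ε₀ ε₁ u g₀ g₁ lam₀ lam₁) : ∀ᵐ x ∂μ, 0 < g₀ x := by
  have hd := hg.mem₀.density
  have hd₁ := hg.mem₁.density
  set A : Set Ω := {x | g₀ x ≤ 0} with hA
  have hAm : MeasurableSet A := measurableSet_le hd.measurable measurable_const
  set c := ∫ x, A.indicator f₀ x ∂μ with hc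
  have hci : Integrable (A.indicator f₀) μ := hf₀.integrable.indicator hAm
  have hc0 : ∀ᵐ x ∂μ, 0 ≤ A.indicator f₀ x := by
    filter_upwards [hf₀p] with x hx
    exact Set.indicator_apply_nonneg (fun _ => hx.le)
  -- optimality against the mixture of weight `t = exp (-s)` on `f₀`, divided by `t`
  have key : ∀ s : ℝ, 0 < s → lam₀ * (ε₀ + c * s) ≤ 1 := by
    intro s hs
    set t := Real.exp (-s) with ht
    have ht0 : 0 < t := Real.exp_pos _
    have ht1 : t < 1 := by rw [ht, Real.exp_lt_one_iff]; linarith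
    have hF := hasFiniteKL_self hf₀ hf₀p
    have hmix := hF.combo hf₀ hf₀p hg.mem₀ (t := t) (s := 1 - t) ht0.le (by linarith) (by ring)
    have hK : klInt μ (fun x => t * f₀ x + (1 - t) * g₀ x) f₀ ≤
        (1 - t) * ε₀ + t * -s * c := by
      rw [← hg.kl₀, hc]
      unfold klInt
      rw [← integral_const_mul, ← integral_const_mul, ← integral_add
        (hg.mem₀.integrable_kl.const_mul _) (hci.const_mul _)]
      refine integral_mono_ae hmix.integrable_kl
        ((hg.mem₀.integrable_kl.const_mul _).add (hci.const_mul _)) ?_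
      filter_upwards [hf₀p, hd.nonneg] with x h1 h2
      by_cases hx : x ∈ A
      · have h3 : g₀ x = 0 := le_antisymm hx h2
        simp only [h3, mul_zero, add_zero, Set.indicator_of_mem hx, zero_add]
        rw [mul_div_cancel_right₀ _ h1.ne', ht, Real.log_exp]
        apply le_of_eq
        ring
      · simp only [Set.indicator_of_notMem hx, mul_zero, add_zero]
        have := log_div_mul_convex h1 h1.le h2 ht0.le (by linarith : 0 ≤ 1 - t) (by ring)
        rw [div_self h1.ne', Real.log_one, zero_mul, mul_zero, zero_add] at this
        exact this
    have hD := affinity_combo_ge hu hf₀ hd₁ hd hd₁ (t := t) (s := 1 - t) ht0.le (by linarith)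
      (by ring)
    have e : affinity μ u (fun x => t * f₀ x + (1 - t) * g₀ x) (fun x => t * g₁ x + (1 - t) * g₁ x)
        = affinity μ u (fun x => t * f₀ x + (1 - t) * g₀ x) g₁ :=
      affinity_congr (EventuallyEq.refl _ _) (Eventually.of_forall fun x => by ring)
    rw [e] at hD
    have hL := hg.le _ g₁ hmix hg.mem₁
    rw [hg.kl₁] at hL
    have h0 := affinity_nonneg (u := u) hf₀ hd₁
    have h1 := affinity_le_one hu hd hd₁
    have hL2 := mul_le_mul_of_nonneg_left hK hg.lam₀_pos.le
    have hL3 := mul_nonneg ht0.le h0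
    have : t * (lam₀ * (ε₀ + c * s)) ≤ t * 1 := by nlinarith
    exact le_of_mul_le_mul_left this ht0
  have hcle : c ≤ 0 := by
    by_contra! hcp
    have hl := hg.lam₀_pos
    have h2 := key (2 / (lam₀ * c)) (by positivity)
    have e : lam₀ * (ε₀ + c * (2 / (lam₀ * c))) = lam₀ * ε₀ + 2 := by field_simp
    rw [e] at h2
    linarith [mul_nonneg hl.le hε₀]
  have hc00 : c = 0 := le_antisymm hcle (integral_nonneg_of_ae hc0)
  rw [hc, integral_eq_zero_iff_of_nonneg_ae hc0 hci] at hc00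
  filter_upwards [hc00, hf₀p] with x h1 h2
  by_contra! h3
  rw [Set.indicator_of_mem (show x ∈ A from h3)] at h1
  exact h2.ne' h1

/-- First order optimality of `g₀` for the affinity with `g₁` over a segment issued from `g₀`. -/
theorem integral_ratio_rpow_le (hu : u ∈ Ioo (0 : ℝ) 1) (hg₀ : IsProbDensity μ g₀)
    (hg₁ : IsProbDensity μ g₁) (hg₀p : ∀ᵐ x ∂μ, 0 < g₀ x) (hg₁p : ∀ᵐ x ∂μ, 0 < g₁ x)
    {k : Ω → ℝ} (hk : IsProbDensity μ k)
    (hmax : ∀ t ∈ Ioo (0 : ℝ) 1, affinity μ u (fun x => t * k x + (1 - t) * g₀ x) g₁ ≤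
      affinity μ u g₀ g₁) :
    Integrable (fun x => (g₁ x / g₀ x) ^ u * k x) μ ∧
      ∫ x, (g₁ x / g₀ x) ^ u * k x ∂μ ≤ affinity μ u g₀ g₁ := by
  set D := affinity μ u g₀ g₁ with hD
  have hD0 : 0 ≤ D := affinity_nonneg hg₀ hg₁
  -- `m t` is the mixture and `q t` the slope `g₁ / m t` of the tangent plane at `(m t, g₁)`
  set m : ℝ → Ω → ℝ := fun t x => t * k x + (1 - t) * g₀ x with hm
  have meas_q : ∀ t, Measurable fun x => (g₁ x / m t x) ^ u := fun t =>
    (hg₁.measurable.div ((hk.measurable.const_mul t).add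
      (hg₀.measurable.const_mul (1 - t)))).pow_const u
  have step : ∀ t ∈ Ioo (0 : ℝ) 1, Integrable (fun x => (g₁ x / m t x) ^ u * k x) μ ∧
      ∫ x, (g₁ x / m t x) ^ u * k x ∂μ ≤ D / (1 - t) := by
    intro t ht
    have ht0 := ht.1
    have ht1 : 0 < 1 - t := by linarith [ht.2]
    have hmd : IsProbDensity μ (m t) := hk.combo hg₀ ht0.le ht1.le (by ring)
    have hmp : ∀ᵐ x ∂μ, 0 < m t x := by
      filter_upwards [hg₀p, hk.nonneg] with x h1 h2
      simp only [hm]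
      positivity
    have im : Integrable (fun x => (g₁ x / m t x) ^ u * m t x) μ := by
      refine (hmd.integrable_affinity hu hg₁).congr ?_
      filter_upwards [hmp, hg₁p] with x h1 h2
      exact rpow_mul_rpow_eq_ratio h1 h2.le
    have em : ∫ x, (g₁ x / m t x) ^ u * m t x ∂μ = affinity μ u (m t) g₁ := by
      refine integral_congr_ae ?_
      filter_upwards [hmp, hg₁p] with x h1 h2
      exact (rpow_mul_rpow_eq_ratio h1 h2.le).symm
    have ig : Integrable (fun x => (g₁ x / m t x) ^ u * g₀ x) μ := by
      refine (im.div_const (1 - t)).mono' ((meas_q t).mul hg₀.measurable).aestronglyMeasurable ?_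
      filter_upwards [hmp, hg₁p, hg₀p, hk.nonneg] with x h1 h2 h3 h4
      rw [Real.norm_of_nonneg (by positivity), le_div_iff₀ ht1, mul_assoc]
      refine mul_le_mul_of_nonneg_left ?_ (by positivity)
      simp only [hm]
      nlinarith
    have ik : Integrable (fun x => (g₁ x / m t x) ^ u * k x) μ := by
      refine (im.div_const t).mono' ((meas_q t).mul hk.measurable).aestronglyMeasurable ?_
      filter_upwards [hmp, hg₁p, hg₀p, hk.nonneg] with x h1 h2 h3 h4
      rw [Real.norm_of_nonneg (by positivity), le_div_iff₀ ht0, mul_assoc]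
      refine mul_le_mul_of_nonneg_left ?_ (by positivity)
      simp only [hm]
      nlinarith
    have esum : affinity μ u (m t) g₁ = t * ∫ x, (g₁ x / m t x) ^ u * k x ∂μ +
        (1 - t) * ∫ x, (g₁ x / m t x) ^ u * g₀ x ∂μ := by
      rw [← em, ← integral_const_mul, ← integral_const_mul, ← integral_add (ik.const_mul t)
        (ig.const_mul (1 - t))]
      refine integral_congr_ae (Eventually.of_forall fun x => ?_)
      simp only [hm]
      ring
    have htan : D ≤ (1 - u) * ∫ x, (g₁ x / m t x) ^ u * g₀ x ∂μ + u * affinity μ u (m t) g₁ := by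
      rw [← em, ← integral_const_mul, ← integral_const_mul, ← integral_add (ig.const_mul (1 - u))
        (im.const_mul u)]
      refine integral_mono_ae (hg₀.integrable_affinity hu hg₁)
        ((ig.const_mul (1 - u)).add (im.const_mul u)) ?_
      filter_upwards [hmp, hg₁p, hg₀p] with x h1 h2 h3
      have := rpow_mul_rpow_le_tangent hu h3.le h2.le (div_pos h2 h1)
      have e1 := rpow_mul_rpow_eq_ratio (u := u) h1 h2.le
      have e2 := rpow_mul_rpow_eq_ratio' (u := u) h1 h2
      rw [e1] at e2
      refine this.trans (le_of_eq ?_)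
      rw [e2]
      ring
    have hmt := hmax t ht
    have k0 : 0 ≤ ∫ x, (g₁ x / m t x) ^ u * k x ∂μ := by
      refine integral_nonneg_of_ae ?_
      filter_upwards [hmp, hg₁p, hk.nonneg] with x h1 h2 h3
      positivity
    set X := ∫ x, (g₁ x / m t x) ^ u * k x ∂μ
    set Y := ∫ x, (g₁ x / m t x) ^ u * g₀ x ∂μ
    have hmt' : t * X + (1 - t) * Y ≤ D := by rw [← esum]; exact hmt
    have hYD : D ≤ Y := by
      have : u * affinity μ u (m t) g₁ ≤ u * D := mul_le_mul_of_nonneg_left hmt hu.1.le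
      have h1u : 0 < 1 - u := by linarith [hu.2]
      nlinarith
    refine ⟨ik, ?_⟩
    have hXD : X ≤ D := by nlinarith
    refine hXD.trans ?_
    rw [le_div_iff₀ ht1]
    nlinarith
  -- let the weight of `k` tend to zero and use Fatou's lemma
  set τ : ℕ → ℝ := fun n => 1 / ((n : ℝ) + 2) with hτ
  have hτm : ∀ n, τ n ∈ Ioo (0 : ℝ) 1 := fun n => by
    refine ⟨by positivity, ?_⟩
    rw [hτ, div_lt_one (by positivity)]
    linarith [n.cast_nonneg (α := ℝ)]
  have hτ0 : Tendsto τ atTop (𝓝 0) :=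
    tendsto_const_nhds.div_atTop (tendsto_natCast_atTop_atTop.atTop_add tendsto_const_nhds)
  have hnn : ∀ᵐ x ∂μ, 0 ≤ (g₁ x / g₀ x) ^ u * k x := by
    filter_upwards [hg₀p, hg₁p, hk.nonneg] with x h1 h2 h3
    positivity
  have hFatou : ∫⁻ x, ENNReal.ofReal ((g₁ x / g₀ x) ^ u * k x) ∂μ ≤ ENNReal.ofReal D := by
    have h2 : ∫⁻ x, ENNReal.ofReal ((g₁ x / g₀ x) ^ u * k x) ∂μ =
        ∫⁻ x, liminf (fun n => ENNReal.ofReal ((g₁ x / m (τ n) x) ^ u * k x)) atTop ∂μ := by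
      refine lintegral_congr_ae ?_
      filter_upwards [hg₀p] with x hx
      have hmlim : Tendsto (fun n => m (τ n) x) atTop (𝓝 (g₀ x)) := by
        have := (hτ0.mul_const (k x)).add ((hτ0.const_sub 1).mul_const (g₀ x))
        simpa using this
      exact (ENNReal.tendsto_ofReal ((((tendsto_const_nhds (x := g₁ x)).div hmlim hx.ne').rpow_const
        (Or.inr hu.1.le)).mul_const (k x))).liminf_eq.symm
    rw [h2]
    refine (lintegral_liminf_le fun n => ((meas_q (τ n)).mul hk.measurable).ennreal_ofReal).trans ?_
    have hDlim : Tendsto (fun n => D / (1 - τ n)) atTop (𝓝 D) := by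
      have := (tendsto_const_nhds (x := D)).div (hτ0.const_sub 1) (by norm_num)
      rw [sub_zero, div_one] at this
      exact this
    rw [← (ENNReal.tendsto_ofReal hDlim).liminf_eq]
    refine liminf_le_liminf (Eventually.of_forall fun n => ?_)
    obtain ⟨i, hi⟩ := step (τ n) (hτm n)
    refine (ofReal_integral_eq_lintegral_ofReal i ?_).symm.le.trans (ENNReal.ofReal_le_ofReal hi)
    · filter_upwards [hg₁p, hk.nonneg, hg₀p] with x h1 h2 h3
      have := (hτm n).1
      have : 0 < 1 - τ n := by linarith [(hτm n).2]
      simp only [hm]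
      positivity
  have hint : Integrable (fun x => (g₁ x / g₀ x) ^ u * k x) μ := by
    refine ⟨(((hg₁.measurable.div hg₀.measurable).pow_const u).mul
      hk.measurable).aestronglyMeasurable, ?_⟩
    rw [hasFiniteIntegral_iff_ofReal hnn]
    exact hFatou.trans_lt ENNReal.ofReal_lt_top
  refine ⟨hint, ?_⟩
  rwa [← ofReal_integral_eq_lintegral_ofReal hint hnn, ENNReal.ofReal_le_ofReal_iff hD0] at hFatou

theorem rpow_ratio_inv {a b : ℝ} (ha : 0 ≤ a) (hb : 0 ≤ b) :
    (a / b) ^ (1 - u) = (b / a) ^ (-1 + u) := by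
  rw [← inv_div b a, Real.inv_rpow (by positivity), ← Real.rpow_neg (by positivity)]
  congr 1
  ring

/-- If the tangent plane of slope `g₁ / g₀` does not exceed its values at `(g₀, g₁)` on the two
classes, then `(g₀, g₁)` is a joint maximum. -/
theorem isJointMax_of_tangent (hu : u ∈ Ioo (0 : ℝ) 1) (hg₀ : g₀ ∈ klClass μ f₀ ε₀)
    (hg₁ : g₁ ∈ klClass μ f₁ ε₁) (hg₀p : ∀ᵐ x ∂μ, 0 < g₀ x) (hg₁p : ∀ᵐ x ∂μ, 0 < g₁ x)
    (h0 : ∀ k ∈ klClass μ f₀ ε₀, Integrable (fun x => (g₁ x / g₀ x) ^ u * k x) μ ∧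
      ∫ x, (g₁ x / g₀ x) ^ u * k x ∂μ ≤ affinity μ u g₀ g₁)
    (h1 : ∀ k ∈ klClass μ f₁ ε₁, Integrable (fun x => (g₁ x / g₀ x) ^ (-1 + u) * k x) μ ∧
      ∫ x, (g₁ x / g₀ x) ^ (-1 + u) * k x ∂μ ≤ affinity μ u g₀ g₁) :
    IsJointMax μ f₀ f₁ ε₀ ε₁ u g₀ g₁ := by
  refine ⟨hg₀, hg₁, fun k₀ hk₀ k₁ hk₁ => ?_⟩
  obtain ⟨i0, l0⟩ := h0 k₀ hk₀
  obtain ⟨i1, l1⟩ := h1 k₁ hk₁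
  have : affinity μ u k₀ k₁ ≤ (1 - u) * ∫ x, (g₁ x / g₀ x) ^ u * k₀ x ∂μ +
      u * ∫ x, (g₁ x / g₀ x) ^ (-1 + u) * k₁ x ∂μ := by
    rw [← integral_const_mul, ← integral_const_mul, ← integral_add (i0.const_mul _)
      (i1.const_mul _)]
    refine integral_mono_ae (hk₀.1.integrable_affinity hu hk₁.1)
      ((i0.const_mul _).add (i1.const_mul _)) ?_
    filter_upwards [hg₀p, hg₁p, hk₀.1.nonneg, hk₁.1.nonneg] with x a b c d
    refine (rpow_mul_rpow_le_tangent hu c d (div_pos b a)).trans (le_of_eq ?_)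
    ring
  have a := mul_le_mul_of_nonneg_left l0 (sub_nonneg.2 hu.2.le)
  have b := mul_le_mul_of_nonneg_left l1 hu.1.le
  linarith

/-- A pair that is optimal in each density separately is optimal jointly. -/
theorem SolvesMaximization.isJointMax (hf₀ : IsProbDensity μ f₀) (hf₁ : IsProbDensity μ f₁)
    (hf₀p : ∀ᵐ x ∂μ, 0 < f₀ x) (hf₁p : ∀ᵐ x ∂μ, 0 < f₁ x) (hε₀ : 0 ≤ ε₀) (hε₁ : 0 ≤ ε₁)
    (hu : u ∈ Ioo (0 : ℝ) 1) (hg : SolvesMaximization μ f₀ f₁ ε₀ ε₁ u g₀ g₁) :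
    IsJointMax μ f₀ f₁ ε₀ ε₁ u g₀ g₁ := by
  obtain ⟨⟨m₀, p₀⟩, ⟨m₁, p₁⟩, x₀, x₁⟩ := hg
  have mix : ∀ {g k : Ω → ℝ}, IsProbDensity μ k → (∀ᵐ x ∂μ, 0 < g x) → ∀ t ∈ Ioo (0 : ℝ) 1,
      ∀ᵐ x ∂μ, 0 < t * k x + (1 - t) * g x := by
    intro g k hk hg t ht
    have h1 := ht.1
    have h2 : 0 < 1 - t := by linarith [ht.2]
    filter_upwards [hk.nonneg, hg] with x a b
    positivity
  refine isJointMax_of_tangent hu m₀ m₁ p₀ p₁ (fun k hk => ?_) (fun k hk => ?_)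
  · exact integral_ratio_rpow_le hu m₀.1 m₁.1 p₀ p₁ hk.1 fun t ht => x₀ _
      ⟨klClass_combo hf₀ hf₀p hε₀ hk m₀ ht.1.le (by linarith [ht.2]) (by ring), mix hk.1 p₀ t ht⟩
  · have := integral_ratio_rpow_le (one_sub_mem_Ioo hu) m₁.1 m₀.1 p₁ p₀ hk.1 fun t ht => by
      rw [affinity_swap, affinity_swap]
      exact x₁ _ ⟨klClass_combo hf₁ hf₁p hε₁ hk m₁ ht.1.le (by linarith [ht.2]) (by ring),
        mix hk.1 p₁ t ht⟩
    rw [affinity_swap] at this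
    have e : (fun x => (g₀ x / g₁ x) ^ (1 - u) * k x) =ᵐ[μ]
        fun x => (g₁ x / g₀ x) ^ (-1 + u) * k x := by
      filter_upwards [p₀, p₁] with x a b
      rw [rpow_ratio_inv a.le b.le]
    exact ⟨this.1.congr e, (integral_congr_ae e).symm.le.trans this.2⟩

theorem IsJointMax.solvesMaximization (hg : IsJointMax μ f₀ f₁ ε₀ ε₁ u g₀ g₁)
    (hg₀p : ∀ᵐ x ∂μ, 0 < g₀ x) (hg₁p : ∀ᵐ x ∂μ, 0 < g₁ x) :
    SolvesMaximization μ f₀ f₁ ε₀ ε₁ u g₀ g₁ where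
  mem₀ := ⟨hg.mem₀, hg₀p⟩
  mem₁ := ⟨hg.mem₁, hg₁p⟩
  max₀ h hh := hg.le h hh.1 g₁ hg.mem₁
  max₁ h hh := hg.le g₀ hg.mem₀ h hh.1

end Optimality

/-! ### Stationarity and the Lagrangians -/

section Stationarity

variable {Ω : Type*} [MeasurableSpace Ω] {μ : Measure Ω} {f f₀ f₁ g₀ g₁ : Ω → ℝ}
  {ε₀ ε₁ u lam₀ lam₁ mu₀ mu₁ : ℝ}

theorem integrable_bdd_mul {η F : Ω → ℝ} (hη : Measurable η) {C : ℝ} (hC : ∀ x, |η x| ≤ C)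
    (hF : Integrable F μ) : Integrable (fun x => η x * F x) μ :=
  hF.bdd_mul (c := C) hη.aestronglyMeasurable (Eventually.of_forall hC)

/-- The first variation of the Lagrangian at a maximizer vanishes along the relative perturbations
`g₀ (1 + τ η)`, `η` bounded, which preserve the total mass. -/
theorem IsLagrangeMax.first_variation (hf₀ : IsProbDensity μ f₀) (hf₀p : ∀ᵐ x ∂μ, 0 < f₀ x)
    (hu : u ∈ Ioo (0 : ℝ) 1) (hg : IsLagrangeMax μ f₀ f₁ ε₀ ε₁ u g₀ g₁ lam₀ lam₁)
    (hp₀ : ∀ᵐ x ∂μ, 0 < g₀ x) {η : Ω → ℝ} (hη : Measurable η) (hηb : ∀ x, |η x| ≤ 1 / 2)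
    (hη0 : ∫ x, η x * g₀ x ∂μ = 0) :
    (1 - u) * ∫ x, η x * (g₁ x ^ u * g₀ x ^ (1 - u)) ∂μ -
      lam₀ * ∫ x, η x * (Real.log (g₀ x / f₀ x) * g₀ x) ∂μ = 0 := by
  have hd := hg.mem₀.density
  have hd₁ := hg.mem₁.density
  have iP := hd.integrable_affinity hu hd₁
  have iZ := hg.mem₀.integrable_kl
  have hη2 : ∀ x, |η x ^ 2| ≤ 1 := fun x => by
    have h1 := abs_nonneg (η x)
    rw [abs_pow]
    nlinarith [hηb x]
  have iηP := integrable_bdd_mul hη hηb iP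
  have iηZ := integrable_bdd_mul hη hηb iZ
  have iηg := integrable_bdd_mul hη hηb hd.integrable
  have iη2P := integrable_bdd_mul (hη.pow_const 2) hη2 iP
  have iη2g := integrable_bdd_mul (hη.pow_const 2) hη2 hd.integrable
  set X := (1 - u) * ∫ x, η x * (g₁ x ^ u * g₀ x ^ (1 - u)) ∂μ -
    lam₀ * ∫ x, η x * (Real.log (g₀ x / f₀ x) * g₀ x) ∂μ with hX
  set Q := ∫ x, η x ^ 2 * (g₁ x ^ u * g₀ x ^ (1 - u)) ∂μ with hQ
  set R := ∫ x, η x ^ 2 * g₀ x ∂μ with hR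
  -- `X` is the first variation; the second order terms are controlled by `Q` and `R`
  have key : ∀ τ : ℝ, |τ| ≤ 1 → τ * X ≤ τ ^ 2 * (Q + lam₀ * R) := by
    intro τ hτ
    have hτη : ∀ x, |τ * η x| ≤ 1 / 2 := fun x => by
      rw [abs_mul]
      nlinarith [hηb x, abs_nonneg (η x), abs_nonneg τ]
    have h1τ : ∀ x, 0 < 1 + τ * η x := fun x => by linarith [(abs_le.1 (hτη x)).1]
    have ih : Integrable (fun x => g₀ x + τ * (η x * g₀ x)) μ := hd.integrable.add (iηg.const_mul τ)
    have hhd : IsProbDensity μ (fun x => g₀ x + τ * (η x * g₀ x)) := by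
      refine ⟨hd.measurable.add ((hη.mul hd.measurable).const_mul τ), ?_, ih, ?_⟩
      · filter_upwards [hp₀] with x hx
        have : g₀ x + τ * (η x * g₀ x) = g₀ x * (1 + τ * η x) := by ring
        rw [this]
        exact (mul_pos hx (h1τ x)).le
      · rw [integral_add hd.integrable (iηg.const_mul τ), integral_const_mul, hη0,
          hd.integral_eq_one, mul_zero, add_zero]
    have ib1 : Integrable (fun x => Real.log (g₀ x / f₀ x) * g₀ x +
        τ * (η x * (Real.log (g₀ x / f₀ x) * g₀ x))) μ := iZ.add (iηZ.const_mul τ)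
    have ib2 : Integrable (fun x => τ * (η x * g₀ x) + τ ^ 2 * (η x ^ 2 * g₀ x)) μ :=
      (iηg.const_mul τ).add (iη2g.const_mul (τ ^ 2))
    have hle : ∀ᵐ x ∂μ, Real.log ((g₀ x + τ * (η x * g₀ x)) / f₀ x) *
        (g₀ x + τ * (η x * g₀ x)) ≤ (Real.log (g₀ x / f₀ x) * g₀ x +
        τ * (η x * (Real.log (g₀ x / f₀ x) * g₀ x))) +
        (τ * (η x * g₀ x) + τ ^ 2 * (η x ^ 2 * g₀ x)) := by
      filter_upwards [hp₀, hf₀p] with x h1 h2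
      have e : g₀ x + τ * (η x * g₀ x) = (1 + τ * η x) * g₀ x := by ring
      rw [e, mul_div_assoc, Real.log_mul (h1τ x).ne' (div_pos h1 h2).ne']
      have := mul_le_mul_of_nonneg_right (one_add_mul_log_le (x := τ * η x)
        (by linarith [h1τ x])) h1.le
      linarith
    have hhK : HasFiniteKL μ f₀ (fun x => g₀ x + τ * (η x * g₀ x)) :=
      hasFiniteKL_of_le hf₀ hf₀p hhd (ib1.add ib2) hle
    have hK : klInt μ (fun x => g₀ x + τ * (η x * g₀ x)) f₀ ≤ ε₀ +
        τ * ∫ x, η x * (Real.log (g₀ x / f₀ x) * g₀ x) ∂μ + τ ^ 2 * R := by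
      refine (integral_mono_ae hhK.integrable_kl (ib1.add ib2) hle).trans (le_of_eq ?_)
      simp only [Pi.add_apply]
      rw [integral_add ib1 ib2, integral_add iZ (iηZ.const_mul τ),
        integral_add (iηg.const_mul τ) (iη2g.const_mul (τ ^ 2)), integral_const_mul,
        integral_const_mul, integral_const_mul, hη0, ← hg.kl₀]
      unfold klInt
      ring
    have hA : affinity μ u g₀ g₁ + (1 - u) * τ * ∫ x, η x * (g₁ x ^ u * g₀ x ^ (1 - u)) ∂μ -
        τ ^ 2 * Q ≤ affinity μ u (fun x => g₀ x + τ * (η x * g₀ x)) g₁ := by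
      have i1 : Integrable (fun x => g₁ x ^ u * g₀ x ^ (1 - u) +
          (1 - u) * τ * (η x * (g₁ x ^ u * g₀ x ^ (1 - u)))) μ :=
        iP.add (iηP.const_mul ((1 - u) * τ))
      have i2 := iη2P.const_mul (τ ^ 2)
      unfold affinity
      rw [hQ, ← integral_const_mul, ← integral_const_mul, ← integral_add iP
        (iηP.const_mul ((1 - u) * τ)), ← integral_sub i1 i2]
      refine integral_mono_ae (i1.sub i2) (hhd.integrable_affinity hu hd₁) ?_
      filter_upwards [hp₀, hd₁.nonneg] with x h1 h2
      have e : g₀ x + τ * (η x * g₀ x) = g₀ x * (1 + τ * η x) := by ring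
      rw [e, Real.mul_rpow h1.le (h1τ x).le]
      have hP : 0 ≤ g₁ x ^ u * g₀ x ^ (1 - u) := by positivity
      have := mul_le_mul_of_nonneg_left (one_add_rpow_ge (one_sub_mem_Ioo hu) (hτη x)) hP
      linarith
    have hL := hg.le _ g₁ hhK hg.mem₁
    rw [hg.kl₁] at hL
    have hL2 := mul_le_mul_of_nonneg_left hK hg.lam₀_pos.le
    rw [hX]
    nlinarith
  have hX0 : ∀ {Y C : ℝ}, (∀ τ : ℝ, 0 < τ → τ ≤ 1 → τ * Y ≤ τ ^ 2 * C) → Y ≤ 0 := by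
    intro Y C h
    by_contra! hY
    have hC : 0 < |C| + 1 := by positivity
    have hτ : 0 < min 1 (Y / (2 * (|C| + 1))) := by positivity
    have h1 := h _ hτ (min_le_left _ _)
    set τ := min 1 (Y / (2 * (|C| + 1)))
    have h2 : τ * (2 * (|C| + 1)) ≤ Y := (le_div_iff₀ (by positivity)).1 (min_le_right _ _)
    have h3 : Y ≤ τ * C := by
      refine le_of_mul_le_mul_left ?_ hτ
      nlinarith
    nlinarith [le_abs_self C]
  refine le_antisymm (hX0 fun τ h0 h1 => key τ (by rwa [abs_of_pos h0])) ?_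
  have := hX0 (Y := -X) (C := Q + lam₀ * R) fun τ h0 h1 => by
    have := key (-τ) (by rwa [abs_neg, abs_of_pos h0])
    rw [neg_sq] at this
    linarith
  linarith

/-- The stationarity condition: the pointwise derivative of the Lagrangian at a maximizer is
constant. It is orthogonal to all bounded perturbations of mean zero, in particular to its own
centred truncations. -/
theorem IsLagrangeMax.stationary (hf₀ : IsProbDensity μ f₀) (hf₀p : ∀ᵐ x ∂μ, 0 < f₀ x)
    (hu : u ∈ Ioo (0 : ℝ) 1) (hg : IsLagrangeMax μ f₀ f₁ ε₀ ε₁ u g₀ g₁ lam₀ lam₁)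
    (hp₀ : ∀ᵐ x ∂μ, 0 < g₀ x) :
    ∃ w : ℝ, ∀ᵐ x ∂μ, (1 - u) * (g₁ x / g₀ x) ^ u - lam₀ * Real.log (g₀ x / f₀ x) = w := by
  have hd := hg.mem₀.density
  have hd₁ := hg.mem₁.density
  have iP := hd.integrable_affinity hu hd₁
  have iZ := hg.mem₀.integrable_kl
  set W : Ω → ℝ := fun x => (1 - u) * (g₁ x / g₀ x) ^ u - lam₀ * Real.log (g₀ x / f₀ x) with hW
  have hWm : Measurable W := (((hd₁.measurable.div hd.measurable).pow_const u).const_mul _).sub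
    ((Real.measurable_log.comp (hd.measurable.div hf₀.measurable)).const_mul _)
  have hWg : ∀ᵐ x ∂μ, W x * g₀ x = (1 - u) * (g₁ x ^ u * g₀ x ^ (1 - u)) -
      lam₀ * (Real.log (g₀ x / f₀ x) * g₀ x) := by
    filter_upwards [hp₀, hd₁.nonneg] with x h1 h2
    rw [rpow_mul_rpow_eq_ratio h1 h2, hW]
    ring
  have iW : Integrable (fun x => W x * g₀ x) μ :=
    ((iP.const_mul (1 - u)).sub (iZ.const_mul lam₀)).congr (hWg.mono fun x hx => hx.symm)
  -- the truncation of `W` at level `n` and its mean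
  set θ : ℕ → Ω → ℝ := fun n x => max (-(n : ℝ)) (min n (W x)) with hθ
  set m : ℕ → ℝ := fun n => ∫ x, θ n x * g₀ x ∂μ with hm
  have hθm : ∀ n, Measurable (θ n) := fun n => measurable_const.max (measurable_const.min hWm)
  have hθb : ∀ n x, |θ n x| ≤ n := fun n x =>
    abs_le.2 ⟨le_max_left _ _, max_le (by linarith [n.cast_nonneg (α := ℝ)]) (min_le_left _ _)⟩
  have iθ : ∀ n, Integrable (fun x => θ n x * g₀ x) μ := fun n =>
    integrable_bdd_mul (hθm n) (hθb n) hd.integrable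
  have hmb : ∀ n, |m n| ≤ n := fun n => by
    have h1 : m n ≤ ∫ x, (n : ℝ) * g₀ x ∂μ := by
      refine integral_mono_ae (iθ n) (hd.integrable.const_mul _) ?_
      filter_upwards [hd.nonneg] with x hx
      exact mul_le_mul_of_nonneg_right (abs_le.1 (hθb n x)).2 hx
    have h2 : ∫ x, -(n : ℝ) * g₀ x ∂μ ≤ m n := by
      refine integral_mono_ae (hd.integrable.const_mul _) (iθ n) ?_
      filter_upwards [hd.nonneg] with x hx
      exact mul_le_mul_of_nonneg_right (abs_le.1 (hθb n x)).1 hx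
    rw [integral_const_mul, hd.integral_eq_one, mul_one] at h1 h2
    exact abs_le.2 ⟨h2, h1⟩
  have hconst : ∀ n, ∀ᵐ x ∂μ, θ n x = m n := by
    intro n
    have hN : (0 : ℝ) < 4 * (n + 1) := by positivity
    set η : Ω → ℝ := fun x => (θ n x - m n) / (4 * (n + 1)) with hη
    have hηm : Measurable η := ((hθm n).sub_const _).div_const _
    have hηb : ∀ x, |η x| ≤ 1 / 2 := fun x => by
      rw [hη, abs_div, abs_of_pos hN, div_le_iff₀ hN]
      have := abs_sub (θ n x) (m n)
      linarith [hθb n x, hmb n]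
    have hη0 : ∫ x, η x * g₀ x ∂μ = 0 := by
      have e : (fun x => η x * g₀ x) = fun x => (θ n x * g₀ x - m n * g₀ x) / (4 * (n + 1)) := by
        funext x; simp only [hη]; ring
      rw [e, integral_div, integral_sub (iθ n) (hd.integrable.const_mul _), integral_const_mul,
        hd.integral_eq_one, mul_one, sub_self, zero_div]
    have hv := hg.first_variation hf₀ hf₀p hu hp₀ hηm hηb hη0
    have iηP := integrable_bdd_mul hηm hηb iP
    have iηZ := integrable_bdd_mul hηm hηb iZ
    have iηg := integrable_bdd_mul hηm hηb hd.integrable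
    have iηW := integrable_bdd_mul hηm hηb iW
    have hvW : ∫ x, η x * (W x * g₀ x) ∂μ = 0 := by
      rw [← hv, ← integral_const_mul, ← integral_const_mul, ← integral_sub (iηP.const_mul _)
        (iηZ.const_mul _)]
      refine integral_congr_ae ?_
      filter_upwards [hWg] with x hx
      rw [hx]
      ring
    have hη2b : ∀ x, |η x ^ 2| ≤ 1 := fun x => by
      have h1 := abs_nonneg (η x)
      rw [abs_pow]
      nlinarith [hηb x]
    have i2 := integrable_bdd_mul (hηm.pow_const 2) hη2b hd.integrable
    have i3 := i2.const_mul (4 * ((n : ℝ) + 1))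
    have i4 : Integrable (fun x => η x * (W x * g₀ x) - m n * (η x * g₀ x)) μ :=
      iηW.sub (iηg.const_mul (m n))
    have hle : 4 * ((n : ℝ) + 1) * ∫ x, η x ^ 2 * g₀ x ∂μ ≤ 0 := by
      have e : ∫ x, (η x * (W x * g₀ x) - m n * (η x * g₀ x)) ∂μ = 0 := by
        rw [integral_sub iηW (iηg.const_mul (m n)), integral_const_mul, hvW, hη0]
        ring
      rw [← e, ← integral_const_mul]
      refine integral_mono_ae i3 i4 ?_
      filter_upwards [hp₀] with x hx
      -- truncation is monotone and fixes `m n`, so `θ - m n` and `W - θ` have the same sign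
      have hs : 0 ≤ (θ n x - m n) * (W x - θ n x) := by
        obtain ⟨a, b⟩ := abs_le.1 (hmb n)
        simp only [hθ]
        rcases le_total (n : ℝ) (W x) with h | h
        · rw [min_eq_left h, max_eq_right (by linarith)]
          exact mul_nonneg (by linarith) (by linarith)
        · rw [min_eq_right h]
          rcases le_total (-(n : ℝ)) (W x) with h' | h'
          · rw [max_eq_right h']; simp
          · rw [max_eq_left h']
            exact mul_nonneg_of_nonpos_of_nonpos (by linarith) (by linarith)
      have e1 : θ n x - m n = 4 * ((n : ℝ) + 1) * η x := by
        simp only [hη]; field_simp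
      have e2 : W x - θ n x = W x - m n - 4 * ((n : ℝ) + 1) * η x := by linarith
      rw [e1, e2, mul_assoc] at hs
      have hs' := nonneg_of_mul_nonneg_right hs hN
      nlinarith [mul_nonneg hs' hx.le]
    have hz : ∫ x, η x ^ 2 * g₀ x ∂μ = 0 := by
      have hnn : 0 ≤ ∫ x, η x ^ 2 * g₀ x ∂μ := by
        refine integral_nonneg_of_ae ?_
        filter_upwards [hd.nonneg] with x hx
        exact mul_nonneg (sq_nonneg _) hx
      nlinarith
    rw [integral_eq_zero_iff_of_nonneg_ae (by
      filter_upwards [hd.nonneg] with x hx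
      exact mul_nonneg (sq_nonneg _) hx) i2] at hz
    filter_upwards [hz, hp₀] with x h1 h2
    have h3 : η x = 0 := by
      have : η x ^ 2 * g₀ x = 0 := h1
      simpa [h2.ne'] using this
    have h4 : (θ n x - m n) / (4 * ((n : ℝ) + 1)) = 0 := h3
    rw [div_eq_zero_iff] at h4
    linarith [h4.resolve_right hN.ne']
  -- at almost every point, `W x` is the eventual value of the means `m n`
  refine ⟨limUnder atTop m, ?_⟩
  filter_upwards [ae_all_iff.2 hconst] with x hx
  refine Eq.symm (Tendsto.limUnder_eq (tendsto_const_nhds.congr' ?_))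
  obtain ⟨N, hN⟩ := exists_nat_ge |W x|
  filter_upwards [eventually_ge_atTop N] with n hn
  have hn' : |W x| ≤ n := hN.trans (by exact_mod_cast hn)
  rw [← hx n]
  simp only [hθ]
  rw [min_eq_right (abs_le.1 hn').2, max_eq_right (abs_le.1 hn').1]

/-- Stationarity solved for the density. -/
theorem eq_exp_of_stationary {a b f : ℝ} (ha : 0 < a) (hf : 0 < f) (hl : 0 < lam₀)
    (hs : b - lam₀ * Real.log (a / f) = lam₀ + mu₀) :
    a = Real.exp ((-lam₀ - mu₀) / lam₀) * Real.exp (b / lam₀) * f := by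
  rw [← Real.exp_add]
  have e : (-lam₀ - mu₀) / lam₀ + b / lam₀ = Real.log (a / f) := by
    field_simp
    linarith
  rw [e, Real.exp_log (by positivity), div_mul_cancel₀ _ hf.ne']

/-- By concavity, the stationarity condition characterizes the pointwise maximum of the Lagrangian
density, also over functions which are not normalized. -/
theorem lagrangian₀_le (hu : u ∈ Ioo (0 : ℝ) 1) (hf₀p : ∀ᵐ x ∂μ, 0 < f₀ x)
    (hg₀ : HasFiniteKL μ f₀ g₀) (hg₁ : IsProbDensity μ g₁) (hp₀ : ∀ᵐ x ∂μ, 0 < g₀ x)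
    (hp₁ : ∀ᵐ x ∂μ, 0 < g₁ x) (hl : 0 < lam₀)
    (hs : ∀ᵐ x ∂μ, (1 - u) * (g₁ x / g₀ x) ^ u - lam₀ * Real.log (g₀ x / f₀ x) = lam₀ + mu₀)
    {h : Ω → ℝ} (hh : InLagrangianDomain μ f₀ h) :
    lagrangian₀ μ f₀ ε₀ u h g₁ lam₀ mu₀ ≤ lagrangian₀ μ f₀ ε₀ u g₀ g₁ lam₀ mu₀ := by
  have val : ∀ {k : Ω → ℝ}, InLagrangianDomain μ f₀ k →
      Integrable (fun x => g₁ x ^ u * k x ^ (1 - u) - lam₀ * (Real.log (k x / f₀ x) * k x) -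
        mu₀ * k x) μ ∧
      lagrangian₀ μ f₀ ε₀ u k g₁ lam₀ mu₀ = lam₀ * ε₀ + mu₀ +
        ∫ x, (g₁ x ^ u * k x ^ (1 - u) - lam₀ * (Real.log (k x / f₀ x) * k x) - mu₀ * k x) ∂μ := by
    intro k hk
    have i1 := integrable_affinity hu hk.measurable hg₁.measurable (hk.pos.mono fun x hx => hx.le)
      hg₁.nonneg hk.integrable hg₁.integrable
    have i2 := hk.integrable_kl.const_mul lam₀
    have i12 : Integrable (fun x => g₁ x ^ u * k x ^ (1 - u) -
      lam₀ * (Real.log (k x / f₀ x) * k x)) μ := i1.sub i2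
    have i3 := hk.integrable.const_mul mu₀
    refine ⟨i12.sub i3, ?_⟩
    rw [integral_sub i12 i3, integral_sub i1 i2, integral_const_mul, integral_const_mul]
    unfold lagrangian₀ affinity klInt
    ring
  have hdom : InLagrangianDomain μ f₀ g₀ :=
    ⟨hg₀.density.measurable, hp₀, hg₀.density.integrable, hg₀.integrable_kl⟩
  rw [(val hh).2, (val hdom).2]
  refine add_le_add le_rfl (integral_mono_ae (val hh).1 (val hdom).1 ?_)
  filter_upwards [hs, hf₀p, hp₀, hp₁, hh.pos] with x h1 h2 h3 h4 h5
  have hl' : 0 < g₁ x / g₀ x := div_pos h4 h3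
  have t1 := rpow_mul_rpow_le_tangent hu h5.le h4.le hl'
  have e1 := rpow_mul_rpow_eq_ratio (u := u) h3 h4.le
  have e2 := rpow_mul_rpow_eq_ratio' (u := u) h3 h4
  have t2 := mul_le_mul_of_nonneg_left (log_div_mul_le h2 h3 h5.le) hl.le
  have e3 : (g₁ x / g₀ x) ^ (-1 + u) * g₁ x = (g₁ x / g₀ x) ^ u * g₀ x := by rw [← e2, e1]
  have t3 : (1 - u) * (g₁ x / g₀ x) ^ u * h x = lam₀ * Real.log (g₀ x / f₀ x) * h x +
      (lam₀ + mu₀) * h x := by rw [← h1]; ring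
  have t4 : (1 - u) * (g₁ x / g₀ x) ^ u * g₀ x = lam₀ * Real.log (g₀ x / f₀ x) * g₀ x +
      (lam₀ + mu₀) * g₀ x := by rw [← h1]; ring
  rw [e1]
  have t5 : u * (g₁ x / g₀ x) ^ (-1 + u) * g₁ x = u * ((g₁ x / g₀ x) ^ u * g₀ x) := by
    rw [← e3]; ring
  linarith

theorem lagrangian₁_eq_swap : lagrangian₁ μ f₁ ε₁ u g₀ g₁ lam₁ mu₁ =
    lagrangian₀ μ f₁ ε₁ (1 - u) g₁ g₀ lam₁ mu₁ := by
  unfold lagrangian₁ lagrangian₀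
  rw [affinity_swap]

end Stationarity

/-! ### Stationary pairs and the system of equations -/

section System

variable {Ω : Type*} [MeasurableSpace Ω] {μ : Measure Ω} {f f₀ f₁ g g₀ g₁ : Ω → ℝ}
  {ε ε₀ ε₁ u lam₀ lam₁ mu₀ mu₁ : ℝ}

/-- The pair `(g₀, g₁)` consists of positive densities lying on the boundaries of the uncertainty
classes, and satisfies the stationarity conditions of the two coupled Lagrangians. -/
structure IsStationary (μ : Measure Ω) (f₀ f₁ : Ω → ℝ) (ε₀ ε₁ u : ℝ) (g₀ g₁ : Ω → ℝ)
    (lam₀ mu₀ lam₁ mu₁ : ℝ) : Prop where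
  mem₀ : HasFiniteKL μ f₀ g₀
  mem₁ : HasFiniteKL μ f₁ g₁
  pos₀ : ∀ᵐ x ∂μ, 0 < g₀ x
  pos₁ : ∀ᵐ x ∂μ, 0 < g₁ x
  lam₀_pos : 0 < lam₀
  lam₁_pos : 0 < lam₁
  kl₀ : klInt μ g₀ f₀ = ε₀
  kl₁ : klInt μ g₁ f₁ = ε₁
  stat₀ : ∀ᵐ x ∂μ, (1 - u) * (g₁ x / g₀ x) ^ u - lam₀ * Real.log (g₀ x / f₀ x) = lam₀ + mu₀
  stat₁ : ∀ᵐ x ∂μ, u * (g₁ x / g₀ x) ^ (-1 + u) - lam₁ * Real.log (g₁ x / f₁ x) = lam₁ + mu₁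

theorem IsStationary.swap
    (hg : IsStationary μ f₀ f₁ ε₀ ε₁ u g₀ g₁ lam₀ mu₀ lam₁ mu₁) :
    IsStationary μ f₁ f₀ ε₁ ε₀ (1 - u) g₁ g₀ lam₁ mu₁ lam₀ mu₀ where
  mem₀ := hg.mem₁
  mem₁ := hg.mem₀
  pos₀ := hg.pos₁
  pos₁ := hg.pos₀
  lam₀_pos := hg.lam₁_pos
  lam₁_pos := hg.lam₀_pos
  kl₀ := hg.kl₁
  kl₁ := hg.kl₀
  stat₀ := by
    filter_upwards [hg.stat₁, hg.pos₀, hg.pos₁] with x h a b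
    rw [rpow_ratio_inv a.le b.le, sub_sub_cancel]
    exact h
  stat₁ := by
    filter_upwards [hg.stat₀, hg.pos₀, hg.pos₁] with x h a b
    rw [← rpow_ratio_inv b.le a.le, sub_sub_cancel]
    exact h

theorem IsLagrangeMax.exists_isStationary (hf₀ : IsProbDensity μ f₀) (hf₁ : IsProbDensity μ f₁)
    (hf₀p : ∀ᵐ x ∂μ, 0 < f₀ x) (hf₁p : ∀ᵐ x ∂μ, 0 < f₁ x) (hε₀ : 0 ≤ ε₀) (hε₁ : 0 ≤ ε₁)
    (hu : u ∈ Ioo (0 : ℝ) 1) (hg : IsLagrangeMax μ f₀ f₁ ε₀ ε₁ u g₀ g₁ lam₀ lam₁) :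
    ∃ mu₀ mu₁, IsStationary μ f₀ f₁ ε₀ ε₁ u g₀ g₁ lam₀ mu₀ lam₁ mu₁ := by
  have hu' := one_sub_mem_Ioo hu
  have p₀ := hg.pos₀ hf₀ hf₀p hu hε₀
  have p₁ := hg.swap.pos₀ hf₁ hf₁p hu' hε₁
  obtain ⟨w₀, hw₀⟩ := hg.stationary hf₀ hf₀p hu p₀
  obtain ⟨w₁, hw₁⟩ := hg.swap.stationary hf₁ hf₁p hu' p₁
  refine ⟨w₀ - lam₀, w₁ - lam₁, hg.mem₀, hg.mem₁, p₀, p₁, hg.lam₀_pos, hg.lam₁_pos, hg.kl₀,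
    hg.kl₁, ?_, ?_⟩
  · filter_upwards [hw₀] with x hx
    rw [hx]; ring
  · filter_upwards [hw₁, p₀, p₁] with x hx a b
    rw [rpow_ratio_inv a.le b.le, sub_sub_cancel] at hx
    rw [hx]; ring

/-- An exponential tilt `g` of `f` maximizes its exponent `q` in mean over the divergence ball
through `g`: this is Gibbs' inequality. -/
theorem integral_tilt_le (hf : IsProbDensity μ f) (hfp : ∀ᵐ x ∂μ, 0 < f x)
    (hg : HasFiniteKL μ f g) (hgp : ∀ᵐ x ∂μ, 0 < g x) (hε : klInt μ g f = ε) {q : Ω → ℝ}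
    (hq : Measurable q) (hq0 : ∀ᵐ x ∂μ, 0 ≤ q x) {lam w : ℝ} (hl : 0 < lam)
    (hs : ∀ᵐ x ∂μ, q x - lam * Real.log (g x / f x) = w) {k : Ω → ℝ} (hk : k ∈ klClass μ f ε) :
    Integrable (fun x => q x * k x) μ ∧ ∫ x, q x * k x ∂μ ≤ ∫ x, q x * g x ∂μ := by
  have hε0 : 0 ≤ ε := hε ▸ klInt_nonneg hf hfp hg
  obtain ⟨hkK, hkε⟩ := (mem_klClass_iff hf hfp hε0).1 hk
  have e : ∫ x, q x * g x ∂μ = lam * ε + w := by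
    have : ∫ x, q x * g x ∂μ = ∫ x, (lam * (Real.log (g x / f x) * g x) + w * g x) ∂μ := by
      refine integral_congr_ae ?_
      filter_upwards [hs] with x hx
      have : q x = lam * Real.log (g x / f x) + w := by linarith
      rw [this]; ring
    rw [this, integral_add (hg.integrable_kl.const_mul lam) (hg.density.integrable.const_mul w),
      integral_const_mul, integral_const_mul, hg.density.integral_eq_one, ← hε]
    unfold klInt
    ring
  have i1 := hkK.integrable_kl.const_mul lam
  have i2 : Integrable (fun x => lam * (g x - k x)) μ :=
    (hg.density.integrable.sub hkK.density.integrable).const_mul lam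
  have i3 := hkK.density.integrable.const_mul w
  have i12 : Integrable (fun x => lam * (Real.log (k x / f x) * k x) + lam * (g x - k x)) μ :=
    i1.add i2
  have hle : ∀ᵐ x ∂μ, q x * k x ≤
      lam * (Real.log (k x / f x) * k x) + lam * (g x - k x) + w * k x := by
    filter_upwards [hs, hfp, hgp, hkK.density.nonneg] with x h1 h2 h3 h4
    have h5 : q x = lam * Real.log (g x / f x) + w := by linarith
    have := mul_le_mul_of_nonneg_left (log_div_mul_le h2 h3 h4) hl.le
    rw [h5]
    linarith
  have hi : Integrable (fun x => q x * k x) μ := by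
    refine integrable_of_le_of_le (hq.mul hkK.density.measurable).aestronglyMeasurable ?_ hle
      (integrable_zero Ω ℝ μ) (i12.add i3)
    filter_upwards [hq0, hkK.density.nonneg] with x h1 h2
    exact mul_nonneg h1 h2
  refine ⟨hi, (integral_mono_ae hi (i12.add i3) hle).trans ?_⟩
  simp only [Pi.add_apply]
  rw [integral_add i12 i3, integral_add i1 i2, integral_const_mul, integral_const_mul,
    integral_const_mul, integral_sub hg.density.integrable hkK.density.integrable,
    hg.density.integral_eq_one, hkK.density.integral_eq_one, e]
  have : lam * klInt μ k f ≤ lam * ε := mul_le_mul_of_nonneg_left hkε hl.le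
  unfold klInt at this
  linarith

theorem affinity_eq_integral_ratio (hp₀ : ∀ᵐ x ∂μ, 0 < g₀ x) (hp₁ : ∀ᵐ x ∂μ, 0 < g₁ x) :
    ∫ x, (g₁ x / g₀ x) ^ u * g₀ x ∂μ = affinity μ u g₀ g₁ := by
  refine integral_congr_ae ?_
  filter_upwards [hp₀, hp₁] with x a b
  exact (rpow_mul_rpow_eq_ratio a b.le).symm

theorem IsStationary.integral_le (hf₀ : IsProbDensity μ f₀) (hf₀p : ∀ᵐ x ∂μ, 0 < f₀ x)
    (hu : u ∈ Ioo (0 : ℝ) 1) (hg : IsStationary μ f₀ f₁ ε₀ ε₁ u g₀ g₁ lam₀ mu₀ lam₁ mu₁)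
    {k : Ω → ℝ} (hk : k ∈ klClass μ f₀ ε₀) :
    Integrable (fun x => (g₁ x / g₀ x) ^ u * k x) μ ∧
      ∫ x, (g₁ x / g₀ x) ^ u * k x ∂μ ≤ affinity μ u g₀ g₁ := by
  have hv : 0 < 1 - u := (one_sub_mem_Ioo hu).1
  obtain ⟨i, l⟩ := integral_tilt_le hf₀ hf₀p hg.mem₀ hg.pos₀ hg.kl₀
    (q := fun x => (1 - u) * (g₁ x / g₀ x) ^ u)
    (((hg.mem₁.density.measurable.div hg.mem₀.density.measurable).pow_const u).const_mul _)
    (by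
      filter_upwards [hg.pos₀, hg.pos₁] with x a b
      positivity) hg.lam₀_pos hg.stat₀ hk
  simp only [mul_assoc] at i l
  rw [integral_const_mul, integral_const_mul,
    affinity_eq_integral_ratio hg.pos₀ hg.pos₁] at l
  refine ⟨(i.const_mul (1 - u)⁻¹).congr (Eventually.of_forall fun x => ?_),
    le_of_mul_le_mul_left l hv⟩
  simp only
  rw [inv_mul_cancel_left₀ hv.ne']

/-- For this concave problem the stationarity conditions are sufficient for joint optimality. -/
theorem IsStationary.isJointMax (hf₀ : IsProbDensity μ f₀) (hf₁ : IsProbDensity μ f₁)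
    (hf₀p : ∀ᵐ x ∂μ, 0 < f₀ x) (hf₁p : ∀ᵐ x ∂μ, 0 < f₁ x) (hu : u ∈ Ioo (0 : ℝ) 1)
    (hg : IsStationary μ f₀ f₁ ε₀ ε₁ u g₀ g₁ lam₀ mu₀ lam₁ mu₁) :
    IsJointMax μ f₀ f₁ ε₀ ε₁ u g₀ g₁ := by
  have hε₀ : 0 ≤ ε₀ := hg.kl₀ ▸ klInt_nonneg hf₀ hf₀p hg.mem₀
  have hε₁ : 0 ≤ ε₁ := hg.kl₁ ▸ klInt_nonneg hf₁ hf₁p hg.mem₁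
  refine isJointMax_of_tangent hu ((mem_klClass_iff hf₀ hf₀p hε₀).2 ⟨hg.mem₀, hg.kl₀.le⟩)
    ((mem_klClass_iff hf₁ hf₁p hε₁).2 ⟨hg.mem₁, hg.kl₁.le⟩) hg.pos₀ hg.pos₁
    (fun k hk => hg.integral_le hf₀ hf₀p hu hk) (fun k hk => ?_)
  have := hg.swap.integral_le hf₁ hf₁p (one_sub_mem_Ioo hu) hk
  rw [affinity_swap] at this
  have e : (fun x => (g₀ x / g₁ x) ^ (1 - u) * k x) =ᵐ[μ]
      fun x => (g₁ x / g₀ x) ^ (-1 + u) * k x := by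
    filter_upwards [hg.pos₀, hg.pos₁] with x a b
    rw [rpow_ratio_inv a.le b.le]
  exact ⟨this.1.congr e, (integral_congr_ae e).symm.le.trans this.2⟩

theorem IsStationary.areKKTMultipliers (hf₀p : ∀ᵐ x ∂μ, 0 < f₀ x) (hf₁p : ∀ᵐ x ∂μ, 0 < f₁ x)
    (hu : u ∈ Ioo (0 : ℝ) 1) (hg : IsStationary μ f₀ f₁ ε₀ ε₁ u g₀ g₁ lam₀ mu₀ lam₁ mu₁) :
    AreKKTMultipliers μ f₀ f₁ ε₀ ε₁ u g₀ g₁ lam₀ mu₀ lam₁ mu₁ where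
  dom₀ := ⟨hg.mem₀.density.measurable, hg.pos₀, hg.mem₀.density.integrable, hg.mem₀.integrable_kl⟩
  dom₁ := ⟨hg.mem₁.density.measurable, hg.pos₁, hg.mem₁.density.integrable, hg.mem₁.integrable_kl⟩
  nonneg₀ := hg.lam₀_pos.le
  nonneg₁ := hg.lam₁_pos.le
  slack₀ := by rw [hg.kl₀, sub_self, mul_zero]
  slack₁ := by rw [hg.kl₁, sub_self, mul_zero]
  max₀ h hh := lagrangian₀_le hu hf₀p hg.mem₀ hg.mem₁.density hg.pos₀ hg.pos₁ hg.lam₀_pos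
    hg.stat₀ hh
  max₁ h hh := by
    rw [lagrangian₁_eq_swap, lagrangian₁_eq_swap]
    exact lagrangian₀_le (one_sub_mem_Ioo hu) hf₁p hg.mem₁ hg.mem₀.density hg.pos₁ hg.pos₀
      hg.lam₁_pos hg.swap.stat₀ hh

theorem IsStationary.hasParametricForm (hf₀p : ∀ᵐ x ∂μ, 0 < f₀ x) (hf₁p : ∀ᵐ x ∂μ, 0 < f₁ x)
    (hg : IsStationary μ f₀ f₁ ε₀ ε₁ u g₀ g₁ lam₀ mu₀ lam₁ mu₁) :
    HasParametricForm μ f₀ f₁ u g₀ g₁ lam₀ mu₀ lam₁ mu₁ := by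
  have l₀ := hg.lam₀_pos
  have l₁ := hg.lam₁_pos
  have F₀ : ∀ᵐ x ∂μ, g₀ x = Real.exp ((-lam₀ - mu₀) / lam₀) *
      Real.exp ((1 - u) * (g₁ x / g₀ x) ^ u / lam₀) * f₀ x := by
    filter_upwards [hg.stat₀, hg.pos₀, hf₀p] with x a b c
    exact eq_exp_of_stationary b c l₀ a
  have F₁ : ∀ᵐ x ∂μ, g₁ x = Real.exp ((-lam₁ - mu₁) / lam₁) *
      Real.exp (u * (g₁ x / g₀ x) ^ (-1 + u) / lam₁) * f₁ x := by
    filter_upwards [hg.stat₁, hg.pos₁, hf₁p] with x a b c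
    exact eq_exp_of_stationary b c l₁ a
  refine ⟨F₀, F₁, ?_⟩
  filter_upwards [F₀, F₁, hf₀p] with x a b c
  refine (congrArg₂ (· / ·) b a).trans ?_
  generalize (g₁ x / g₀ x) ^ u = p
  generalize (g₁ x / g₀ x) ^ (-1 + u) = q
  rw [mul_div_mul_comm, ← Real.exp_add, ← Real.exp_add, ← Real.exp_add, ← Real.exp_sub]
  congr 2
  field_simp
  ring

/-- Change of variables between an unnormalized tilt `r f = S g` and the density `g`. -/
theorem tilt_integrals (hfp : ∀ᵐ x ∂μ, 0 < f x) (hg : HasFiniteKL μ f g) {r : Ω → ℝ} {S : ℝ}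
    (hS : 0 < S) (hr : ∀ᵐ x ∂μ, r x * f x = S * g x) :
    Integrable (fun x => r x * f x) μ ∧ ∫ x, r x * f x ∂μ = S ∧
      Integrable (fun x => r x * Real.log (r x / S) * f x / S) μ ∧
      ∫ x, r x * Real.log (r x / S) * f x / S ∂μ = klInt μ g f := by
  have e : (fun x => r x * Real.log (r x / S) * f x / S) =ᵐ[μ]
      fun x => Real.log (g x / f x) * g x := by
    filter_upwards [hr, hfp] with x a b
    have h1 : r x / S = g x / f x := by
      rw [div_eq_div_iff hS.ne' b.ne', a]; ring
    have h2 : r x * f x / S = g x := by rw [a, mul_div_cancel_left₀ _ hS.ne']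
    calc _ = Real.log (r x / S) * (r x * f x / S) := by ring
      _ = _ := by rw [h1, h2]
  refine ⟨(hg.density.integrable.const_mul S).congr (hr.mono fun x hx => hx.symm), ?_,
    hg.integrable_kl.congr e.symm, integral_congr_ae e⟩
  rw [integral_congr_ae hr, integral_const_mul, hg.density.integral_eq_one, mul_one]

theorem IsStationary.solvesSystem (hf₀p : ∀ᵐ x ∂μ, 0 < f₀ x) (hf₁p : ∀ᵐ x ∂μ, 0 < f₁ x)
    (hg : IsStationary μ f₀ f₁ ε₀ ε₁ u g₀ g₁ lam₀ mu₀ lam₁ mu₁) :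
    SolvesSystem μ f₀ f₁ ε₀ ε₁ u lam₀ lam₁ (fun x => g₁ x / g₀ x) ∧
      s₀ μ f₀ u lam₀ (fun x => g₁ x / g₀ x) = Real.exp ((lam₀ + mu₀) / lam₀) ∧
      s₁ μ f₁ u lam₁ (fun x => g₁ x / g₀ x) = Real.exp ((lam₁ + mu₁) / lam₁) := by
  obtain ⟨F₀, F₁, -⟩ := hg.hasParametricForm hf₀p hf₁p
  set l : Ω → ℝ := fun x => g₁ x / g₀ x with hl
  have rescale : ∀ {lam m r f g : ℝ}, g = Real.exp ((-lam - m) / lam) * r * f →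
      r * f = Real.exp ((lam + m) / lam) * g := by
    intro lam m r f g h
    rw [h, ← mul_assoc, ← mul_assoc, ← Real.exp_add]
    have : (lam + m) / lam + (-lam - m) / lam = 0 := by ring
    rw [this, Real.exp_zero, one_mul]
  have R₀ : ∀ᵐ x ∂μ, r₀ u lam₀ l x * f₀ x = Real.exp ((lam₀ + mu₀) / lam₀) * g₀ x := by
    filter_upwards [F₀] with x hx
    exact rescale hx
  have R₁ : ∀ᵐ x ∂μ, r₁ u lam₁ l x * f₁ x = Real.exp ((lam₁ + mu₁) / lam₁) * g₁ x := by
    filter_upwards [F₁] with x hx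
    exact rescale hx
  obtain ⟨a₀, b₀, c₀, d₀⟩ := tilt_integrals hf₀p hg.mem₀ (Real.exp_pos _) R₀
  obtain ⟨a₁, b₁, c₁, d₁⟩ := tilt_integrals hf₁p hg.mem₁ (Real.exp_pos _) R₁
  have S₀ : s₀ μ f₀ u lam₀ l = Real.exp ((lam₀ + mu₀) / lam₀) := b₀
  have S₁ : s₁ μ f₁ u lam₁ l = Real.exp ((lam₁ + mu₁) / lam₁) := b₁
  refine ⟨⟨hg.lam₀_pos, hg.lam₁_pos, ?_, ?_, a₀, a₁, ?_, ?_, ?_, ?_, ?_⟩, S₀, S₁⟩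
  · exact (hg.mem₁.density.measurable.div hg.mem₀.density.measurable).aemeasurable
  · filter_upwards [hg.pos₀, hg.pos₁] with x a b
    exact div_pos b a
  · rw [S₀]; exact c₀
  · rw [S₁]; exact c₁
  · rw [S₀, d₀, hg.kl₀]
  · rw [S₁, d₁, hg.kl₁]
  · filter_upwards [R₀, R₁, hf₀p, hg.pos₀] with x h1 h2 h3 h4
    have hr : 0 < r₀ u lam₀ l x := Real.exp_pos _
    rw [S₀, S₁]
    simp only [hl] at *
    have p0 := Real.exp_pos ((lam₀ + mu₀) / lam₀)
    have p1 := Real.exp_pos ((lam₁ + mu₁) / lam₁)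
    rw [div_mul_div_comm, div_eq_div_iff h4.ne' (by positivity)]
    calc _ = g₁ x * Real.exp ((lam₁ + mu₁) / lam₁) * (r₀ u lam₀ (fun x => g₁ x / g₀ x) x * f₀ x) := by
          ring
      _ = Real.exp ((lam₀ + mu₀) / lam₀) * g₀ x * (Real.exp ((lam₁ + mu₁) / lam₁) * g₁ x) := by
          rw [h1]; ring
      _ = _ := by rw [← h2]; ring

/-- A normalized tilt of `f` with prescribed divergence is a density of that divergence. -/
theorem hasFiniteKL_of_tilt (hf : IsProbDensity μ f) (hfp : ∀ᵐ x ∂μ, 0 < f x) {r : Ω → ℝ}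
    (hrm : Measurable r) (hrp : ∀ x, 0 < r x) (hi : Integrable (fun x => r x * f x) μ)
    (hi' : Integrable (fun x => r x * Real.log (r x / ∫ y, r y * f y ∂μ) * f x /
      ∫ y, r y * f y ∂μ) μ)
    (he : ∫ x, r x * Real.log (r x / ∫ y, r y * f y ∂μ) * f x / ∫ y, r y * f y ∂μ ∂μ = ε) :
    0 < ∫ y, r y * f y ∂μ ∧ HasFiniteKL μ f (fun x => r x * f x / ∫ y, r y * f y ∂μ) ∧
      klInt μ (fun x => r x * f x / ∫ y, r y * f y ∂μ) f = ε := by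
  have hnn : ∀ᵐ x ∂μ, 0 ≤ r x * f x := by
    filter_upwards [hfp] with x hx
    exact (mul_pos (hrp x) hx).le
  have hS : 0 < ∫ y, r y * f y ∂μ := by
    refine (integral_nonneg_of_ae hnn).lt_of_ne' fun h0 => ?_
    rw [integral_eq_zero_iff_of_nonneg_ae hnn hi] at h0
    have : ∫ x, f x ∂μ = 0 := by
      rw [integral_congr_ae (g := fun _ => (0 : ℝ)), integral_zero]
      filter_upwards [h0] with x hx
      exact (mul_eq_zero.1 hx).resolve_left (hrp x).ne'
    rw [hf.integral_eq_one] at this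
    exact one_ne_zero this
  set S := ∫ y, r y * f y ∂μ with hSdef
  have e : (fun x => r x * Real.log (r x / S) * f x / S) =ᵐ[μ]
      fun x => Real.log (r x * f x / S / f x) * (r x * f x / S) := by
    filter_upwards [hfp] with x hx
    have : r x * f x / S / f x = r x / S := by field_simp
    rw [this]
    ring
  refine ⟨hS, ⟨IsProbDensity.of_integral_pos (hrm.mul hf.measurable) hnn hi hS, hi'.congr e⟩, ?_⟩
  rw [← he]
  exact (integral_congr_ae e).symm

/-- The two tilts built from a solution of the system form a stationary pair with ratio `l`; the
multipliers `mu` are read off from the normalizations. -/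
theorem SolvesSystem.exists_isStationary {l : Ω → ℝ} (hf₀ : IsProbDensity μ f₀)
    (hf₁ : IsProbDensity μ f₁) (hf₀p : ∀ᵐ x ∂μ, 0 < f₀ x) (hf₁p : ∀ᵐ x ∂μ, 0 < f₁ x)
    (hlm : Measurable l) (hl : SolvesSystem μ f₀ f₁ ε₀ ε₁ u lam₀ lam₁ l) :
    ∃ (h₀ h₁ : Ω → ℝ) (mu₀ mu₁ : ℝ), IsStationary μ f₀ f₁ ε₀ ε₁ u h₀ h₁ lam₀ mu₀ lam₁ mu₁ ∧
      l =ᵐ[μ] fun x => h₁ x / h₀ x := by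
  obtain ⟨S₀p, K₀, k₀⟩ := hasFiniteKL_of_tilt hf₀ hf₀p (r := r₀ u lam₀ l)
    (((hlm.pow_const u).const_mul _).div_const _).exp (fun x => Real.exp_pos _) hl.integrable₀
    hl.integrable_log₀ hl.eq₀
  obtain ⟨S₁p, K₁, k₁⟩ := hasFiniteKL_of_tilt hf₁ hf₁p (r := r₁ u lam₁ l)
    (((hlm.pow_const (-1 + u)).const_mul _).div_const _).exp (fun x => Real.exp_pos _)
    hl.integrable₁ hl.integrable_log₁ hl.eq₁
  have hratio := hl.eq_ratio
  unfold s₀ s₁ at hratio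
  set S₀ := ∫ y, r₀ u lam₀ l y * f₀ y ∂μ
  set S₁ := ∫ y, r₁ u lam₁ l y * f₁ y ∂μ
  set h₀ : Ω → ℝ := fun x => r₀ u lam₀ l x * f₀ x / S₀ with hh₀
  set h₁ : Ω → ℝ := fun x => r₁ u lam₁ l x * f₁ x / S₁ with hh₁
  have R₀ : ∀ x, 0 < r₀ u lam₀ l x := fun x => Real.exp_pos _
  have R₁ : ∀ x, 0 < r₁ u lam₁ l x := fun x => Real.exp_pos _
  have p₀ : ∀ᵐ x ∂μ, 0 < h₀ x := by
    filter_upwards [hf₀p] with x hx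
    exact div_pos (mul_pos (R₀ x) hx) S₀p
  have p₁ : ∀ᵐ x ∂μ, 0 < h₁ x := by
    filter_upwards [hf₁p] with x hx
    exact div_pos (mul_pos (R₁ x) hx) S₁p
  have hle : l =ᵐ[μ] fun x => h₁ x / h₀ x := by
    filter_upwards [hratio, hf₀p] with x hx h2
    have := R₀ x
    conv_lhs => rw [hx]
    simp only [hh₀, hh₁]
    field_simp
  have stat : ∀ {lam q f S : ℝ}, 0 < lam → 0 < f → 0 < S →
      q - lam * Real.log (Real.exp (q / lam) * f / S / f) = lam + (lam * Real.log S - lam) := by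
    intro lam q f S hl hf hS
    have e : Real.exp (q / lam) * f / S / f = Real.exp (q / lam) / S := by field_simp
    rw [e, Real.log_div (Real.exp_pos _).ne' hS.ne', Real.log_exp]
    field_simp
    ring
  refine ⟨h₀, h₁, lam₀ * Real.log S₀ - lam₀, lam₁ * Real.log S₁ - lam₁,
    ⟨K₀, K₁, p₀, p₁, hl.lam₀_pos, hl.lam₁_pos, k₀, k₁, ?_, ?_⟩, hle⟩
  · filter_upwards [hle, hf₀p] with x hx h2
    rw [← hx]
    exact stat hl.lam₀_pos h2 S₀p
  · filter_upwards [hle, hf₁p] with x hx h2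
    rw [← hx]
    exact stat hl.lam₁_pos h2 S₁p

/-- The system only depends on the almost everywhere class of the unknown function. -/
theorem SolvesSystem.congr {l l' : Ω → ℝ} (h : l =ᵐ[μ] l')
    (hl : SolvesSystem μ f₀ f₁ ε₀ ε₁ u lam₀ lam₁ l) :
    SolvesSystem μ f₀ f₁ ε₀ ε₁ u lam₀ lam₁ l' := by
  have e₀ : ∀ᵐ x ∂μ, r₀ u lam₀ l' x = r₀ u lam₀ l x := by
    filter_upwards [h] with x hx
    unfold r₀; rw [hx]
  have e₁ : ∀ᵐ x ∂μ, r₁ u lam₁ l' x = r₁ u lam₁ l x := by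
    filter_upwards [h] with x hx
    unfold r₁; rw [hx]
  have S₀ : s₀ μ f₀ u lam₀ l' = s₀ μ f₀ u lam₀ l :=
    integral_congr_ae (e₀.mono fun x hx => by simp only [hx])
  have S₁ : s₁ μ f₁ u lam₁ l' = s₁ μ f₁ u lam₁ l :=
    integral_congr_ae (e₁.mono fun x hx => by simp only [hx])
  refine ⟨hl.lam₀_pos, hl.lam₁_pos, hl.aemeasurable.congr h, ?_, ?_, ?_, ?_, ?_, ?_, ?_, ?_⟩
  · filter_upwards [h, hl.pos] with x a b
    rwa [← a]
  · exact hl.integrable₀.congr (e₀.mono fun x hx => by simp only [hx])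
  · exact hl.integrable₁.congr (e₁.mono fun x hx => by simp only [hx])
  · rw [S₀]; exact hl.integrable_log₀.congr (e₀.mono fun x hx => by simp only [hx])
  · rw [S₁]; exact hl.integrable_log₁.congr (e₁.mono fun x hx => by simp only [hx])
  · rw [S₀, ← hl.eq₀]; exact integral_congr_ae (e₀.mono fun x hx => by simp only [hx])
  · rw [S₁, ← hl.eq₁]; exact integral_congr_ae (e₁.mono fun x hx => by simp only [hx])
  · rw [S₀, S₁]
    filter_upwards [hl.eq_ratio, e₀, e₁, h] with x a b c d
    rw [b, c, ← d]
    exact a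

/-- A nontrivial exponential tilt determines its temperature `lam`: otherwise `log (g / f)` would
be constant, forcing `g = f`. -/
theorem temperature_unique (hf : IsProbDensity μ f) (hfp : ∀ᵐ x ∂μ, 0 < f x)
    (hg : HasFiniteKL μ f g) (hgp : ∀ᵐ x ∂μ, 0 < g x) (hkl : klInt μ g f ≠ 0) {q : Ω → ℝ}
    {lam lam' w w' : ℝ} (h : ∀ᵐ x ∂μ, q x - lam * Real.log (g x / f x) = w)
    (h' : ∀ᵐ x ∂μ, q x - lam' * Real.log (g x / f x) = w') : lam' = lam := by
  by_contra hne
  have hd : lam' - lam ≠ 0 := sub_ne_zero.2 hne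
  set c := (w - w') / (lam' - lam) with hc
  have hlog : ∀ᵐ x ∂μ, Real.log (g x / f x) = c := by
    filter_upwards [h, h'] with x a b
    rw [hc, eq_div_iff hd]
    linarith
  have hgf : ∀ᵐ x ∂μ, g x = Real.exp c * f x := by
    filter_upwards [hlog, hfp, hgp] with x a b d
    rw [← a, Real.exp_log (div_pos d b), div_mul_cancel₀ _ b.ne']
  have h1 := integral_congr_ae hgf
  rw [integral_const_mul, hg.density.integral_eq_one, hf.integral_eq_one, mul_one] at h1
  have hc0 : c = 0 := by rw [← Real.log_exp c, ← h1, Real.log_one]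
  refine hkl ?_
  unfold klInt
  rw [integral_congr_ae (g := fun _ => (0 : ℝ)), integral_zero]
  filter_upwards [hlog] with x hx
  rw [hx, hc0, zero_mul]

/-- Uniqueness for the system: a solution yields a stationary pair, hence the joint maximum. -/
theorem IsStationary.system_unique {l : Ω → ℝ} {lam₀' lam₁' : ℝ} (hf₀ : IsProbDensity μ f₀)
    (hf₁ : IsProbDensity μ f₁) (hf₀p : ∀ᵐ x ∂μ, 0 < f₀ x) (hf₁p : ∀ᵐ x ∂μ, 0 < f₁ x)
    (hε₀ : 0 < ε₀) (hε₁ : 0 < ε₁) (hu : u ∈ Ioo (0 : ℝ) 1)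
    (hg : IsStationary μ f₀ f₁ ε₀ ε₁ u g₀ g₁ lam₀ mu₀ lam₁ mu₁) (hlt : affinity μ u g₀ g₁ < 1)
    (hl : SolvesSystem μ f₀ f₁ ε₀ ε₁ u lam₀' lam₁' l) :
    lam₀' = lam₀ ∧ lam₁' = lam₁ ∧ l =ᵐ[μ] fun x => g₁ x / g₀ x := by
  -- `l` is only almost everywhere measurable, whereas the classes consist of measurable densities
  have hmk := hl.aemeasurable.ae_eq_mk
  obtain ⟨h₀, h₁, mu₀', mu₁', hh, hlh⟩ := (hl.congr hmk).exists_isStationary hf₀ hf₁ hf₀p hf₁p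
    hl.aemeasurable.measurable_mk
  obtain ⟨e₀, e₁⟩ := (hg.isJointMax hf₀ hf₁ hf₀p hf₁p hu).ae_eq hf₀ hf₁ hf₀p hf₁p hε₀ hε₁ hu
    (hh.isJointMax hf₀ hf₁ hf₀p hf₁p hu) hlt
  refine ⟨?_, ?_, ?_⟩
  · refine temperature_unique hf₀ hf₀p hg.mem₀ hg.pos₀ (hg.kl₀ ▸ hε₀.ne') hg.stat₀
      (w' := lam₀' + mu₀') ?_
    filter_upwards [hh.stat₀, e₀, e₁] with x a b c
    rw [b, c, a]
  · refine temperature_unique hf₁ hf₁p hg.mem₁ hg.pos₁ (hg.kl₁ ▸ hε₁.ne') hg.stat₁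
      (w' := lam₁' + mu₁') ?_
    filter_upwards [hh.stat₁, e₀, e₁] with x a b c
    rw [b, c, a]
  · filter_upwards [hmk, hlh, e₀, e₁] with x a b c d
    rw [a, b, c, d]

end System

/-! ### Minimization over the exponent -/

section MaxMin

variable {Ω : Type*} [MeasurableSpace Ω] {μ : Measure Ω} {f₀ f₁ g₀ g₁ : Ω → ℝ}
  {ε₀ ε₁ u v s : ℝ}

theorem rpow_exponent_combo {a b : ℝ} (hu : u ∈ Ioo (0 : ℝ) 1) (hv : v ∈ Ioo (0 : ℝ) 1)
    (hs : s ∈ Ioo (0 : ℝ) 1) (ha : 0 ≤ a) (hb : 0 ≤ b) :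
    b ^ ((1 - s) * u + s * v) * a ^ (1 - ((1 - s) * u + s * v)) =
      (b ^ v * a ^ (1 - v)) ^ s * (b ^ u * a ^ (1 - u)) ^ (1 - s) := by
  have hu' := (one_sub_mem_Ioo hu).1.le
  have hv' := (one_sub_mem_Ioo hv).1.le
  have hs' := (one_sub_mem_Ioo hs).1.le
  have e : 1 - ((1 - s) * u + s * v) = (1 - s) * (1 - u) + s * (1 - v) := by ring
  rw [e, Real.rpow_add_of_nonneg hb (mul_nonneg hs' hu.1.le) (mul_nonneg hs.1.le hv.1.le),
    Real.rpow_add_of_nonneg ha (mul_nonneg hs' hu') (mul_nonneg hs.1.le hv'),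
    Real.mul_rpow (by positivity) (by positivity), Real.mul_rpow (by positivity) (by positivity),
    ← Real.rpow_mul hb, ← Real.rpow_mul hb, ← Real.rpow_mul ha, ← Real.rpow_mul ha,
    mul_comm v s, mul_comm (1 - v) s, mul_comm u, mul_comm (1 - u) (1 - s)]
  ring

theorem combo_mem_Ioo (hu : u ∈ Ioo (0 : ℝ) 1) (hv : v ∈ Ioo (0 : ℝ) 1)
    (hs : s ∈ Ioo (0 : ℝ) 1) : (1 - s) * u + s * v ∈ Ioo (0 : ℝ) 1 := by
  have h1 := (one_sub_mem_Ioo hs).1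
  refine ⟨add_pos (mul_pos h1 hu.1) (mul_pos hs.1 hv.1), ?_⟩
  nlinarith [mul_lt_mul_of_pos_left hu.2 h1, mul_lt_mul_of_pos_left hv.2 hs.1]

/-- Convexity of the affinity in its exponent (Hölder's inequality). -/
theorem affinity_exponent_le (hg₀ : IsProbDensity μ g₀) (hg₁ : IsProbDensity μ g₁)
    (hu : u ∈ Ioo (0 : ℝ) 1) (hv : v ∈ Ioo (0 : ℝ) 1) (hs : s ∈ Ioo (0 : ℝ) 1) :
    affinity μ ((1 - s) * u + s * v) g₀ g₁ ≤
      (1 - s) * affinity μ u g₀ g₁ + s * affinity μ v g₀ g₁ := by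
  unfold affinity
  have iu := (hg₀.integrable_affinity hu hg₁).const_mul (1 - s)
  have iv := (hg₀.integrable_affinity hv hg₁).const_mul s
  rw [← integral_const_mul, ← integral_const_mul, ← integral_add iu iv]
  refine integral_mono_ae (hg₀.integrable_affinity (combo_mem_Ioo hu hv hs) hg₁) (iu.add iv) ?_
  filter_upwards [hg₀.nonneg, hg₁.nonneg] with x a b
  rw [rpow_exponent_combo hu hv hs a b]
  exact rpow_mul_rpow_le hs (by positivity) (by positivity)

theorem affinity_exponent_lt (hg₀ : IsProbDensity μ g₀) (hg₁ : IsProbDensity μ g₁)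
    (hp₀ : ∀ᵐ x ∂μ, 0 < g₀ x) (hp₁ : ∀ᵐ x ∂μ, 0 < g₁ x) (hne : ¬ g₀ =ᵐ[μ] g₁)
    (hu : u ∈ Ioo (0 : ℝ) 1) (hv : v ∈ Ioo (0 : ℝ) 1) (huv : v ≠ u) (hs : s ∈ Ioo (0 : ℝ) 1) :
    affinity μ ((1 - s) * u + s * v) g₀ g₁ <
      (1 - s) * affinity μ u g₀ g₁ + s * affinity μ v g₀ g₁ := by
  refine (affinity_exponent_le hg₀ hg₁ hu hv hs).lt_of_ne fun heq => hne ?_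
  have iu := (hg₀.integrable_affinity hu hg₁).const_mul (1 - s)
  have iv := (hg₀.integrable_affinity hv hg₁).const_mul s
  have iuv : Integrable (fun x => (1 - s) * (g₁ x ^ u * g₀ x ^ (1 - u)) +
    s * (g₁ x ^ v * g₀ x ^ (1 - v))) μ := iu.add iv
  have iw := hg₀.integrable_affinity (combo_mem_Ioo hu hv hs) hg₁
  unfold affinity at heq
  rw [← integral_const_mul, ← integral_const_mul, ← integral_add iu iv,
    integral_eq_iff_of_ae_le iw iuv (by
      filter_upwards [hg₀.nonneg, hg₁.nonneg] with x a b
      rw [rpow_exponent_combo hu hv hs a b]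
      exact rpow_mul_rpow_le hs (by positivity) (by positivity))] at heq
  filter_upwards [heq, hp₀, hp₁] with x hx a b
  rw [rpow_exponent_combo hu hv hs a.le b.le] at hx
  have e := eq_of_rpow_mul_rpow_eq hs (by positivity) (by positivity) hx
  have e' : g₀ x * (g₁ x / g₀ x) ^ u = g₀ x * (g₁ x / g₀ x) ^ v := by
    rw [rpow_mul_rpow_eq_ratio a b.le, rpow_mul_rpow_eq_ratio a b.le] at e
    linarith
  have e2 := mul_left_cancel₀ a.ne' e'
  have e3 := congrArg Real.log e2
  rw [Real.log_rpow (div_pos b a), Real.log_rpow (div_pos b a)] at e3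
  have e4 : (v - u) * Real.log (g₁ x / g₀ x) = 0 := by linarith
  have e5 := (mul_eq_zero.1 e4).resolve_left (sub_ne_zero.2 huv)
  have e6 := Real.eq_one_of_pos_of_log_eq_zero (div_pos b a) e5
  rw [div_eq_one_iff_eq a.ne'] at e6
  exact e6.symm

theorem tendsto_affinity_zero (hg₀ : IsProbDensity μ g₀) (hg₁ : IsProbDensity μ g₁)
    (hp₁ : ∀ᵐ x ∂μ, 0 < g₁ x) :
    Tendsto (fun u => affinity μ u g₀ g₁) (𝓝[>] 0) (𝓝 1) := by
  rw [← hg₀.integral_eq_one]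
  refine tendsto_integral_filter_of_dominated_convergence (fun x => g₀ x + g₁ x) ?_ ?_
    (hg₀.integrable.add hg₁.integrable) ?_
  · exact Eventually.of_forall fun u =>
      (measurable_affinity hg₀.measurable hg₁.measurable).aestronglyMeasurable
  · filter_upwards [Ioo_mem_nhdsGT one_pos] with u hu
    filter_upwards [hg₀.nonneg, hg₁.nonneg] with x a b
    rw [Real.norm_of_nonneg (by positivity)]
    have := rpow_mul_rpow_le hu a b
    nlinarith [hu.1, hu.2]
  · filter_upwards [hg₀.nonneg, hp₁] with x a b
    have h1 : Tendsto (fun u : ℝ => g₁ x ^ u) (𝓝 0) (𝓝 (g₁ x ^ (0 : ℝ))) :=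
      (Real.continuousAt_const_rpow b.ne').tendsto
    have h2 : Tendsto (fun u : ℝ => g₀ x ^ (1 - u)) (𝓝 0) (𝓝 (g₀ x ^ (1 - (0 : ℝ)))) :=
      ContinuousAt.tendsto (f := fun u : ℝ => g₀ x ^ (1 - u))
        ((Real.continuousAt_const_rpow' (by norm_num)).comp (by fun_prop))
    have := (h1.mul h2).mono_left (nhdsWithin_le_nhds (s := Ioi (0 : ℝ)))
    simpa using this

/-- Off a compact subinterval of `(0, 1)`, the affinity of two positive densities exceeds any
given level below one. -/
theorem exists_affinity_gt_near_endpoints (hg₀ : IsProbDensity μ g₀) (hg₁ : IsProbDensity μ g₁)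
    (hp₀ : ∀ᵐ x ∂μ, 0 < g₀ x) (hp₁ : ∀ᵐ x ∂μ, 0 < g₁ x) {c : ℝ} (hc : c < 1) :
    ∃ a b : ℝ, 0 < a ∧ a ≤ 1 / 2 ∧ 1 / 2 ≤ b ∧ b < 1 ∧
      ∀ u ∈ Ioo (0 : ℝ) 1, u ∉ Icc a b → c < affinity μ u g₀ g₁ := by
  obtain ⟨a, ha, ha'⟩ := mem_nhdsGT_iff_exists_Ioo_subset.1
    ((tendsto_affinity_zero hg₀ hg₁ hp₁).eventually (lt_mem_nhds hc))
  obtain ⟨b, hb, hb'⟩ := mem_nhdsGT_iff_exists_Ioo_subset.1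
    ((tendsto_affinity_zero hg₁ hg₀ hp₀).eventually (lt_mem_nhds hc))
  rw [mem_Ioi] at ha hb
  have hb2 : 0 < min b (1 / 2) := lt_min hb (by norm_num)
  refine ⟨min a (1 / 2), 1 - min b (1 / 2), lt_min ha (by norm_num), min_le_right _ _,
    by linarith [min_le_right b (1 / 2)], by linarith, fun u hu hn => ?_⟩
  rw [mem_Icc, not_and_or, not_le, not_le] at hn
  rcases hn with hn | hn
  · exact ha' ⟨hu.1, hn.trans_le (min_le_left _ _)⟩
  · have : c < affinity μ (1 - u) g₁ g₀ :=
      hb' ⟨by linarith [hu.2], by linarith [min_le_left b (1 / 2)]⟩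
    rwa [affinity_swap] at this

/-- The value of the joint maximization of the affinity, as a function of the exponent. -/
noncomputable def maxAffinity (μ : Measure Ω) (f₀ f₁ : Ω → ℝ) (ε₀ ε₁ u : ℝ) : ℝ :=
  sSup {a | ∃ h₀ ∈ klClass μ f₀ ε₀, ∃ h₁ ∈ klClass μ f₁ ε₁, a = affinity μ u h₀ h₁}

theorem IsJointMax.affinity_eq (hg : IsJointMax μ f₀ f₁ ε₀ ε₁ u g₀ g₁) :
    affinity μ u g₀ g₁ = maxAffinity μ f₀ f₁ ε₀ ε₁ u := by
  have h : IsGreatest {a | ∃ h₀ ∈ klClass μ f₀ ε₀, ∃ h₁ ∈ klClass μ f₁ ε₁,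
      a = affinity μ u h₀ h₁} (affinity μ u g₀ g₁) := by
    refine ⟨⟨g₀, hg.mem₀, g₁, hg.mem₁, rfl⟩, ?_⟩
    rintro _ ⟨h₀, hh₀, h₁, hh₁, rfl⟩
    exact hg.le h₀ hh₀ h₁ hh₁
  exact h.csSup_eq.symm

theorem affinity_le_maxAffinity (hu : u ∈ Ioo (0 : ℝ) 1) (hg₀ : g₀ ∈ klClass μ f₀ ε₀)
    (hg₁ : g₁ ∈ klClass μ f₁ ε₁) : affinity μ u g₀ g₁ ≤ maxAffinity μ f₀ f₁ ε₀ ε₁ u :=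
  le_csSup ⟨1, by
    rintro _ ⟨h₀, hh₀, h₁, hh₁, rfl⟩
    exact affinity_le_one hu hh₀.1 hh₁.1⟩ ⟨g₀, hg₀, g₁, hg₁, rfl⟩

theorem exists_minimizer_maxAffinity (hf₀ : IsProbDensity μ f₀) (hf₁ : IsProbDensity μ f₁)
    (hf₀p : ∀ᵐ x ∂μ, 0 < f₀ x) (hf₁p : ∀ᵐ x ∂μ, 0 < f₁ x) (hε₀ : 0 ≤ ε₀) (hε₁ : 0 ≤ ε₁)
    (hdisj : Disjoint (klClass μ f₀ ε₀) (klClass μ f₁ ε₁)) :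
    ∃ u ∈ Ioo (0 : ℝ) 1, ∀ v ∈ Ioo (0 : ℝ) 1,
      maxAffinity μ f₀ f₁ ε₀ ε₁ u ≤ maxAffinity μ f₀ f₁ ε₀ ε₁ v := by
  set M := maxAffinity μ f₀ f₁ ε₀ ε₁ with hM
  have hex : ∀ u ∈ Ioo (0 : ℝ) 1, ∃ g₀ g₁, IsJointMax μ f₀ f₁ ε₀ ε₁ u g₀ g₁ := fun u hu =>
    exists_isJointMax hf₀ hf₁ hf₀p hf₁p hε₀ hε₁ hu
  have hconv : ConvexOn ℝ (Ioo (0 : ℝ) 1) M := by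
    rw [convexOn_iff_forall_pos]
    refine ⟨convex_Ioo 0 1, fun u hu v hv t s ht hs hts => ?_⟩
    have ht' : t = 1 - s := by linarith
    have hs' : s ∈ Ioo (0 : ℝ) 1 := ⟨hs, by linarith⟩
    simp only [smul_eq_mul, ht']
    obtain ⟨g₀, g₁, hg⟩ := hex _ (combo_mem_Ioo hu hv hs')
    rw [hM, ← hg.affinity_eq]
    refine (affinity_exponent_le hg.mem₀.1 hg.mem₁.1 hu hv hs').trans ?_
    exact add_le_add (mul_le_mul_of_nonneg_left (affinity_le_maxAffinity hu hg.mem₀ hg.mem₁)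
      (by linarith)) (mul_le_mul_of_nonneg_left (affinity_le_maxAffinity hv hg.mem₀ hg.mem₁) hs.le)
  have hhalf : (1 / 2 : ℝ) ∈ Ioo (0 : ℝ) 1 := by norm_num
  have hlt : M (1 / 2) < 1 := by
    obtain ⟨g₀, g₁, hg⟩ := hex _ hhalf
    rw [hM, ← hg.affinity_eq]
    exact affinity_lt_one_of_disjoint hhalf hf₁ hf₁p hdisj hg.mem₀ hg.mem₁
  obtain ⟨a, b, ha, ha2, hb2, hb, hab⟩ := exists_affinity_gt_near_endpoints hf₀ hf₁ hf₀p hf₁p hlt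
  have hsub : Icc a b ⊆ Ioo (0 : ℝ) 1 := fun x hx => ⟨ha.trans_le hx.1, hx.2.trans_lt hb⟩
  obtain ⟨u, hu, hmin⟩ := isCompact_Icc.exists_isMinOn ⟨1 / 2, ha2, hb2⟩
    ((hconv.continuousOn isOpen_Ioo).mono hsub)
  refine ⟨u, hsub hu, fun v hv => ?_⟩
  by_cases hvK : v ∈ Icc a b
  · exact hmin hvK
  · exact (hmin ⟨ha2, hb2⟩).trans ((hab v hv hvK).le.trans (affinity_le_maxAffinity hv
      (self_mem_klClass hf₀ hf₀p hε₀) (self_mem_klClass hf₁ hf₁p hε₁)))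

/-- The saddle point property: at a minimizer `u` of the maximal affinity, the maximizing pair has
`u` as a minimizing exponent. The maximizing pairs for exponents slightly off `u` towards `v` nearly
maximize the affinity at `u` while keeping the affinity at `v` above the value. -/
theorem IsJointMax.saddle (hf₀ : IsProbDensity μ f₀) (hf₁ : IsProbDensity μ f₁)
    (hf₀p : ∀ᵐ x ∂μ, 0 < f₀ x) (hf₁p : ∀ᵐ x ∂μ, 0 < f₁ x) (hε₀ : 0 < ε₀) (hε₁ : 0 < ε₁)
    (hdisj : Disjoint (klClass μ f₀ ε₀) (klClass μ f₁ ε₁)) (hu : u ∈ Ioo (0 : ℝ) 1)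
    (hmin : ∀ w ∈ Ioo (0 : ℝ) 1, maxAffinity μ f₀ f₁ ε₀ ε₁ u ≤ maxAffinity μ f₀ f₁ ε₀ ε₁ w)
    (hg : IsJointMax μ f₀ f₁ ε₀ ε₁ u g₀ g₁) (hv : v ∈ Ioo (0 : ℝ) 1) :
    affinity μ u g₀ g₁ ≤ affinity μ v g₀ g₁ := by
  set m := affinity μ u g₀ g₁ with hm
  have hmM : m = maxAffinity μ f₀ f₁ ε₀ ε₁ u := hg.affinity_eq
  obtain ⟨k₀, hk₀, k₁, hk₁, hku, hkv⟩ := exists_affinity_ge (a := m) (b := m) hf₀ hf₁ hf₀p hf₁p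
    hε₀.le hε₁.le hu hv (by
    intro δ hδ
    -- chosen so that `(m - t) / (1 - t) ≥ m - δ`
    set t := δ / (1 + δ) with ht
    have htm : t ∈ Ioo (0 : ℝ) 1 :=
      ⟨by positivity, by rw [ht, div_lt_one (by positivity)]; linarith⟩
    have ht1 := (one_sub_mem_Ioo htm).1
    obtain ⟨h₀, h₁, hh⟩ := exists_isJointMax hf₀ hf₁ hf₀p hf₁p hε₀.le hε₁.le
      (combo_mem_Ioo hu hv htm)
    have c1 := hmin _ (combo_mem_Ioo hu hv htm)
    rw [← hh.affinity_eq, ← hmM] at c1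
    have c2 := c1.trans (affinity_exponent_le hh.mem₀.1 hh.mem₁.1 hu hv htm)
    have c3 := affinity_le_one hv hh.mem₀.1 hh.mem₁.1
    have c4 := hg.le _ hh.mem₀ _ hh.mem₁
    have c5 : t * (1 + δ) = δ := div_mul_cancel₀ _ (by positivity)
    have c6 : 0 ≤ m := affinity_nonneg hg.mem₀.1 hg.mem₁.1
    refine ⟨h₀, hh.mem₀, h₁, hh.mem₁, ?_, ?_⟩
    · refine le_of_mul_le_mul_left ?_ ht1
      nlinarith [mul_le_mul_of_nonneg_left c3 htm.1.le, mul_nonneg htm.1.le c6]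
    · have : t * m ≤ t * affinity μ v h₀ h₁ := by
        nlinarith [mul_le_mul_of_nonneg_left c4 ht1.le]
      linarith [le_of_mul_le_mul_left this htm.1])
  have hk : IsJointMax μ f₀ f₁ ε₀ ε₁ u k₀ k₁ :=
    ⟨hk₀, hk₁, fun a ha b hb => (hg.le a ha b hb).trans hku⟩
  obtain ⟨e₀, e₁⟩ := hg.ae_eq hf₀ hf₁ hf₀p hf₁p hε₀ hε₁ hu hk
    (affinity_lt_one_of_disjoint hu hf₁ hf₁p hdisj hg.mem₀ hg.mem₁)
  rw [affinity_congr (u := v) e₀ e₁]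
  exact hkv

/-- The minimizer of the maximal affinity is unique, by strict convexity of the affinity of the
saddle pair in the exponent. -/
theorem maxAffinity_lt_of_saddle (hp₀ : ∀ᵐ x ∂μ, 0 < g₀ x) (hp₁ : ∀ᵐ x ∂μ, 0 < g₁ x)
    (hg : IsJointMax μ f₀ f₁ ε₀ ε₁ u g₀ g₁) (hlt : affinity μ u g₀ g₁ < 1)
    (hu : u ∈ Ioo (0 : ℝ) 1)
    (hsad : ∀ w ∈ Ioo (0 : ℝ) 1, affinity μ u g₀ g₁ ≤ affinity μ w g₀ g₁)
    (hv : v ∈ Ioo (0 : ℝ) 1) (hvu : v ≠ u) :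
    affinity μ u g₀ g₁ < maxAffinity μ f₀ f₁ ε₀ ε₁ v := by
  have hne : ¬ g₀ =ᵐ[μ] g₁ := by
    intro h
    refine hlt.ne ?_
    rw [← hg.mem₀.1.integral_eq_one]
    refine integral_congr_ae ?_
    filter_upwards [h, hp₀] with x hx a
    rw [← hx, ← Real.rpow_add a]
    simp
  have hhalf : (1 / 2 : ℝ) ∈ Ioo (0 : ℝ) 1 := by norm_num
  have h1 := affinity_exponent_lt hg.mem₀.1 hg.mem₁.1 hp₀ hp₁ hne hu hv hvu hhalf
  have h2 := hsad _ (combo_mem_Ioo hu hv hhalf)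
  have h3 := affinity_le_maxAffinity hv hg.mem₀ hg.mem₁
  linarith

end MaxMin

/-- The maximization stage has a solution which is a joint maximum and satisfies the stationarity
conditions for suitable multipliers. -/
theorem exists_isJointMax_isStationary {Ω : Type*} [MeasurableSpace Ω] {μ : Measure Ω}
    {f₀ f₁ : Ω → ℝ} {ε₀ ε₁ u : ℝ} (hf₀ : IsProbDensity μ f₀) (hf₁ : IsProbDensity μ f₁)
    (hf₀p : ∀ᵐ x ∂μ, 0 < f₀ x) (hf₁p : ∀ᵐ x ∂μ, 0 < f₁ x) (hε₀ : 0 < ε₀) (hε₁ : 0 < ε₁)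
    (hdisj : Disjoint (klClass μ f₀ ε₀) (klClass μ f₁ ε₁)) (hu : u ∈ Ioo (0 : ℝ) 1) :
    ∃ (g₀ g₁ : Ω → ℝ) (lam₀ mu₀ lam₁ mu₁ : ℝ), IsJointMax μ f₀ f₁ ε₀ ε₁ u g₀ g₁ ∧
      affinity μ u g₀ g₁ < 1 ∧ IsStationary μ f₀ f₁ ε₀ ε₁ u g₀ g₁ lam₀ mu₀ lam₁ mu₁ := by
  obtain ⟨g₀, g₁, hg⟩ := exists_isJointMax hf₀ hf₁ hf₀p hf₁p hε₀.le hε₁.le hu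
  have hlt := affinity_lt_one_of_disjoint hu hf₁ hf₁p hdisj hg.mem₀ hg.mem₁
  obtain ⟨lam₀, lam₁, hL⟩ := hg.exists_isLagrangeMax hf₀ hf₁ hf₀p hf₁p hε₀ hε₁ hu hlt
  obtain ⟨mu₀, mu₁, hS⟩ := hL.exists_isStationary hf₀ hf₁ hf₀p hf₁p hε₀.le hε₁.le hu
  exact ⟨g₀, g₁, lam₀, mu₀, lam₁, mu₁, hg, hlt, hS⟩

end RobustTest

theorem theorem2 {Ω : Type*} [MeasurableSpace Ω] (μ : Measure Ω) [SigmaFinite μ]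
    (f₀ f₁ : Ω → ℝ) (ε₀ ε₁ : ℝ)
    (hf₀ : RobustTest.IsProbDensity μ f₀) (hf₁ : RobustTest.IsProbDensity μ f₁)
    (hf₀_pos : ∀ᵐ x ∂μ, 0 < f₀ x) (hf₁_pos : ∀ᵐ x ∂μ, 0 < f₁ x)
    (hε₀ : 0 < ε₀) (hε₁ : 0 < ε₁)
    (hdisj : Disjoint (RobustTest.klClass μ f₀ ε₀) (RobustTest.klClass μ f₁ ε₁)) :
    -- For each fixed `u`, the maximization stage, its parametric forms and the system.
    (∀ u ∈ Ioo (0 : ℝ) 1, ∃ (g₀ g₁ : Ω → ℝ) (lam₀ mu₀ lam₁ mu₁ : ℝ),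
      RobustTest.SolvesMaximization μ f₀ f₁ ε₀ ε₁ u g₀ g₁ ∧
      (∀ h₀ h₁ : Ω → ℝ, RobustTest.SolvesMaximization μ f₀ f₁ ε₀ ε₁ u h₀ h₁ →
        h₀ =ᵐ[μ] g₀ ∧ h₁ =ᵐ[μ] g₁) ∧
      (∀ h₀ ∈ RobustTest.klClass μ f₀ ε₀, ∀ h₁ ∈ RobustTest.klClass μ f₁ ε₁,
        RobustTest.affinity μ u h₀ h₁ ≤ RobustTest.affinity μ u g₀ g₁) ∧
      0 < lam₀ ∧ 0 < lam₁ ∧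
      RobustTest.AreKKTMultipliers μ f₀ f₁ ε₀ ε₁ u g₀ g₁ lam₀ mu₀ lam₁ mu₁ ∧
      RobustTest.HasParametricForm μ f₀ f₁ u g₀ g₁ lam₀ mu₀ lam₁ mu₁ ∧
      RobustTest.SolvesSystem μ f₀ f₁ ε₀ ε₁ u lam₀ lam₁ (fun x => g₁ x / g₀ x) ∧
      RobustTest.s₀ μ f₀ u lam₀ (fun x => g₁ x / g₀ x) = Real.exp ((lam₀ + mu₀) / lam₀) ∧
      RobustTest.s₁ μ f₁ u lam₁ (fun x => g₁ x / g₀ x) = Real.exp ((lam₁ + mu₁) / lam₁) ∧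
      (∀ (lam₀' lam₁' : ℝ) (l : Ω → ℝ),
        RobustTest.SolvesSystem μ f₀ f₁ ε₀ ε₁ u lam₀' lam₁' l →
        lam₀' = lam₀ ∧ lam₁' = lam₁ ∧ l =ᵐ[μ] fun x => g₁ x / g₀ x)) ∧
    -- The max-min problem has a unique solution, and it has the parametric forms.
    (∃ (u : ℝ) (g₀ g₁ : Ω → ℝ) (lam₀ mu₀ lam₁ mu₁ : ℝ),
      RobustTest.SolvesMaxMin μ f₀ f₁ ε₀ ε₁ u g₀ g₁ ∧
      (∀ (v : ℝ) (h₀ h₁ : Ω → ℝ), RobustTest.SolvesMaxMin μ f₀ f₁ ε₀ ε₁ v h₀ h₁ →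
        v = u ∧ h₀ =ᵐ[μ] g₀ ∧ h₁ =ᵐ[μ] g₁) ∧
      0 < lam₀ ∧ 0 < lam₁ ∧
      RobustTest.AreKKTMultipliers μ f₀ f₁ ε₀ ε₁ u g₀ g₁ lam₀ mu₀ lam₁ mu₁ ∧
      RobustTest.HasParametricForm μ f₀ f₁ u g₀ g₁ lam₀ mu₀ lam₁ mu₁ ∧
      -- `u` is also the only minimizer of the affinity of the densities found as functions of `u`.
      (∀ (v : ℝ) (h₀ h₁ : Ω → ℝ), v ∈ Ioo (0 : ℝ) 1 → v ≠ u →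
        RobustTest.SolvesMaximization μ f₀ f₁ ε₀ ε₁ v h₀ h₁ →
        RobustTest.affinity μ u g₀ g₁ < RobustTest.affinity μ v h₀ h₁)) := by
  have hex := fun u hu => RobustTest.exists_isJointMax_isStationary (u := u) hf₀ hf₁ hf₀_pos hf₁_pos
    hε₀ hε₁ hdisj hu
  have hjoint : ∀ u ∈ Ioo (0 : ℝ) 1, ∀ h₀ h₁ : Ω → ℝ,
      RobustTest.SolvesMaximization μ f₀ f₁ ε₀ ε₁ u h₀ h₁ →
      RobustTest.IsJointMax μ f₀ f₁ ε₀ ε₁ u h₀ h₁ := fun u hu h₀ h₁ hh =>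
    hh.isJointMax hf₀ hf₁ hf₀_pos hf₁_pos hε₀.le hε₁.le hu
  refine ⟨fun u hu => ?_, ?_⟩
  · obtain ⟨g₀, g₁, lam₀, mu₀, lam₁, mu₁, hg, hlt, hS⟩ := hex u hu
    obtain ⟨hsys, hs₀, hs₁⟩ := hS.solvesSystem hf₀_pos hf₁_pos
    refine ⟨g₀, g₁, lam₀, mu₀, lam₁, mu₁, hg.solvesMaximization hS.pos₀ hS.pos₁,
      fun h₀ h₁ hh => ?_, hg.le, hS.lam₀_pos, hS.lam₁_pos,
      hS.areKKTMultipliers hf₀_pos hf₁_pos hu, hS.hasParametricForm hf₀_pos hf₁_pos, hsys, hs₀, hs₁,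
      fun lam₀' lam₁' l hl => hS.system_unique hf₀ hf₁ hf₀_pos hf₁_pos hε₀ hε₁ hu hlt hl⟩
    obtain ⟨e₀, e₁⟩ := hg.ae_eq hf₀ hf₁ hf₀_pos hf₁_pos hε₀ hε₁ hu (hjoint u hu h₀ h₁ hh) hlt
    exact ⟨e₀.symm, e₁.symm⟩
  · obtain ⟨u, hu, hmin⟩ := RobustTest.exists_minimizer_maxAffinity hf₀ hf₁ hf₀_pos hf₁_pos hε₀.le
      hε₁.le hdisj
    obtain ⟨g₀, g₁, lam₀, mu₀, lam₁, mu₁, hg, hlt, hS⟩ := hex u hu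
    have hsad : ∀ w ∈ Ioo (0 : ℝ) 1,
        RobustTest.affinity μ u g₀ g₁ ≤ RobustTest.affinity μ w g₀ g₁ := fun w hw =>
      hg.saddle hf₀ hf₁ hf₀_pos hf₁_pos hε₀ hε₁ hdisj hu hmin hw
    have hstrict : ∀ v ∈ Ioo (0 : ℝ) 1, v ≠ u → ∀ h₀ h₁ : Ω → ℝ,
        RobustTest.SolvesMaximization μ f₀ f₁ ε₀ ε₁ v h₀ h₁ →
        RobustTest.affinity μ u g₀ g₁ < RobustTest.affinity μ v h₀ h₁ := by
      intro v hv hvu h₀ h₁ hh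
      rw [(hjoint v hv h₀ h₁ hh).affinity_eq]
      exact RobustTest.maxAffinity_lt_of_saddle hS.pos₀ hS.pos₁ hg hlt hu hsad hv hvu
    refine ⟨u, g₀, g₁, lam₀, mu₀, lam₁, mu₁,
      ⟨hu, hg.solvesMaximization hS.pos₀ hS.pos₁, hsad⟩, fun v h₀ h₁ hh => ?_, hS.lam₀_pos,
      hS.lam₁_pos, hS.areKKTMultipliers hf₀_pos hf₁_pos hu, hS.hasParametricForm hf₀_pos hf₁_pos,
      fun v h₀ h₁ hv hvu hh => hstrict v hv hvu h₀ h₁ hh⟩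
    have hvu : v = u := by
      by_contra hne
      have h1 := hstrict v hh.mem_Ioo hne h₀ h₁ hh.maximization
      have h2 := hh.minimization u hu
      have h3 := hg.le h₀ hh.maximization.mem₀.1 h₁ hh.maximization.mem₁.1
      linarith
    subst hvu
    obtain ⟨e₀, e₁⟩ := hg.ae_eq hf₀ hf₁ hf₀_pos hf₁_pos hε₀ hε₁ hu
      (hjoint v hu h₀ h₁ hh.maximization) hlt
    exact ⟨rfl, e₀.symm, e₁.symm⟩
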